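/- For every integer $n \ge 177$ there exists a connected planar $K_2$-hypohamiltonian graph of order $n$. Here graphs are finite and simple, the order is the number of vertices, a graph is hamiltonian if it has a cycle through all of its vertices, and a connected graph $G$ is called $K_2$-hypohamiltonian if $G$ itself is not hamiltonian, but for any two adjacent vertices $v, w$ of $G$ the graph $G - v - w$ is hamiltonian. -/

import Mathlib

/-- The Euclidean plane. -/
abbrev Plane : Type := EuclideanSpace ℝ (Fin 2)

/-- A graph is planar if it can be drawn in the plane without crossings: vertices are distinct
points, every edge is a simple arc joining the points of its two ends, the interior of an edge
contains no vertex, and the interiors of distinct edges are disjoint. -/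
def IsPlanar {V : Type*} (G : SimpleGraph V) : Prop :=
  ∃ (p : V → Plane) (γ : G.edgeSet → C(unitInterval, Plane)),
    Function.Injective p ∧
    (∀ e, Function.Injective (γ e)) ∧
    (∀ e, s(γ e 0, γ e 1) = Sym2.map p e) ∧
    (∀ e, ∀ t ∈ Set.Ioo (0 : unitInterval) 1, ∀ v, γ e t ≠ p v) ∧
    (∀ e e', e ≠ e' → ∀ t ∈ Set.Ioo (0 : unitInterval) 1,
      ∀ t' ∈ Set.Ioo (0 : unitInterval) 1, γ e t ≠ γ e' t')

/-- A graph is `K₂`-hamiltonian if the removal of any pair of adjacent vertices yields a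
hamiltonian graph. -/
def IsK2Hamiltonian {V : Type*} [Fintype V] [DecidableEq V] (G : SimpleGraph V) : Prop :=
  ∀ v w : V, G.Adj v w → (G.induce {x : V | x ≠ v ∧ x ≠ w}).IsHamiltonian

/-- A graph is `K₂`-hypohamiltonian if it is `K₂`-hamiltonian yet non-hamiltonian. -/
def IsK2Hypohamiltonian {V : Type*} [Fintype V] [DecidableEq V] (G : SimpleGraph V) : Prop :=
  IsK2Hamiltonian G ∧ ¬ G.IsHamiltonian

/-!
A plane graph all of whose faces but one have length congruent to `2` modulo `3` has no Hamiltonian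
cycle unless its order is congruent to `2` modulo `3`. Indeed a Hamiltonian cycle cuts the faces into
two classes, each of them a tree in the dual graph. Counting the incidences between edges and faces
in the class that avoids the exceptional face, with `a` faces and hence `a - 1` edges off the cycle,
gives `2 * a` modulo `3` on one side and `n + 2 * (a - 1)` on the other
(`FaceStructure.not_isCycle`). This provides small planar `K₂`-hypohamiltonian graphs: plane graphs
with one triangle, one octagon and otherwise pentagons, of order `1` modulo `3`, in which the required
cycles missing two adjacent vertices are exhibited one by one.

Larger orders are reached by gluing. If `x` is a cubic vertex of `G` and `y` a cubic vertex of `H`,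
delete both and identify the neighbours of `x` with those of `y`. A Hamiltonian cycle of the result
is cut by the three identified vertices into three segments, each inside one of the two parts. One part
contains exactly two of them, which form a path covering this part, and this path closes up through
`x` or `y` to a Hamiltonian cycle of `G` or `H` (`IsGluing.not_hasCycleOn`). Conversely, the cycles of `G`
and `H` missing one or two vertices combine to cycles of the result missing two adjacent vertices
(`IsGluing.hasCycleOn_sdiff_edge`). The order of the result is `|G| + |H| - 5`.

All graphs glued here are pieces (`IsPiece`): they have two cubic vertices on a common face, the octagon,
and are drawn in a vertical strip whose two boundary lines carry the neighbours of these vertices at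
standard heights. Chains of pieces are therefore drawn by placing strips side by side
(`IsRightCap.glueAt`). Pieces of the eight orders `46, 49, 55, 79, 94, 97, 103, 106` suffice: every
integer from `172` on is a sum of the numbers obtained from these orders by subtracting five
(`exists_isRightCap`). A piece is given by numerical data from which all of its properties are
checked by computation (`PieceData.isPiece`).
-/

/-! ### Paths and cycles with a prescribed vertex set -/

section Paths

variable {V W : Type*}

/-- `G` has a path with at least one edge, ends `u` and `v`, and vertex set exactly `S`.
The path is recorded by the list `m` of its interior vertices; `u ≠ v` is forced by `Nodup`. -/
def HasPathOn (G : SimpleGraph V) (S : Set V) (u v : V) : Prop :=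
  ∃ m : List V, (u :: (m ++ [v])).IsChain G.Adj ∧ (u :: (m ++ [v])).Nodup ∧
    ∀ w, w ∈ u :: (m ++ [v]) ↔ w ∈ S

/-- `G` has a cycle with vertex set exactly `S`: a path with at least three vertices whose ends
are adjacent. -/
def HasCycleOn (G : SimpleGraph V) (S : Set V) : Prop :=
  ∃ (u v : V) (m : List V), m ≠ [] ∧ G.Adj v u ∧ (u :: (m ++ [v])).IsChain G.Adj ∧
    (u :: (m ++ [v])).Nodup ∧ ∀ w, w ∈ u :: (m ++ [v]) ↔ w ∈ S

namespace HasPathOn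

variable {G : SimpleGraph V} {S : Set V} {u v : V}

theorem ne (h : HasPathOn G S u v) : u ≠ v := by
  obtain ⟨m, -, h, -⟩ := h
  rintro rfl
  simp at h

theorem left_mem (h : HasPathOn G S u v) : u ∈ S := by
  obtain ⟨m, -, -, h⟩ := h
  exact (h u).1 (by simp)

theorem right_mem (h : HasPathOn G S u v) : v ∈ S := by
  obtain ⟨m, -, -, h⟩ := h
  exact (h v).1 (by simp)

theorem symm (h : HasPathOn G S u v) : HasPathOn G S v u := by
  obtain ⟨m, hc, hn, hm⟩ := h
  have e : v :: (m.reverse ++ [u]) = (u :: (m ++ [v])).reverse := by simp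
  refine ⟨m.reverse, ?_, ?_, ?_⟩
  · rw [e, List.isChain_reverse]
    exact hc.imp fun _ _ h => h.symm
  · rw [e]; exact List.nodup_reverse.2 hn
  · intro w; rw [e, List.mem_reverse, hm]

theorem map {H : SimpleGraph W} (f : V → W) (hf : Set.InjOn f S)
    (hadj : ∀ a ∈ S, ∀ b ∈ S, G.Adj a b → H.Adj (f a) (f b)) (h : HasPathOn G S u v) :
    HasPathOn H (f '' S) (f u) (f v) := by
  obtain ⟨m, hc, hn, hm⟩ := h
  have e : f u :: (m.map f ++ [f v]) = (u :: (m ++ [v])).map f := by simp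
  refine ⟨m.map f, ?_, ?_, ?_⟩
  · rw [e, List.isChain_map]
    exact hc.imp_of_mem_imp fun a b ha hb hab => hadj a ((hm a).1 ha) b ((hm b).1 hb) hab
  · rw [e]
    exact hn.map_on fun a ha b hb hab => hf ((hm a).1 ha) ((hm b).1 hb) hab
  · intro w; rw [e, List.mem_map]
    simp only [hm, Set.mem_image]

/-- A path closes up through a new vertex adjacent to its two ends. -/
theorem hasCycleOn_insert {x : V} (h : HasPathOn G S u v) (hx : x ∉ S) (hu : G.Adj x u)
    (hv : G.Adj x v) : HasCycleOn G (insert x S) := by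
  obtain ⟨m, hc, hn, hm⟩ := h
  refine ⟨x, v, u :: m, by simp, hv.symm, ?_, ?_, ?_⟩
  · simpa using ⟨hu, hc⟩
  · have : x ∉ u :: (m ++ [v]) := fun h => hx ((hm x).1 h)
    simpa using List.nodup_cons.2 ⟨this, hn⟩
  · intro w
    rw [Set.mem_insert_iff, ← hm]
    simp

/-- Two paths with the same non-adjacent ends and no other common vertex form a cycle. -/
theorem hasCycleOn_union {S' : Set V} (h : HasPathOn G S u v) (h' : HasPathOn G S' u v)
    (hS : ∀ w, w ∈ S → w ∈ S' → w = u ∨ w = v) (huv : ¬ G.Adj u v) :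
    HasCycleOn G (S ∪ S') := by
  obtain ⟨m, hc, hn, hm⟩ := h
  obtain ⟨m', hc', hn', hm'⟩ := h'.symm
  rcases m' with _ | ⟨z, m'⟩
  · exact absurd (by simpa using hc') (fun h => huv (SimpleGraph.Adj.symm h))
  have hlast : ∃ m'' y, z :: m' = m'' ++ [y] := by
    rcases List.eq_nil_or_concat (z :: m') with h | ⟨a, b, h⟩
    · simp at h
    · exact ⟨a, b, by simpa using h⟩
  obtain ⟨m'', y, e⟩ := hlast
  rw [e] at hc' hn' hm'
  have hdis : ∀ w ∈ m'' ++ [y], w ∉ u :: (m ++ [v]) := by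
    intro w hw hw'
    have h1 := (hm w).1 hw'
    have h2 := (hm' w).1 (by simp at hw ⊢; tauto)
    rcases hS w h1 h2 with rfl | rfl
    · simp [List.nodup_append] at hn' hw; grind
    · simp at hn' hw; grind
  refine ⟨u, y, m ++ v :: m'', by simp, ?_, ?_, ?_, ?_⟩
  · have : (v :: m'' ++ [y, u]).IsChain G.Adj := by simpa using hc'
    rw [List.isChain_append] at this
    simpa using this.2.1
  · have h1 : (v :: (m'' ++ [y])).IsChain G.Adj := by
      have : (v :: (m'' ++ [y]) ++ [u]).IsChain G.Adj := by simpa using hc'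
      exact this.left_of_append
    have e2 : u :: (m ++ v :: m'' ++ [y]) = (u :: m) ++ v :: (m'' ++ [y]) := by simp
    rw [e2, List.isChain_split]
    exact ⟨by simpa using hc, h1⟩
  · have e2 : u :: (m ++ v :: m'' ++ [y]) = (u :: (m ++ [v])) ++ (m'' ++ [y]) := by simp
    rw [e2, List.nodup_append']
    refine ⟨hn, ?_, fun w hw hw' => hdis w hw' hw⟩
    have := (List.nodup_cons.1 hn').2
    exact (List.nodup_append'.1 this).1
  · intro w
    have e2 : u :: (m ++ v :: m'' ++ [y]) = (u :: (m ++ [v])) ++ (m'' ++ [y]) := by simp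
    rw [e2, List.mem_append, hm, Set.mem_union, ← hm' w]
    have h3 := hm u
    have h4 := hm v
    simp at h3 h4 ⊢
    grind

end HasPathOn

namespace HasCycleOn

variable {G : SimpleGraph V} {S : Set V}

theorem map {H : SimpleGraph W} (f : V → W) (hf : Set.InjOn f S)
    (hadj : ∀ a ∈ S, ∀ b ∈ S, G.Adj a b → H.Adj (f a) (f b)) (h : HasCycleOn G S) :
    HasCycleOn H (f '' S) := by
  obtain ⟨u, v, m, h0, hvu, hc, hn, hm⟩ := h
  obtain ⟨m', h1, h2, h3⟩ := HasPathOn.map f hf hadj ⟨m, hc, hn, hm⟩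
  have hl : ((u :: (m ++ [v])).map f).length = (f u :: (m' ++ [f v])).length := by
    have hn' : ((u :: (m ++ [v])).map f).Nodup :=
      hn.map_on fun a ha b hb hab => hf ((hm a).1 ha) ((hm b).1 hb) hab
    refine ((List.perm_ext_iff_of_nodup hn' h2).2 fun w => ?_).length_eq
    simp only [h3, List.mem_map, hm, Set.mem_image]
  refine ⟨f u, f v, m', ?_, hadj _ ((hm v).1 (by simp)) _ ((hm u).1 (by simp)) hvu, h1, h2, h3⟩
  rintro rfl
  simp at hl
  exact h0 hl

/-- A cycle can be started at any of its vertices. -/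
theorem exists_path_of_mem {x : V} (h : HasCycleOn G S) (hx : x ∈ S) :
    ∃ u v, G.Adj x u ∧ G.Adj x v ∧ HasPathOn G (S \ {x}) u v := by
  obtain ⟨a, b, m, h0, hba, hc, hn, hm⟩ := h
  obtain ⟨s, t, e⟩ := List.append_of_mem ((hm x).2 hx)
  -- the rest of the cycle, read from the successor of `x` round to its predecessor
  have key : ∃ l : List V, 2 ≤ l.length ∧ l.IsChain G.Adj ∧ l.Nodup ∧ (∀ w, w ∈ l ↔ w ∈ S \ {x}) ∧
      (∀ w ∈ l.head?, G.Adj x w) ∧ (∀ w ∈ l.getLast?, G.Adj x w) := by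
    have hlen : 2 ≤ (t ++ s).length := by
      have := congrArg List.length e
      have h1 : 0 < m.length := List.length_pos_iff.2 h0
      simp at this ⊢; omega
    have hcx := hc
    rw [e, List.isChain_append] at hcx
    obtain ⟨hs, hxt, hsx⟩ := hcx
    have hhead : ∀ w ∈ (s ++ x :: t).head?, w = a := by rw [← e]; simp
    have hlast : ∀ w ∈ (s ++ x :: t).getLast?, w = b := by
      intro w hw
      have : (a :: (m ++ [b])).getLast? = some b := List.getLast?_concat (l := a :: m)
      rw [← e, this] at hw
      simpa using hw.symm
    have hnd : (x :: (t ++ s)).Nodup := by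
      have h2 : (x :: (t ++ s)).Perm (s ++ x :: t) :=
        (List.perm_append_comm (l₁ := x :: t) (l₂ := s))
      rw [h2.nodup_iff, ← e]; exact hn
    refine ⟨t ++ s, hlen, ?_, (List.nodup_cons.1 hnd).2, ?_, ?_, ?_⟩
    · rw [List.isChain_append]
      refine ⟨hxt.tail, hs, ?_⟩
      intro p hp q hq
      have h1 : p = b := by
        apply hlast
        cases t with
        | nil => simp at hp
        | cons t0 t => simpa [List.getLast?_append, List.getLast?_cons] using hp
      have h2 : q = a := by
        apply hhead
        cases s with
        | nil => simp at hq
        | cons t0 t => simpa using hq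
      rw [h1, h2]; exact hba
    · intro w
      have h1 := hm w
      rw [e] at h1
      have h2 := (List.nodup_cons.1 hnd).1
      rw [Set.mem_sdiff, ← h1, Set.mem_singleton_iff]
      simp only [List.mem_append, List.mem_cons] at h2 ⊢
      constructor
      · rintro h; refine ⟨by tauto, ?_⟩; rintro rfl; tauto
      · tauto
    · intro w hw
      cases t with
      | nil =>
        have h1 : w = a := by
          apply hhead; cases s with
          | nil => simp at hw
          | cons _ _ => simpa using hw
        have h2 : x = b := by apply hlast; simp
        rw [h1, h2]; exact hba
      | cons t0 t =>
        have : w = t0 := by simpa using hw.symm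
        rw [this]
        exact (List.isChain_cons_cons.1 hxt).1
    · intro w hw
      rcases List.eq_nil_or_concat s with rfl | ⟨s', y, rfl⟩
      · have h2 : x = a := by apply hhead; simp
        have h1 : w = b := by
          apply hlast; cases t with
          | nil => simp at hw
          | cons _ _ => simpa [List.getLast?_cons] using hw
        rw [h1, h2]; exact hba.symm
      · have : w = y := by simpa [List.getLast?_append] using hw.symm
        rw [this]
        exact (hsx y (by simp) x (by simp)).symm
  obtain ⟨l, h2, h3, h4, h5, h6, h7⟩ := key
  obtain _ | ⟨u, l⟩ := l
  · simp at h2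
  rcases List.eq_nil_or_concat l with rfl | ⟨l', v, rfl⟩
  · simp at h2
  rw [List.concat_eq_append] at *
  refine ⟨u, v, h6 u (by simp), h7 v ?_, l', h3, h4, h5⟩
  exact List.getLast?_concat (l := u :: l')

end HasCycleOn

end Paths

/-! ### Gluing two graphs along three vertices -/

section Gluing

variable {V W : Type*}

/-- The properties of a graph piece with vertex set `A` and terminals `T` that matter for gluing:
no path between two terminals covers all of `A`, but such paths exist once a terminal or two
adjacent vertices are removed. -/
structure IsGluingSide (G : SimpleGraph V) (A T : Set V) : Prop where
  subset : T ⊆ A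
  no_path : ∀ u ∈ T, ∀ v ∈ T, ¬ HasPathOn G A u v
  path_sdiff_terminal : ∀ t ∈ T, ∃ u ∈ T, ∃ v ∈ T, HasPathOn G (A \ {t}) u v
  path_sdiff_edge : ∀ a ∈ A, ∀ b ∈ A, G.Adj a b → ∃ u ∈ T, ∃ v ∈ T, HasPathOn G (A \ {a, b}) u v
  not_adj : ∀ u ∈ T, ∀ v ∈ T, ¬ G.Adj u v
  nonempty : (A \ T).Nonempty

/-- Deleting a vertex `x` from a `K₂`-hypohamiltonian graph on `S` leaves a gluing side whose
terminals are the neighbours of `x`. -/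
theorem IsGluingSide.of_vertex {G : SimpleGraph V} {S T : Set V} {x : V} (hx : x ∈ S)
    (hT : ∀ u, G.Adj x u ↔ u ∈ T) (hTS : T ⊆ S) (hham : ¬ HasCycleOn G S)
    (hk1 : ∀ t ∈ T, HasCycleOn G (S \ {t}))
    (hk2 : ∀ a ∈ S, ∀ b ∈ S, G.Adj a b → HasCycleOn G (S \ {a, b}))
    (hT' : ∀ u ∈ T, ∀ v ∈ T, ¬ G.Adj u v) (hne : (S \ insert x T).Nonempty) :
    IsGluingSide G (S \ {x}) T where
  subset u hu := ⟨hTS hu, fun h => G.loopless.irrefl x ((hT x).2 (by rw [← h]; exact hu))⟩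
  no_path u hu v hv h := hham <| by
    have := h.hasCycleOn_insert (x := x) (by simp) ((hT u).2 hu) ((hT v).2 hv)
    rwa [Set.insert_sdiff_singleton, Set.insert_eq_of_mem hx] at this
  path_sdiff_terminal t ht := by
    have hxt : x ≠ t := ((hT t).2 ht).ne
    obtain ⟨u, v, hu, hv, h⟩ := (hk1 t ht).exists_path_of_mem (x := x) ⟨hx, hxt⟩
    refine ⟨u, (hT u).1 hu, v, (hT v).1 hv, ?_⟩
    rwa [Set.sdiff_sdiff_comm]
  path_sdiff_edge a ha b hb hab := by
    obtain ⟨u, v, hu, hv, h⟩ := (hk2 a ha.1 b hb.1 hab).exists_path_of_mem (x := x) ⟨hx, by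
      rintro (h | h)
      · exact ha.2 h.symm
      · exact hb.2 h.symm⟩
    refine ⟨u, (hT u).1 hu, v, (hT v).1 hv, ?_⟩
    rwa [Set.sdiff_sdiff_comm]
  not_adj := hT'
  nonempty := by
    obtain ⟨w, hw, hw'⟩ := hne
    exact ⟨w, ⟨hw, fun h => hw' (Or.inl h)⟩, fun h => hw' (Or.inr h)⟩

/-- Gluing sides are transported along a map with a left inverse on the side. -/
theorem IsGluingSide.map {G : SimpleGraph V} {H : SimpleGraph W} {A T : Set V} (f : V → W)
    (g : W → V) (hg : ∀ a ∈ A, g (f a) = a)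
    (hadj : ∀ a ∈ A, ∀ b ∈ A, G.Adj a b ↔ H.Adj (f a) (f b)) (h : IsGluingSide G A T) :
    IsGluingSide H (f '' A) (f '' T) := by
  have hinj : Set.InjOn f A := fun a ha b hb hab => by rw [← hg a ha, hab, hg b hb]
  have himg : g '' (f '' A) = A := by
    rw [Set.image_image]
    exact (Set.image_congr hg).trans (Set.image_id' A)
  have hsd : ∀ B : Set V, B ⊆ A → f '' A \ f '' B = f '' (A \ B) := fun B hB =>
    (hinj.image_sdiff_subset hB).symm
  refine ⟨Set.image_mono h.subset, ?_, ?_, ?_, ?_, ?_⟩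
  · rintro _ ⟨u, hu, rfl⟩ _ ⟨v, hv, rfl⟩ hp
    have := hp.map (H := G) g (by
      rintro _ ⟨a, ha, rfl⟩ _ ⟨b, hb, rfl⟩ hab
      rw [hg a ha, hg b hb] at hab; rw [hab]) (by
      rintro _ ⟨a, ha, rfl⟩ _ ⟨b, hb, rfl⟩ hab
      rw [hg a ha, hg b hb]; exact (hadj a ha b hb).2 hab)
    rw [himg, hg u (h.subset hu), hg v (h.subset hv)] at this
    exact h.no_path u hu v hv this
  · rintro _ ⟨t, ht, rfl⟩
    obtain ⟨u, hu, v, hv, hp⟩ := h.path_sdiff_terminal t ht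
    refine ⟨f u, ⟨u, hu, rfl⟩, f v, ⟨v, hv, rfl⟩, ?_⟩
    rw [← Set.image_singleton, hsd _ (by simpa using h.subset ht)]
    exact hp.map f (hinj.mono Set.sdiff_subset) fun a ha b hb => (hadj a ha.1 b hb.1).1
  · rintro _ ⟨a, ha, rfl⟩ _ ⟨b, hb, rfl⟩ hab
    obtain ⟨u, hu, v, hv, hp⟩ := h.path_sdiff_edge a ha b hb ((hadj a ha b hb).2 hab)
    refine ⟨f u, ⟨u, hu, rfl⟩, f v, ⟨v, hv, rfl⟩, ?_⟩
    rw [← Set.image_pair, hsd _ (by rintro _ (rfl | rfl) <;> assumption)]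
    exact hp.map f (hinj.mono Set.sdiff_subset) fun a ha b hb => (hadj a ha.1 b hb.1).1
  · rintro _ ⟨u, hu, rfl⟩ _ ⟨v, hv, rfl⟩ hp
    exact h.not_adj u hu v hv ((hadj u (h.subset hu) v (h.subset hv)).2 hp)
  · rw [hsd _ h.subset]; exact h.nonempty.image f

/-- Two sets glued along exactly three terminals. -/
structure IsGluing (G : SimpleGraph V) (A B T : Set V) : Prop where
  left : IsGluingSide G A T
  right : IsGluingSide G B T
  inter : ∀ w, w ∈ A → w ∈ B → w ∈ T
  adj : ∀ a b, a ∈ A ∪ B → b ∈ A ∪ B → G.Adj a b → (a ∈ A ∧ b ∈ A) ∨ (a ∈ B ∧ b ∈ B)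
  card : ∃ t₁ t₂ t₃, t₁ ≠ t₂ ∧ t₁ ≠ t₃ ∧ t₂ ≠ t₃ ∧ ∀ t, t ∈ T ↔ t = t₁ ∨ t = t₂ ∨ t = t₃

namespace IsGluing

variable {G : SimpleGraph V} {A B T : Set V}

theorem symm (h : IsGluing G A B T) : IsGluing G B A T :=
  ⟨h.right, h.left, fun w h1 h2 => h.inter w h2 h1, fun a b ha hb hab =>
    (h.adj a b (ha.symm) (hb.symm) hab).symm, h.card⟩

/-- A path between two terminals that leaves out a part `D` of the right side is completed to a
cycle by the path of the left side that misses exactly the third terminal. -/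
theorem hasCycleOn_sdiff (h : IsGluing G A B T) {D : Set V} (hD : D ⊆ B) {u v : V} (hu : u ∈ T)
    (hv : v ∈ T) (hp : HasPathOn G (B \ D) u v) : HasCycleOn G ((A ∪ B) \ D) := by
  have huv := hp.ne
  have huD := hp.left_mem.2
  have hvD := hp.right_mem.2
  obtain ⟨t, ht, htu, htv, hT⟩ : ∃ t ∈ T, t ≠ u ∧ t ≠ v ∧ ∀ w ∈ T, w = t ∨ w = u ∨ w = v := by
    obtain ⟨t₁, t₂, t₃, h12, h13, h23, hT⟩ := h.card
    simp only [hT] at hu hv ⊢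
    by_cases h1 : t₁ ≠ u ∧ t₁ ≠ v
    · exact ⟨t₁, by simp, h1.1, h1.2, by grind⟩
    by_cases h2 : t₂ ≠ u ∧ t₂ ≠ v
    · exact ⟨t₂, by simp, h2.1, h2.2, by grind⟩
    · exact ⟨t₃, by simp, by grind, by grind, by grind⟩
  obtain ⟨u', hu', v', hv', hq⟩ := h.left.path_sdiff_terminal t ht
  have hq' : HasPathOn G (A \ {t}) u v := by
    have h1 := hq.ne
    have h2 := hq.left_mem.2
    have h3 := hq.right_mem.2
    simp only [Set.mem_singleton_iff] at h2 h3
    rcases hT u' hu' with e | rfl | rfl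
    · exact absurd e h2
    · rcases hT v' hv' with e | e | rfl
      · exact absurd e h3
      · exact absurd e.symm h1
      · exact hq
    · rcases hT v' hv' with e | rfl | e
      · exact absurd e h3
      · exact hq.symm
      · exact absurd e.symm h1
  have hc := hp.hasCycleOn_union hq' (fun w hw hw' => by
    have hwT := h.inter w hw'.1 hw.1
    have := hT w hwT
    have h2 : w ≠ t := hw'.2
    tauto) (h.left.not_adj u hu v hv)
  convert hc using 1
  ext w
  have hAt := h.right.subset ht
  have huA := h.left.subset hu
  have hvA := h.left.subset hv
  simp only [Set.mem_sdiff, Set.mem_union, Set.mem_singleton_iff]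
  constructor
  · rintro ⟨hw | hw, hwD⟩
    · by_cases e : w = t
      · subst e; exact Or.inl ⟨hAt, hwD⟩
      · exact Or.inr ⟨hw, e⟩
    · exact Or.inl ⟨hw, hwD⟩
  · rintro (⟨hw, hwD⟩ | ⟨hw, e⟩)
    · exact ⟨Or.inr hw, hwD⟩
    · refine ⟨Or.inl hw, fun hwD => ?_⟩
      have hwT := h.inter w hw (hD hwD)
      rcases hT w hwT with rfl | rfl | rfl
      · exact e rfl
      · exact huD hwD
      · exact hvD hwD

theorem hasCycleOn_sdiff_edge (h : IsGluing G A B T) {a b : V} (ha : a ∈ A ∪ B) (hb : b ∈ A ∪ B)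
    (hab : G.Adj a b) : HasCycleOn G ((A ∪ B) \ {a, b}) := by
  wlog hB : a ∈ B ∧ b ∈ B generalizing A B
  · have hA := (h.adj a b ha hb hab).resolve_right hB
    rw [Set.union_comm] at ha hb ⊢
    exact this h.symm ha hb hA
  obtain ⟨u, hu, v, hv, hp⟩ := h.right.path_sdiff_edge a hB.1 b hB.2 hab
  exact h.hasCycleOn_sdiff (by rintro _ (rfl | rfl) <;> tauto) hu hv hp

/-- A chain of vertices avoiding the terminals stays on one side. -/
theorem chain_side (h : IsGluing G A B T) {l : List V} (hc : l.IsChain G.Adj)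
    (hl : ∀ w ∈ l, w ∈ A ∪ B) (hT : ∀ w ∈ l, w ∉ T) : (∀ w ∈ l, w ∈ A) ∨ (∀ w ∈ l, w ∈ B) := by
  induction l with
  | nil => simp
  | cons x l ih =>
    cases l with
    | nil => simpa using hl
    | cons y l =>
      rw [List.isChain_cons_cons] at hc
      have hx := hT x (by simp)
      have hy := hT y (by simp)
      have hxy := h.adj x y (hl x (by simp)) (hl y (by simp)) hc.1
      have hi := h.inter y
      rcases ih hc.2 (fun w hw => hl w (by simp [hw])) (fun w hw => hT w (by simp [hw])) with h1 | h1
      · left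
        have := h1 y (by simp)
        intro w hw
        rcases List.mem_cons.1 hw with rfl | hw
        · tauto
        · exact h1 w hw
      · right
        have := h1 y (by simp)
        intro w hw
        rcases List.mem_cons.1 hw with rfl | hw
        · tauto
        · exact h1 w hw

end IsGluing

end Gluing

section Gluing

variable {V : Type*} {G : SimpleGraph V} {A B T : Set V}

/-- A cycle through the three terminals `x`, `y`, `z` (in this cyclic order), cut at them into
three segments with interiors `p`, `q` and `r`, and covering `S`. -/
structure IsThreeSegmentCycle (G : SimpleGraph V) (S T : Set V) (x y z : V) (p q r : List V) :
    Prop where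
  chain₁ : (x :: (p ++ [y])).IsChain G.Adj
  chain₂ : (y :: (q ++ [z])).IsChain G.Adj
  chain₃ : (z :: (r ++ [x])).IsChain G.Adj
  nodup : (x :: (p ++ y :: (q ++ z :: r))).Nodup
  mem : ∀ w, w ∈ x :: (p ++ y :: (q ++ z :: r)) ↔ w ∈ S
  terminal : ∀ t, t ∈ T ↔ t = x ∨ t = y ∨ t = z

namespace IsThreeSegmentCycle

variable {S : Set V} {x y z : V} {p q r : List V}

theorem rotate (h : IsThreeSegmentCycle G S T x y z p q r) :
    IsThreeSegmentCycle G S T y z x q r p := by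
  have hp : (y :: (q ++ z :: (r ++ x :: p))).Perm (x :: (p ++ y :: (q ++ z :: r))) := by
    have := List.perm_append_comm (l₁ := y :: (q ++ z :: r)) (l₂ := x :: p)
    simpa using this
  exact ⟨h.chain₂, h.chain₃, h.chain₁, hp.nodup_iff.2 h.nodup,
    fun w => by rw [hp.mem_iff, h.mem], fun t => by rw [h.terminal]; tauto⟩

theorem not_mem_terminal (h : IsThreeSegmentCycle G S T x y z p q r) :
    (∀ w ∈ p, w ∉ T) ∧ (∀ w ∈ q, w ∉ T) ∧ (∀ w ∈ r, w ∉ T) := by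
  have hn := h.nodup
  simp only [h.terminal]
  simp [List.nodup_append] at hn
  grind

/-- The two segments on one side would form a path between terminals covering that side. -/
theorem false_of_two (hg : IsGluing G A B T) (h : IsThreeSegmentCycle G (A ∪ B) T x y z p q r)
    (hp : ∀ w ∈ p, w ∈ A) (hq : ∀ w ∈ q, w ∈ B) (hr : ∀ w ∈ r, w ∈ B) : False := by
  have hx : x ∈ T := by simp [h.terminal]
  have hy : y ∈ T := by simp [h.terminal]
  have hz : z ∈ T := by simp [h.terminal]
  refine hg.right.no_path y hy x hx ⟨q ++ z :: r, ?_, ?_, ?_⟩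
  · have e : y :: (q ++ z :: r ++ [x]) = (y :: q) ++ z :: (r ++ [x]) := by simp
    rw [e, List.isChain_split]
    exact ⟨by simpa using h.chain₂, h.chain₃⟩
  · have hn := h.rotate.nodup
    have : (y :: (q ++ z :: r ++ [x])).Sublist (y :: (q ++ z :: (r ++ x :: p))) := by
      simp
    exact this.nodup hn
  · intro w
    have hm := h.mem w
    have hi := hg.inter w
    have h1 := hg.right.subset hx
    have h2 := hg.right.subset hy
    have h3 := hg.right.subset hz
    have h4 := h.not_mem_terminal.1 w
    simp only [List.mem_cons, List.mem_append, Set.mem_union, List.not_mem_nil, or_false] at hm ⊢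
    constructor
    · rintro (rfl | (hw | rfl | hw) | rfl)
      · exact h2
      · exact hq w hw
      · exact h3
      · exact hr w hw
      · exact h1
    · intro hw
      have h5 : w ∉ p := fun hwp => h4 hwp (hi (hp w hwp) hw)
      tauto

theorem false_of_three (hg : IsGluing G A B T) (h : IsThreeSegmentCycle G (A ∪ B) T x y z p q r)
    (hp : ∀ w ∈ p, w ∈ A) (hq : ∀ w ∈ q, w ∈ A) (hr : ∀ w ∈ r, w ∈ A) : False := by
  obtain ⟨w, hw, hwT⟩ := hg.right.nonempty
  have hm := (h.mem w).2 (Or.inr hw)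
  rw [h.terminal] at hwT
  have hi := hg.inter w
  rw [h.terminal] at hi
  simp only [List.mem_cons, List.mem_append] at hm
  have := hp w
  have := hq w
  have := hr w
  tauto

theorem not_of_isGluing (hg : IsGluing G A B T) :
    ¬ IsThreeSegmentCycle G (A ∪ B) T x y z p q r := by
  intro h
  have hT := h.not_mem_terminal
  have hmem : ∀ w, w ∈ p ∨ w ∈ q ∨ w ∈ r → w ∈ A ∪ B := fun w hw => by
    rw [← h.mem]; simp; tauto
  have hp := hg.chain_side (l := p) (h.chain₁.tail.left_of_append) (fun w hw => hmem w (by tauto))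
    hT.1
  have hq := hg.chain_side (l := q) (h.chain₂.tail.left_of_append) (fun w hw => hmem w (by tauto))
    hT.2.1
  have hr := hg.chain_side (l := r) (h.chain₃.tail.left_of_append) (fun w hw => hmem w (by tauto))
    hT.2.2
  have h' : IsThreeSegmentCycle G (B ∪ A) T x y z p q r := by rwa [Set.union_comm]
  rcases hp with hp | hp <;> rcases hq with hq | hq <;> rcases hr with hr | hr
  · exact h.false_of_three hg hp hq hr
  · exact h'.rotate.rotate.false_of_two hg.symm hr hp hq
  · exact h'.rotate.false_of_two hg.symm hq hr hp
  · exact h.false_of_two hg hp hq hr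
  · exact h'.false_of_two hg.symm hp hq hr
  · exact h.rotate.false_of_two hg hq hr hp
  · exact h.rotate.rotate.false_of_two hg hr hp hq
  · exact h'.false_of_three hg.symm hp hq hr

end IsThreeSegmentCycle

/-- A cycle covering a glued graph would be cut by the terminals into three segments, two of which
lie on a common side and together cover it. -/
theorem IsGluing.not_hasCycleOn (hg : IsGluing G A B T) : ¬ HasCycleOn G (A ∪ B) := by
  intro hc
  obtain ⟨t₁, t₂, t₃, h12, h13, h23, hT⟩ := hg.card
  have hTS : ∀ t ∈ T, t ∈ A ∪ B := fun t ht => Or.inl (hg.left.subset ht)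
  obtain ⟨u, v, hu, hv, m, hch, hn, hm⟩ :=
    hc.exists_path_of_mem (x := t₁) (hTS _ (by simp [hT]))
  -- the terminals `y`, `z` in the order in which the path meets them
  obtain ⟨y, z, p, q, r, e, hT⟩ : ∃ y z p q r, u :: (m ++ [v]) = p ++ y :: (q ++ z :: r) ∧
      ∀ t, t ∈ T ↔ t = t₁ ∨ t = y ∨ t = z := by
    have h2 : t₂ ∈ u :: (m ++ [v]) := (hm _).2 ⟨hTS _ (by simp [hT]), h12.symm⟩
    have h3 : t₃ ∈ u :: (m ++ [v]) := (hm _).2 ⟨hTS _ (by simp [hT]), h13.symm⟩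
    obtain ⟨s, r, e⟩ := List.append_of_mem h2
    rw [e] at h3
    rcases List.mem_append.1 h3 with h3 | h3
    · obtain ⟨s', r', rfl⟩ := List.append_of_mem h3
      exact ⟨t₃, t₂, s', r', r, by simp [e], fun t => by rw [hT]; tauto⟩
    · rcases List.mem_cons.1 h3 with h3 | h3
      · exact absurd h3.symm h23
      obtain ⟨s', r', rfl⟩ := List.append_of_mem h3
      exact ⟨t₂, t₃, s, s', r', e, hT⟩
  have hcyc : (t₁ :: (u :: (m ++ [v])) ++ [t₁]).IsChain G.Adj := by
    rw [List.isChain_append]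
    refine ⟨List.isChain_cons_cons.2 ⟨hu, hch⟩, by simp, ?_⟩
    intro a ha b hb
    have e1 : (t₁ :: (u :: (m ++ [v]))).getLast? = some v :=
      List.getLast?_concat (l := t₁ :: u :: m)
    rw [e1] at ha
    simp at ha hb
    rw [← ha, ← hb]; exact hv.symm
  rw [e] at hcyc hn hm
  have e2 : t₁ :: (p ++ y :: (q ++ z :: r)) ++ [t₁] = (t₁ :: p) ++ y :: (q ++ z :: (r ++ [t₁])) := by
    simp
  have e3 : y :: (q ++ z :: (r ++ [t₁])) = (y :: q) ++ z :: (r ++ [t₁]) := by simp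
  rw [e2, List.isChain_split] at hcyc
  obtain ⟨hcyc₁, hcyc₂⟩ := hcyc
  rw [e3, List.isChain_split] at hcyc₂
  refine IsThreeSegmentCycle.not_of_isGluing (x := t₁) (y := y) (z := z) (p := p) (q := q) (r := r)
    hg ⟨by simpa using hcyc₁, by simpa using hcyc₂.1, hcyc₂.2, ?_, ?_, hT⟩
  · refine List.nodup_cons.2 ⟨fun h => ?_, hn⟩
    exact ((hm _).1 h).2 rfl
  · intro w
    rw [List.mem_cons, hm]
    constructor
    · rintro (rfl | h)
      · exact hTS _ (by simp [hT])
      · exact h.1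
    · intro h
      by_cases e : w = t₁
      · exact Or.inl e
      · exact Or.inr ⟨h, e⟩

end Gluing

/-! ### Grinberg's criterion modulo three -/

section Grinberg

/-- A combinatorial plane graph: edges indexed by `ι`, the edge `i` having ends `src i`, `tgt i` and
lying on the faces `left i`, `right i`. The vertices are counted by `n`. Planarity enters through
three facts only: around each vertex every face is met an even number of times, the dual graph is
connected, and Euler's formula holds. -/
structure FaceStructure (V ι Φ : Type*) [DecidableEq V] [Fintype ι] [Fintype Φ] (n : ℕ) where
  src : ι → V
  tgt : ι → V
  left : ι → Φ
  right : ι → Φ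
  even_vertex : ∀ (b : Φ → ZMod 2) (x : V),
    ∑ i with src i = x ∨ tgt i = x, (b (left i) + b (right i)) = 0
  dual_connected : ∀ S : Set Φ, S.Nonempty → (∀ i, left i ∈ S ↔ right i ∈ S) → S = Set.univ
  euler : n + Fintype.card Φ = Fintype.card ι + 2

namespace FaceStructure

variable {V ι Φ : Type*} [DecidableEq V] [Fintype ι] [Fintype Φ] {n : ℕ}

/-- A set of faces is closed under a set of edges if it contains both or none of the two faces at
each of these edges. -/
def Closed (F : FaceStructure V ι Φ n) (D : Set ι) (S : Set Φ) : Prop :=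
  ∀ i ∈ D, F.left i ∈ S ↔ F.right i ∈ S

/-- The component of the face `a` in the dual graph with edge set `D`. -/
def component (F : FaceStructure V ι Φ n) (D : Set ι) (a : Φ) : Set Φ :=
  {x | ∀ S, F.Closed D S → a ∈ S → x ∈ S}

variable (F : FaceStructure V ι Φ n)

theorem mem_component (D : Set ι) (a : Φ) : a ∈ F.component D a := fun _ _ h => h

theorem closed_component (D : Set ι) (a : Φ) : F.Closed D (F.component D a) := fun i hi =>
  ⟨fun h S hS ha => (hS i hi).1 (h S hS ha), fun h S hS ha => (hS i hi).2 (h S hS ha)⟩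

theorem component_subset {D : Set ι} {a : Φ} {S : Set Φ} (hS : F.Closed D S) (ha : a ∈ S) :
    F.component D a ⊆ S := fun _ hx => hx S hS ha

/-- A component of the dual graph has at most one more vertex than it has edges. -/
theorem ncard_component_le (D : Set ι) (a : Φ) :
    (F.component D a).ncard ≤ {i | i ∈ D ∧ F.left i ∈ F.component D a}.ncard + 1 := by
  classical
  set A := F.component D a with hA
  -- a largest set around `a` that has at most one more vertex than edges
  let P : Finset (Finset Φ) := Finset.univ.filter fun S => a ∈ S ∧ (∀ x ∈ S, x ∈ A) ∧
    S.card ≤ {i | i ∈ D ∧ F.left i ∈ S ∧ F.right i ∈ S}.ncard + 1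
  have hP : P.Nonempty := ⟨{a}, by
    simp only [P, Finset.mem_filter, Finset.mem_univ, true_and, Finset.mem_singleton,
      Finset.card_singleton, le_add_iff_nonneg_left, zero_le, and_true]
    rintro x rfl
    exact F.mem_component D x⟩
  obtain ⟨S, hSP, hmax⟩ := P.exists_max_image Finset.card hP
  simp only [P, Finset.mem_filter, Finset.mem_univ, true_and] at hSP hmax
  obtain ⟨haS, hSA, hcard⟩ := hSP
  have hclosed : F.Closed D (S : Set Φ) := by
    by_contra hcon
    simp only [Closed, not_forall] at hcon
    obtain ⟨i, hi, hcon⟩ := hcon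
    have hAi := F.closed_component D a i hi
    rw [← hA] at hAi
    obtain ⟨x, hxA, hxS, hins⟩ : ∃ x, x ∈ A ∧ x ∉ S ∧ F.left i ∈ insert x S ∧
        F.right i ∈ insert x S := by
      by_cases hl : F.left i ∈ S
      · have hr : F.right i ∉ S := fun hr => hcon (by simp [hl, hr])
        exact ⟨F.right i, hAi.1 (hSA _ hl), hr, by simp [hl], by simp⟩
      · have hr : F.right i ∈ S := by
          by_contra hr; exact hcon (by simp [hl, hr])
        exact ⟨F.left i, hAi.2 (hSA _ hr), hl, by simp, by simp [hr]⟩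
    have hlt : {i | i ∈ D ∧ F.left i ∈ S ∧ F.right i ∈ S}.ncard <
        {i | i ∈ D ∧ F.left i ∈ insert x S ∧ F.right i ∈ insert x S}.ncard := by
      apply Set.ncard_lt_ncard _ (Set.toFinite _)
      refine ⟨fun j hj => ?_, fun hsub => ?_⟩
      · simp only [Set.mem_ofPred_eq, Finset.mem_insert] at hj ⊢
        tauto
      · have := hsub (show i ∈ {i | _} from ⟨hi, hins⟩)
        exact hcon (by simp [this.2.1, this.2.2])
    have hcx := Finset.card_insert_of_notMem hxS
    have := hmax (insert x S) ⟨by simp [haS], by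
      intro y hy
      rcases Finset.mem_insert.1 hy with rfl | hy
      · exact hxA
      · exact hSA y hy, by omega⟩
    omega
  have hAS : A = (S : Set Φ) := Set.ext fun x =>
    ⟨fun hx => F.component_subset hclosed (by simpa using haS) hx, fun hx => hSA x hx⟩
  rw [hAS, Set.ncard_coe_finset]
  refine hcard.trans (Nat.add_le_add_right (Set.ncard_le_ncard (fun i hi => ?_) (Set.toFinite _)) 1)
  exact ⟨hi.1, hi.2.1⟩

/-- The edges of a closed walk `c : ZMod n → V` in a face structure. -/
structure IsCycle (c : ZMod n → V) (e : ZMod n → ι) : Prop where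
  three_le : 3 ≤ n
  injective : Function.Injective c
  ends : ∀ k, (F.src (e k) = c k ∧ F.tgt (e k) = c (k + 1)) ∨
    (F.src (e k) = c (k + 1) ∧ F.tgt (e k) = c k)

namespace IsCycle

variable {F} {c : ZMod n → V} {e : ZMod n → ι}

theorem two_ne_zero (h : F.IsCycle c e) : (2 : ZMod n) ≠ 0 := by
  intro h0
  have : ((2 : ℕ) : ZMod n) = 0 := by exact_mod_cast h0
  rw [ZMod.natCast_eq_zero_iff] at this
  have := Nat.le_of_dvd (by norm_num) this
  have := h.three_le
  omega

theorem one_ne_zero (h : F.IsCycle c e) : (1 : ZMod n) ≠ 0 := by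
  intro h0
  apply h.two_ne_zero
  rw [← one_add_one_eq_two, h0, add_zero]

theorem mem_ends (h : F.IsCycle c e) (j k : ZMod n) :
    (F.src (e j) = c k ∨ F.tgt (e j) = c k) ↔ (j = k ∨ j + 1 = k) := by
  rcases h.ends j with ⟨h1, h2⟩ | ⟨h1, h2⟩
  · rw [h1, h2, h.injective.eq_iff, h.injective.eq_iff]
  · rw [h1, h2, h.injective.eq_iff, h.injective.eq_iff, or_comm]

theorem injective_edge (h : F.IsCycle c e) : Function.Injective e := by
  intro j k hjk
  have h1 := (h.mem_ends k j).1 (by rw [← hjk]; exact (h.mem_ends j j).2 (Or.inl rfl))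
  have h2 := (h.mem_ends k (j + 1)).1 (by rw [← hjk]; exact (h.mem_ends j (j + 1)).2 (Or.inr rfl))
  rcases h1 with h1 | h1
  · exact h1.symm
  · rcases h2 with h2 | h2
    · rw [h2] at h1
      exact absurd (by linear_combination h1) h.two_ne_zero
    · exact (add_right_cancel h2).symm

/-- A set of faces that is not separated by any edge outside a cycle, nor by one edge of the cycle,
is trivial: its boundary is an even subgraph of a path. -/
theorem eq_univ_of_closed (h : F.IsCycle c e) {S : Set Φ} (hne : S.Nonempty)
    (hS : F.Closed (Set.range e)ᶜ S) {k₀ : ZMod n}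
    (hk₀ : F.left (e k₀) ∈ S ↔ F.right (e k₀) ∈ S) : S = Set.univ := by
  classical
  let b : Φ → ZMod 2 := fun x => if x ∈ S then 1 else 0
  have hb : ∀ i, b (F.left i) + b (F.right i) = 0 ↔ (F.left i ∈ S ↔ F.right i ∈ S) := by
    intro i
    by_cases h1 : F.left i ∈ S <;> by_cases h2 : F.right i ∈ S <;> simp [b, h1, h2]
    decide
  have hstep : ∀ k, b (F.left (e k)) + b (F.right (e k)) =
      b (F.left (e (k + 1))) + b (F.right (e (k + 1))) := by
    intro k
    have hev := F.even_vertex b (c (k + 1))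
    have hne' : e k ≠ e (k + 1) := fun hh => h.one_ne_zero (by
      have := h.injective_edge hh
      linear_combination -this)
    rw [← Finset.sum_subset (s₁ := {e k, e (k + 1)}), Finset.sum_pair hne'] at hev
    · generalize b (F.left (e k)) + b (F.right (e k)) = x at *
      generalize b (F.left (e (k + 1))) + b (F.right (e (k + 1))) = y at *
      revert x y; decide
    · intro i hi
      rw [Finset.mem_filter]
      refine ⟨Finset.mem_univ _, ?_⟩
      rcases Finset.mem_insert.1 hi with rfl | hi
      · exact (h.mem_ends _ _).2 (Or.inr rfl)
      · rw [Finset.mem_singleton.1 hi]; exact (h.mem_ends _ _).2 (Or.inl rfl)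
    · intro i hi hi'
      rw [Finset.mem_filter] at hi
      by_cases hr : i ∈ Set.range e
      · obtain ⟨j, rfl⟩ := hr
        rcases (h.mem_ends _ _).1 hi.2 with rfl | hj
        · simp at hi'
        · rw [add_right_cancel hj] at hi'; simp at hi'
      · exact (hb i).2 (hS i hr)
  have hall : ∀ m : ℕ, b (F.left (e (k₀ + m))) + b (F.right (e (k₀ + m))) = 0 := by
    intro m
    induction m with
    | zero => simpa using (hb _).2 hk₀
    | succ m ih =>
      rw [hstep] at ih
      push_cast
      rwa [← add_assoc]
  have : NeZero n := ⟨by have := h.three_le; omega⟩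
  refine F.dual_connected S hne fun i => ?_
  by_cases hr : i ∈ Set.range e
  · obtain ⟨j, rfl⟩ := hr
    have := hall (j - k₀).val
    rw [ZMod.natCast_zmod_val, add_sub_cancel] at this
    exact (hb _).1 this
  · exact hS i hr

/-- The two sides of a Hamiltonian cycle: the edges off the cycle join faces of the same side, the
edges of the cycle join faces of different sides, and each side is a tree in the dual graph.
The side chosen here is the one avoiding a given face. -/
theorem exists_side (h : F.IsCycle c e) (f₀ : Φ) : ∃ A : Set Φ, f₀ ∉ A ∧
    (∀ i, i ∉ Set.range e → (F.left i ∈ A ↔ F.right i ∈ A)) ∧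
    (∀ k, ¬ (F.left (e k) ∈ A ↔ F.right (e k) ∈ A)) ∧
    A.ncard = {i | i ∉ Set.range e ∧ F.left i ∈ A}.ncard + 1 := by
  set D : Set ι := (Set.range e)ᶜ with hD
  set a := F.left (e 0) with ha
  set b := F.right (e 0) with hb
  set A := F.component D a with hA
  set B := F.component D b with hB
  have : NeZero n := ⟨by have := h.three_le; omega⟩
  have hcA := F.closed_component D a
  have hcB := F.closed_component D b
  have haA := F.mem_component D a
  have hbB := F.mem_component D b
  have hcardA := F.ncard_component_le D a
  have hcardB := F.ncard_component_le D b
  rw [← hA] at hcA haA hcardA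
  rw [← hB] at hcB hbB hcardB
  have hcardD : n + D.ncard = Fintype.card ι := by
    have h1 := Set.ncard_add_ncard_compl (Set.range e)
    rwa [← Set.image_univ, Set.ncard_image_of_injective _ h.injective_edge, Set.ncard_univ,
      Set.image_univ, Nat.card_zmod, Nat.card_eq_fintype_card] at h1
  have heuler := F.euler
  have hcardΦ : (Set.univ : Set Φ).ncard = Fintype.card Φ := by
    rw [Set.ncard_univ, Nat.card_eq_fintype_card]
  have hAne : A ≠ Set.univ := by
    intro hu
    have h2 : {i | i ∈ D ∧ F.left i ∈ A}.ncard ≤ D.ncard :=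
      Set.ncard_le_ncard (fun i hi => hi.1) (Set.toFinite _)
    rw [hu, hcardΦ] at hcardA
    rw [hu] at h2
    omega
  have hbA : b ∉ A := fun hbA =>
    hAne (h.eq_univ_of_closed ⟨a, haA⟩ hcA (k₀ := 0) (by simp [← ha, ← hb, haA, hbA]))
  have hBA : ∀ x ∈ B, x ∉ A := by
    have : F.Closed D Aᶜ := fun i hi => not_congr (hcA i hi)
    exact fun x hx => F.component_subset this hbA hx
  have hAB : A ∪ B = Set.univ := by
    refine h.eq_univ_of_closed ⟨a, Or.inl haA⟩ (fun i hi => or_congr (hcA i hi) (hcB i hi))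
      (k₀ := 0) ?_
    rw [← ha, ← hb]
    exact ⟨fun _ => Or.inr hbB, fun _ => Or.inl haA⟩
  have hBne : B ≠ Set.univ := fun hu => hBA a (by rw [hu]; trivial) haA
  have hBc : B = Aᶜ := Set.ext fun x => ⟨hBA x, fun hx => by
    have : x ∈ A ∪ B := by rw [hAB]; trivial
    exact this.resolve_left hx⟩
  have hsumV : A.ncard + B.ncard = Fintype.card Φ := by
    rw [hBc, Set.ncard_add_ncard_compl, Nat.card_eq_fintype_card]
  have hsumE : {i | i ∈ D ∧ F.left i ∈ A}.ncard + {i | i ∈ D ∧ F.left i ∈ B}.ncard = D.ncard := by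
    rw [hBc]
    exact Set.ncard_inter_add_ncard_sdiff_eq_ncard D {i | F.left i ∈ A} (Set.toFinite _)
  have key : ∀ X : Set Φ, X ≠ Set.univ → X.Nonempty → F.Closed D X → f₀ ∉ X →
      X.ncard = {i | i ∈ D ∧ F.left i ∈ X}.ncard + 1 →
      ∃ A : Set Φ, f₀ ∉ A ∧ (∀ i, i ∉ Set.range e → (F.left i ∈ A ↔ F.right i ∈ A)) ∧
      (∀ k, ¬ (F.left (e k) ∈ A ↔ F.right (e k) ∈ A)) ∧
      A.ncard = {i | i ∉ Set.range e ∧ F.left i ∈ A}.ncard + 1 :=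
    fun X hX hXn hXD hf hcard => ⟨X, hf, hXD, fun k hk => hX (h.eq_univ_of_closed hXn hXD hk), hcard⟩
  by_cases hf : f₀ ∈ A
  · exact key B hBne ⟨b, hbB⟩ hcB (fun hx => hBA _ hx hf) (by omega)
  · exact key A hAne ⟨a, haA⟩ hcA hf (by omega)

end IsCycle

/-- The length of a face, as the number of its incidences with edges. -/
noncomputable def faceLength (x : Φ) : ℕ := {i | F.left i = x}.ncard + {i | F.right i = x}.ncard

/-- **Grinberg's criterion** modulo three: a plane graph in which all faces but one have length
congruent to `2` modulo `3` has no Hamiltonian cycle unless its order is congruent to `2`. -/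
theorem not_isCycle (f₀ : Φ) (hf : ∀ x, x ≠ f₀ → F.faceLength x % 3 = 2) (hn : n % 3 ≠ 2)
    (c : ZMod n → V) (e : ZMod n → ι) : ¬ F.IsCycle c e := by
  classical
  intro h
  have : NeZero n := ⟨by have := h.three_le; omega⟩
  obtain ⟨A, hfA, hD, hC, hcard⟩ := h.exists_side f₀
  have hsum : ∀ (p : ι → Prop) [DecidablePred p], {i | p i}.ncard = ∑ i, if p i then 1 else 0 :=
      fun p _ => by
    rw [Set.ncard_eq_toFinset_card', ← Finset.card_filter]
    congr 1
    ext; simp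
  have hcardC : (∑ i, if i ∈ Set.range e then 1 else 0) = n := by
    rw [← hsum]
    change (Set.range e).ncard = n
    rw [← Set.image_univ, Set.ncard_image_of_injective _ h.injective_edge, Set.ncard_univ,
      Nat.card_zmod]
  -- count the incidences between edges and faces of the side `A` in two ways
  have h1 : ∑ x ∈ A.toFinset, F.faceLength x =
      ∑ i, ((if F.left i ∈ A then 1 else 0) + (if F.right i ∈ A then 1 else 0)) := by
    simp only [faceLength, hsum, Finset.sum_add_distrib]
    rw [Finset.sum_comm, Finset.sum_comm (s := A.toFinset)]
    simp
  have h2 : ∑ i, ((if F.left i ∈ A then 1 else 0) + (if F.right i ∈ A then 1 else 0)) =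
      ∑ i, ((if i ∈ Set.range e then 1 else 0) +
        2 * (if i ∉ Set.range e ∧ F.left i ∈ A then 1 else 0)) := by
    refine Finset.sum_congr rfl fun i _ => ?_
    by_cases hi : i ∈ Set.range e
    · obtain ⟨k, rfl⟩ := hi
      have := hC k
      by_cases hl : F.left (e k) ∈ A <;> by_cases hr : F.right (e k) ∈ A <;> simp_all
    · have := hD i hi
      by_cases hl : F.left i ∈ A <;> by_cases hr : F.right i ∈ A <;> simp_all
  rw [h2, Finset.sum_add_distrib, ← Finset.mul_sum, hcardC, ← hsum] at h1
  have h4 : (∑ x ∈ A.toFinset, F.faceLength x) % 3 = (2 * A.ncard) % 3 := by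
    rw [Finset.sum_nat_mod, Finset.sum_congr rfl fun x hx => hf x fun h => hfA (by simpa [h] using hx)]
    simp [mul_comm, Set.ncard_eq_toFinset_card']
  omega

end FaceStructure

end Grinberg

/-! ### Cycles with prescribed vertex set and Hamiltonicity -/

section Hamiltonian

variable {V : Type*} [Fintype V] [DecidableEq V] {G : SimpleGraph V}

theorem HasCycleOn.isHamiltonian (h : HasCycleOn G Set.univ) : G.IsHamiltonian := by
  intro _
  obtain ⟨u, v, m, h0, hvu, hc, hn, hm⟩ := h
  obtain ⟨p, hp⟩ : ∃ p : G.Walk u v, p.support = u :: (m ++ [v]) := by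
    have : ∃ p : G.Walk ((u :: (m ++ [v])).head (by simp)) ((u :: (m ++ [v])).getLast (by simp)),
        p.support = u :: (m ++ [v]) := ⟨_, SimpleGraph.Walk.support_ofSupport _ hc⟩
    have hl : (u :: (m ++ [v])).getLast (by simp) = v := by simp
    rwa [hl] at this
  have hpath : p.IsPath := SimpleGraph.Walk.IsPath.mk' (by rw [hp]; exact hn)
  refine ⟨v, SimpleGraph.Walk.cons hvu p, ?_, ?_⟩
  · rw [SimpleGraph.Walk.isCycle_iff_isPath_tail_and_le_length]
    refine ⟨by simpa using hpath, ?_⟩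
    have := p.length_support
    rw [hp] at this
    have h1 : 0 < m.length := List.length_pos_iff.2 h0
    simp at this ⊢
    omega
  · have : p.IsHamiltonian := hpath.isHamiltonian_of_mem fun w => by
      rw [hp, hm]; trivial
    intro w
    simpa using this w

theorem SimpleGraph.IsHamiltonian.hasCycleOn (h : G.IsHamiltonian) (hV : 3 ≤ Fintype.card V) :
    HasCycleOn G Set.univ := by
  obtain ⟨v, p, hp⟩ := h (by omega)
  have hlen := hp.length_eq
  cases p with
  | nil => simp at hlen; omega
  | @cons _ u _ hvu p =>
    have hham : p.IsHamiltonian := fun w => by simpa using hp.isHamiltonian_tail w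
    have hs : p.support.length = Fintype.card V := hham.length_support
    have hchain := p.isChain_adj_support
    have hnd := hham.isPath.support_nodup
    have hmem := hham.mem_support
    have hhead : p.support.head? = some u := by
      rw [List.head?_eq_some_head (SimpleGraph.Walk.support_ne_nil p), SimpleGraph.Walk.head_support]
    have hlast : p.support.getLast? = some v := by
      rw [List.getLast?_eq_some_getLast (SimpleGraph.Walk.support_ne_nil p),
        SimpleGraph.Walk.getLast_support]
    generalize p.support = l at hs hchain hnd hmem hhead hlast
    obtain _ | ⟨u', l⟩ := l
    · simp at hhead
    obtain rfl : u' = u := by simpa using hhead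
    rcases List.eq_nil_or_concat l with rfl | ⟨m, v', rfl⟩
    · simp at hs; omega
    rw [List.concat_eq_append] at *
    have h1 : (u' :: (m ++ [v'])).getLast? = some v' := List.getLast?_concat (l := u' :: m)
    obtain rfl : v' = v := by rw [h1] at hlast; simpa using hlast
    refine ⟨u', v', m, ?_, hvu, hchain, hnd, fun w => ⟨fun _ => trivial, fun _ => hmem w⟩⟩
    rintro rfl
    simp at hs
    omega

end Hamiltonian

section Comap

variable {V W : Type*} {G : SimpleGraph W}

theorem HasCycleOn.comap [Nonempty V] {f : V → W} (hf : Function.Injective f)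
    (h : HasCycleOn G (Set.range f)) : HasCycleOn (G.comap f) Set.univ := by
  have hl := Function.leftInverse_invFun hf
  have := h.map (H := G.comap f) (Function.invFun f) (by
    rintro _ ⟨a, rfl⟩ _ ⟨b, rfl⟩ hab
    rw [hl, hl] at hab; rw [hab]) (by
    rintro _ ⟨a, rfl⟩ _ ⟨b, rfl⟩ hab
    rw [hl, hl]; exact hab)
  rwa [← Set.range_comp, hl.comp_eq_id, Set.range_id] at this

theorem HasCycleOn.of_comap {f : V → W} (hf : Function.Injective f)
    (h : HasCycleOn (G.comap f) Set.univ) : HasCycleOn G (Set.range f) := by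
  have := h.map (H := G) f hf.injOn fun _ _ _ _ hab => hab
  rwa [Set.image_univ] at this

end Comap

/-! ### Straight-line drawings -/

section Drawing

/-- The drawing of the edges of `G` inside `A` as straight segments between the points
`(X u, Y u)` has no crossings. -/
structure IsStraightDrawing {V : Type*} (G : SimpleGraph V) (A : Set V) (X Y : V → ℝ) : Prop where
  injOn : ∀ u ∈ A, ∀ v ∈ A, X u = X v → Y u = Y v → u = v
  vertex : ∀ a ∈ A, ∀ b ∈ A, G.Adj a b → ∀ v ∈ A, ∀ t ∈ Set.Ioo (0 : ℝ) 1,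
    ¬ (AffineMap.lineMap (X a) (X b) t = X v ∧ AffineMap.lineMap (Y a) (Y b) t = Y v)
  edge : ∀ a ∈ A, ∀ b ∈ A, G.Adj a b → ∀ c ∈ A, ∀ d ∈ A, G.Adj c d → s(a, b) ≠ s(c, d) →
    ∀ t ∈ Set.Ioo (0 : ℝ) 1, ∀ t' ∈ Set.Ioo (0 : ℝ) 1,
    ¬ (AffineMap.lineMap (X a) (X b) t = AffineMap.lineMap (X c) (X d) t' ∧
      AffineMap.lineMap (Y a) (Y b) t = AffineMap.lineMap (Y c) (Y d) t')

namespace IsStraightDrawing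

variable {V W : Type*} {G : SimpleGraph V}

theorem mono {A B : Set V} {X Y : V → ℝ} (h : IsStraightDrawing G A X Y) (hB : B ⊆ A) :
    IsStraightDrawing G B X Y :=
  ⟨fun u hu v hv => h.injOn u (hB hu) v (hB hv),
    fun a ha b hb hab v hv => h.vertex a (hB ha) b (hB hb) hab v (hB hv),
    fun a ha b hb hab c hc d hd => h.edge a (hB ha) b (hB hb) hab c (hB hc) d (hB hd)⟩

/-- Relabelling the vertices and translating the drawing horizontally. -/
theorem map {H : SimpleGraph W} {A : Set V} {X Y : V → ℝ} {X' Y' : W → ℝ} (f : V → W) (s : ℝ)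
    (h : IsStraightDrawing G A X Y) (hadj : ∀ a ∈ A, ∀ b ∈ A, H.Adj (f a) (f b) → G.Adj a b)
    (hX : ∀ a ∈ A, X' (f a) = X a + s) (hY : ∀ a ∈ A, Y' (f a) = Y a) :
    IsStraightDrawing H (f '' A) X' Y' := by
  have hline : ∀ x y t : ℝ, AffineMap.lineMap (x + s) (y + s) t = AffineMap.lineMap x y t + s := by
    intro x y t
    simp only [AffineMap.lineMap_apply, vsub_eq_sub, vadd_eq_add, smul_eq_mul]; ring
  refine ⟨?_, ?_, ?_⟩
  · rintro _ ⟨u, hu, rfl⟩ _ ⟨v, hv, rfl⟩ h1 h2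
    rw [hX u hu, hX v hv] at h1
    rw [hY u hu, hY v hv] at h2
    rw [h.injOn u hu v hv (by linarith) h2]
  · rintro _ ⟨a, ha, rfl⟩ _ ⟨b, hb, rfl⟩ hab _ ⟨v, hv, rfl⟩ t ht ⟨h1, h2⟩
    rw [hX a ha, hX b hb, hX v hv, hline, add_left_inj] at h1
    rw [hY a ha, hY b hb, hY v hv] at h2
    exact h.vertex a ha b hb (hadj a ha b hb hab) v hv t ht ⟨h1, h2⟩
  · rintro _ ⟨a, ha, rfl⟩ _ ⟨b, hb, rfl⟩ hab _ ⟨c, hc, rfl⟩ _ ⟨d, hd, rfl⟩ hcd hne t ht t' ht' ⟨h1, h2⟩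
    rw [hX a ha, hX b hb, hX c hc, hX d hd, hline, hline, add_left_inj] at h1
    rw [hY a ha, hY b hb, hY c hc, hY d hd] at h2
    refine h.edge a ha b hb (hadj a ha b hb hab) c hc d hd (hadj c hc d hd hcd) ?_ t ht t' ht'
      ⟨h1, h2⟩
    intro e
    apply hne
    have := congrArg (Sym2.map f) e
    simpa using this

theorem lineMap_lt {x y w t : ℝ} (hx : x ≤ w) (hy : y ≤ w) (hne : ¬ (x = w ∧ y = w))
    (ht : t ∈ Set.Ioo (0 : ℝ) 1) : AffineMap.lineMap x y t < w := by
  have h0 := ht.1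
  have h1 := ht.2
  rw [AffineMap.lineMap_apply, vsub_eq_sub, vadd_eq_add, smul_eq_mul]
  rcases hx.lt_or_eq with h | h
  · nlinarith
  · rcases hy.lt_or_eq with h' | h'
    · nlinarith
    · exact absurd ⟨h, h'⟩ hne

theorem lt_lineMap {x y w t : ℝ} (hx : w ≤ x) (hy : w ≤ y) (hne : ¬ (x = w ∧ y = w))
    (ht : t ∈ Set.Ioo (0 : ℝ) 1) : w < AffineMap.lineMap x y t := by
  have h0 := ht.1
  have h1 := ht.2
  rw [AffineMap.lineMap_apply, vsub_eq_sub, vadd_eq_add, smul_eq_mul]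
  rcases hx.lt_or_eq with h | h
  · nlinarith
  · rcases hy.lt_or_eq with h' | h'
    · nlinarith
    · exact absurd ⟨h.symm, h'.symm⟩ hne

/-- Drawings on the two sides of a vertical line through the terminals fit together. -/
theorem union {A B T : Set V} {X Y : V → ℝ} {w : ℝ} (hg : IsGluing G A B T)
    (hA : IsStraightDrawing G A X Y) (hB : IsStraightDrawing G B X Y) (hT : ∀ t ∈ T, X t = w)
    (hAw : ∀ a ∈ A, a ∉ T → X a < w) (hBw : ∀ b ∈ B, b ∉ T → w < X b) :
    IsStraightDrawing G (A ∪ B) X Y := by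
  have hAle : ∀ a ∈ A, X a ≤ w := fun a ha => by
    by_cases h : a ∈ T
    · exact (hT a h).le
    · exact (hAw a ha h).le
  have hBle : ∀ b ∈ B, w ≤ X b := fun b hb => by
    by_cases h : b ∈ T
    · exact (hT b h).ge
    · exact (hBw b hb h).le
  have hATw : ∀ a ∈ A, X a = w → a ∈ T := fun a ha h => by
    by_contra hn; exact absurd h (hAw a ha hn).ne
  have hBTw : ∀ b ∈ B, X b = w → b ∈ T := fun b hb h => by
    by_contra hn; exact absurd h (hBw b hb hn).ne'
  have hlt : ∀ a ∈ A, ∀ b ∈ A, G.Adj a b → ∀ t ∈ Set.Ioo (0 : ℝ) 1,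
      AffineMap.lineMap (X a) (X b) t < w := fun a ha b hb hab t ht =>
    lineMap_lt (hAle a ha) (hAle b hb)
      (fun h => hg.left.not_adj a (hATw a ha h.1) b (hATw b hb h.2) hab) ht
  have hgt : ∀ a ∈ B, ∀ b ∈ B, G.Adj a b → ∀ t ∈ Set.Ioo (0 : ℝ) 1,
      w < AffineMap.lineMap (X a) (X b) t := fun a ha b hb hab t ht =>
    lt_lineMap (hBle a ha) (hBle b hb)
      (fun h => hg.left.not_adj a (hBTw a ha h.1) b (hBTw b hb h.2) hab) ht
  have hmix : ∀ a ∈ A, ∀ b ∈ B, X a = X b → a ∈ T ∧ b ∈ T := fun a ha b hb h =>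
    ⟨hATw a ha (le_antisymm (hAle a ha) (h ▸ hBle b hb)),
      hBTw b hb (le_antisymm (h ▸ hAle a ha) (hBle b hb))⟩
  refine ⟨?_, ?_, ?_⟩
  · rintro u (hu | hu) v (hv | hv) h1 h2
    · exact hA.injOn u hu v hv h1 h2
    · exact hB.injOn u (hg.right.subset (hmix u hu v hv h1).1) v hv h1 h2
    · exact hB.injOn u hu v (hg.right.subset (hmix v hv u hu h1.symm).1) h1 h2
    · exact hB.injOn u hu v hv h1 h2
  · intro a ha b hb hab v hv t ht h
    rcases hg.adj a b ha hb hab with ⟨ha, hb⟩ | ⟨ha, hb⟩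
    · rcases hv with hv | hv
      · exact hA.vertex a ha b hb hab v hv t ht h
      · exact absurd h.1 ((hlt a ha b hb hab t ht).trans_le (hBle v hv)).ne
    · rcases hv with hv | hv
      · exact absurd h.1 ((hAle v hv).trans_lt (hgt a ha b hb hab t ht)).ne'
      · exact hB.vertex a ha b hb hab v hv t ht h
  · intro a ha b hb hab c hc d hd hcd hne t ht t' ht' h
    rcases hg.adj a b ha hb hab with ⟨ha, hb⟩ | ⟨ha, hb⟩ <;>
      rcases hg.adj c d hc hd hcd with ⟨hc, hd⟩ | ⟨hc, hd⟩
    · exact hA.edge a ha b hb hab c hc d hd hcd hne t ht t' ht' h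
    · exact absurd h.1 ((hlt a ha b hb hab t ht).trans (hgt c hc d hd hcd t' ht')).ne
    · exact absurd h.1 ((hlt c hc d hd hcd t' ht').trans (hgt a ha b hb hab t ht)).ne'
    · exact hB.edge a ha b hb hab c hc d hd hcd hne t ht t' ht' h

theorem isPlanar {X Y : V → ℝ} (h : IsStraightDrawing G Set.univ X Y) : IsPlanar G := by
  let p : V → Plane := fun v => !₂[X v, Y v]
  have hp : ∀ a b : V, ∀ t : ℝ, ∀ q : Plane, AffineMap.lineMap (p a) (p b) t = q ↔
      AffineMap.lineMap (X a) (X b) t = q 0 ∧ AffineMap.lineMap (Y a) (Y b) t = q 1 := by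
    intro a b t q
    rw [PiLp.ext_iff, Fin.forall_fin_two]
    simp [p, AffineMap.lineMap_apply]
  have hp' : ∀ a b : V, ∀ t : ℝ,
      (AffineMap.lineMap (p a) (p b) t : Plane) 0 = AffineMap.lineMap (X a) (X b) t ∧
      (AffineMap.lineMap (p a) (p b) t : Plane) 1 = AffineMap.lineMap (Y a) (Y b) t := by
    intro a b t
    simp [p, AffineMap.lineMap_apply]
  have hinj : Function.Injective p := by
    intro u v huv
    have h0 := congrArg (fun q : Plane => q 0) huv
    have h1 := congrArg (fun q : Plane => q 1) huv
    exact h.injOn u trivial v trivial (by simpa [p] using h0) (by simpa [p] using h1)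
  -- each edge is drawn as a segment, oriented by a choice of its first end
  have hout : ∀ e : G.edgeSet, s((Quot.out e.1).1, (Quot.out e.1).2) = e.1 := fun e =>
    Quot.out_eq e.1
  have hadj : ∀ e : G.edgeSet, G.Adj (Quot.out e.1).1 (Quot.out e.1).2 := fun e => by
    rw [← SimpleGraph.mem_edgeSet, hout]; exact e.2
  refine ⟨p, fun e => ⟨fun t => AffineMap.lineMap (p (Quot.out e.1).1) (p (Quot.out e.1).2) (t : ℝ),
    by fun_prop⟩, hinj, ?_, ?_, ?_, ?_⟩
  · intro e t t' htt
    have hne : p (Quot.out e.1).1 ≠ p (Quot.out e.1).2 := fun hh => (hadj e).ne (hinj hh)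
    exact Subtype.ext (AffineMap.lineMap_injective ℝ hne htt)
  · intro e
    simp only [ContinuousMap.coe_mk, Set.Icc.coe_zero, Set.Icc.coe_one, AffineMap.lineMap_apply_zero,
      AffineMap.lineMap_apply_one]
    conv_rhs => rw [← hout e]
    rfl
  · intro e t ht v hv
    have ht' : (t : ℝ) ∈ Set.Ioo (0 : ℝ) 1 := ⟨ht.1, ht.2⟩
    refine h.vertex _ trivial _ trivial (hadj e) v trivial t ht' ?_
    simpa [p] using (hp _ _ _ _).1 hv
  · intro e e' hne t ht t' ht' heq
    have h1 : (t : ℝ) ∈ Set.Ioo (0 : ℝ) 1 := ⟨ht.1, ht.2⟩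
    have h2 : (t' : ℝ) ∈ Set.Ioo (0 : ℝ) 1 := ⟨ht'.1, ht'.2⟩
    refine h.edge _ trivial _ trivial (hadj e) _ trivial _ trivial (hadj e') ?_ t h1 t' h2 ?_
    · rw [hout, hout]; exact fun hh => hne (Subtype.ext hh)
    · have := (hp _ _ _ _).1 heq
      simpa [hp'] using this

end IsStraightDrawing

end Drawing

/-! ### Chains of pieces -/

section Chain

/-- The three heights at which the terminals of all pieces are drawn. -/
def terminalHeight (i : ℕ) : ℝ := (i + 1) * 1000000

/-- A `K₂`-hypohamiltonian graph with vertices `0, …, k + 3`, drawn in the plane so that further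
pieces can be attached on the right: the last vertex `k + 3` is cubic, its neighbours, the terminals
`k`, `k + 1`, `k + 2`, lie on a vertical line at prescribed heights, and all other vertices lie to
the left of this line. -/
structure IsRightCap (k : ℕ) (G : SimpleGraph ℕ) : Prop where
  pos : 0 < k
  lt_of_adj : ∀ a b, G.Adj a b → a < k + 4
  adj_last : ∀ u, G.Adj (k + 3) u ↔ u ∈ Set.Ico k (k + 3)
  not_adj : ∀ u ∈ Set.Ico k (k + 3), ∀ v ∈ Set.Ico k (k + 3), ¬ G.Adj u v
  not_ham : ¬ HasCycleOn G (Set.Iio (k + 4))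
  ham_sdiff_edge : ∀ a b, G.Adj a b → HasCycleOn G (Set.Iio (k + 4) \ {a, b})
  ham_sdiff_terminal : ∀ t ∈ Set.Ico k (k + 3), HasCycleOn G (Set.Iio (k + 4) \ {t})
  drawing : ∃ (X Y : ℕ → ℝ) (w : ℝ), IsStraightDrawing G (Set.Iio (k + 4)) X Y ∧
    (∀ u < k, X u < w) ∧ w < X (k + 3) ∧
    ∀ i < 3, X (k + i) = w ∧ Y (k + i) = terminalHeight i

/-- A piece that can be attached on both sides: moreover the vertex `0` is cubic, its neighbours `1`,
`2`, `3` are drawn on a vertical line, and all other vertices lie to the right of this line. -/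
structure IsPiece (k : ℕ) (G : SimpleGraph ℕ) : Prop extends IsRightCap k G where
  four_le : 4 ≤ k
  adj_zero : ∀ u, G.Adj 0 u ↔ u ∈ Set.Ico 1 4
  not_adj_left : ∀ u ∈ Set.Ico 1 4, ∀ v ∈ Set.Ico 1 4, ¬ G.Adj u v
  ham_sdiff_left : ∀ t ∈ Set.Ico 1 4, HasCycleOn G (Set.Iio (k + 4) \ {t})
  drawing_both : ∃ (X Y : ℕ → ℝ) (w w' : ℝ), IsStraightDrawing G (Set.Iio (k + 4)) X Y ∧
    (∀ u < k, X u < w) ∧ w < X (k + 3) ∧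
    (∀ i < 3, X (k + i) = w ∧ Y (k + i) = terminalHeight i) ∧
    (∀ u, 4 ≤ u → u < k + 4 → w' < X u) ∧
    ∀ i < 3, X (1 + i) = w' ∧ Y (1 + i) = terminalHeight i

/-- The graph obtained from `G` and `H` by deleting the last vertex `k + 3` of `G` and the first
vertex `0` of `H` and identifying the vertices `k`, `k + 1`, `k + 2` of `G` with the vertices `1`,
`2`, `3` of `H`. The vertex `u` of `H` becomes `u + (k - 1)`. -/
def glueAt (k : ℕ) (G H : SimpleGraph ℕ) : SimpleGraph ℕ where
  Adj a b := (G.Adj a b ∧ a < k + 3 ∧ b < k + 3) ∨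
    (k ≤ a ∧ k ≤ b ∧ H.Adj (a - (k - 1)) (b - (k - 1)))
  symm := ⟨fun a b h => by
    rcases h with ⟨h, ha, hb⟩ | ⟨ha, hb, h⟩
    · exact Or.inl ⟨h.symm, hb, ha⟩
    · exact Or.inr ⟨hb, ha, h.symm⟩⟩
  loopless := ⟨fun a h => by
    rcases h with ⟨h, -⟩ | ⟨-, -, h⟩
    · exact G.loopless.irrefl _ h
    · exact H.loopless.irrefl _ h⟩

variable {k j : ℕ} {G H : SimpleGraph ℕ}

theorem Ico_three_iff {k t : ℕ} : t ∈ Set.Ico k (k + 3) ↔ t = k ∨ t = k + 1 ∨ t = k + 2 := by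
  rw [Set.mem_Ico]; omega

theorem image_add_Ico (k a b : ℕ) : (fun u => u + k) '' Set.Ico a b = Set.Ico (a + k) (b + k) := by
  ext u
  simp only [Set.mem_image, Set.mem_Ico]
  exact ⟨fun ⟨v, hv, e⟩ => by omega, fun hu => ⟨u - k, by omega, by omega⟩⟩

theorem glueAt_adj_left (hG : IsRightCap k G) (hH : IsPiece j H) {a b : ℕ} (ha : a < k + 3)
    (hb : b < k + 3) : (glueAt k G H).Adj a b ↔ G.Adj a b := by
  have hk := hG.pos
  refine ⟨fun h => ?_, fun h => Or.inl ⟨h, ha, hb⟩⟩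
  rcases h with h | ⟨ha', hb', h⟩
  · exact h.1
  · exact absurd h (hH.not_adj_left _ (Set.mem_Ico.2 (by omega)) _ (Set.mem_Ico.2 (by omega)))

theorem glueAt_adj_right (hG : IsRightCap k G) {a b : ℕ} (ha : 1 ≤ a) (hb : 1 ≤ b) :
    (glueAt k G H).Adj (a + (k - 1)) (b + (k - 1)) ↔ H.Adj a b := by
  have hk := hG.pos
  refine ⟨fun h => ?_, fun h => Or.inr ⟨by omega, by omega, by simpa using h⟩⟩
  rcases h with ⟨h, ha', hb'⟩ | ⟨ha', hb', h⟩
  · exact absurd h (hG.not_adj _ (Set.mem_Ico.2 (by omega)) _ (Set.mem_Ico.2 (by omega)))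
  · simpa using h

theorem glueAt_lt_of_adj (hG : IsRightCap k G) (hH : IsPiece j H) {a b : ℕ}
    (h : (glueAt k G H).Adj a b) : a < k + j + 3 := by
  have hk := hG.pos
  rcases h with ⟨h, ha', hb'⟩ | ⟨ha', hb', h⟩
  · omega
  · have := hH.lt_of_adj _ _ h
    omega

theorem IsRightCap.isGluingSide (hG : IsRightCap k G) :
    IsGluingSide G (Set.Iio (k + 3)) (Set.Ico k (k + 3)) := by
  have hk := hG.pos
  have := IsGluingSide.of_vertex (G := G) (S := Set.Iio (k + 4)) (T := Set.Ico k (k + 3))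
    (x := k + 3) (by simp) hG.adj_last (fun t ht => by simp at ht ⊢; omega) hG.not_ham
    hG.ham_sdiff_terminal (fun a _ b _ => hG.ham_sdiff_edge a b) hG.not_adj
    ⟨0, by simp, by simp; omega⟩
  convert this using 1
  ext u; simp; omega

theorem IsPiece.isGluingSide (hH : IsPiece j H) :
    IsGluingSide H (Set.Ico 1 (j + 4)) (Set.Ico 1 4) := by
  have hj := hH.four_le
  have := IsGluingSide.of_vertex (G := H) (S := Set.Iio (j + 4)) (T := Set.Ico 1 4)
    (x := 0) (by simp) hH.adj_zero (fun t ht => by simp at ht ⊢; omega) hH.not_ham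
    hH.ham_sdiff_left (fun a _ b _ => hH.ham_sdiff_edge a b) hH.not_adj_left
    ⟨4, by simp; omega, by simp⟩
  convert this using 1
  ext u; simp; omega

theorem isGluing_glueAt (hG : IsRightCap k G) (hH : IsPiece j H) :
    IsGluing (glueAt k G H) (Set.Iio (k + 3)) (Set.Ico k (k + j + 3)) (Set.Ico k (k + 3)) where
  left := by
    have := IsGluingSide.map (A := Set.Iio (k + 3)) (H := glueAt k G H) id id (fun _ _ => rfl)
      (fun a ha b hb => (glueAt_adj_left hG hH ha hb).symm) hG.isGluingSide
    rwa [Set.image_id, Set.image_id] at this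
  right := by
    have hk := hG.pos
    have := hH.isGluingSide.map (H := glueAt k G H) (fun u => u + (k - 1)) (fun u => u - (k - 1))
      (fun a _ => by simp) fun a ha b hb => (glueAt_adj_right hG ha.1 hb.1).symm
    rw [image_add_Ico, image_add_Ico] at this
    convert this using 2 <;> omega
  inter w h1 h2 := ⟨h2.1, h1⟩
  adj a b ha hb hab := by
    have h1 := glueAt_lt_of_adj hG hH hab
    have h2 := glueAt_lt_of_adj hG hH hab.symm
    rcases hab with ⟨h, ha', hb'⟩ | ⟨ha', hb', h⟩
    · exact Or.inl ⟨ha', hb'⟩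
    · exact Or.inr ⟨⟨ha', h1⟩, ⟨hb', h2⟩⟩
  card := ⟨k, k + 1, k + 2, by omega, by omega, by omega, fun t => Ico_three_iff⟩

/-- Attaching a piece of order `j + 4` to a graph of order `k + 4` gives a graph of the same kind, of
order `k + j + 3`. -/
theorem IsRightCap.glueAt (hG : IsRightCap k G) (hH : IsPiece j H) :
    IsRightCap (k + j - 1) (glueAt k G H) := by
  have hk := hG.pos
  have hj := hH.four_le
  have hg := isGluing_glueAt hG hH
  have hunion : Set.Iio (k + 3) ∪ Set.Ico k (k + j + 3) = Set.Iio (k + j - 1 + 4) := by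
    ext u; simp; omega
  have hIco : ∀ {u}, u ∈ Set.Ico (k + j - 1) (k + j - 1 + 3) →
      ∃ v, v ∈ Set.Ico j (j + 3) ∧ u = v + (k - 1) := fun {u} hu =>
    ⟨u - (k - 1), by simp at hu ⊢; omega, by simp at hu; omega⟩
  refine ⟨by omega, ?_, ?_, ?_, ?_, ?_, ?_, ?_⟩
  · intro a b h
    have := glueAt_lt_of_adj hG hH h
    omega
  · intro u
    have e : k + j - 1 + 3 = (j + 3) + (k - 1) := by omega
    rw [e]
    constructor
    · intro h
      have hu : k ≤ u := by
        rcases h with ⟨-, h, -⟩ | ⟨-, h, -⟩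
        · omega
        · exact h
      obtain ⟨v, rfl⟩ : ∃ v, u = v + (k - 1) := ⟨u - (k - 1), by omega⟩
      have := (hH.adj_last v).1 ((glueAt_adj_right hG (by omega) (by omega)).1 h)
      simp at this ⊢; omega
    · intro hu
      rw [← e] at hu
      obtain ⟨v, hv, rfl⟩ := hIco hu
      have hv' := hv.1
      exact (glueAt_adj_right hG (by omega) (by omega)).2 ((hH.adj_last v).2 hv)
  · intro u hu v hv h
    obtain ⟨u, hu', rfl⟩ := hIco hu
    obtain ⟨v, hv', rfl⟩ := hIco hv
    have hu₁ := hu'.1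
    have hv₁ := hv'.1
    exact hH.not_adj u hu' v hv' ((glueAt_adj_right hG (by omega) (by omega)).1 h)
  · rw [← hunion]; exact hg.not_hasCycleOn
  · intro a b hab
    rw [← hunion]
    refine hg.hasCycleOn_sdiff_edge ?_ ?_ hab
    · rw [hunion]; have := glueAt_lt_of_adj hG hH hab; simp; omega
    · rw [hunion]; have := glueAt_lt_of_adj hG hH hab.symm; simp; omega
  · intro t ht
    obtain ⟨t, ht', rfl⟩ := hIco ht
    have ht₁ := ht'.1
    have ht₂ := ht'.2
    rw [← hunion]
    -- a cycle of the piece missing `t` passes through `0` and so leaves a path between terminals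
    obtain ⟨u, v, hu, hv, hp⟩ := (hH.ham_sdiff_terminal t ht').exists_path_of_mem (x := 0)
      ⟨by simp, by simp; omega⟩
    have hu' := (hH.adj_zero u).1 hu
    have hv' := (hH.adj_zero v).1 hv
    have hp' := hp.map (H := _root_.glueAt k G H) (fun u => u + (k - 1))
      (fun a _ b _ hab => by simpa using hab) (by
        intro a ha b hb hab
        have h1 : a ≠ 0 := ha.2
        have h2 : b ≠ 0 := hb.2
        exact (glueAt_adj_right hG (by omega) (by omega)).2 hab)
    refine hg.hasCycleOn_sdiff (D := {t + (k - 1)}) (by simp; omega) (u := u + (k - 1))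
      (v := v + (k - 1)) (by simp at hu' ⊢; omega) (by simp at hv' ⊢; omega) ?_
    convert hp' using 1
    ext w
    simp only [Set.mem_sdiff, Set.mem_Ico, Set.mem_singleton_iff, Set.mem_image, Set.mem_Iio]
    exact ⟨fun h => ⟨w - (k - 1), by omega, by omega⟩, fun ⟨z, hz, e⟩ => by omega⟩
  · obtain ⟨X, Y, w, hd, hlt, hgt, hterm⟩ := hG.drawing
    obtain ⟨X', Y', v, v', hd', hlt', hgt', hterm', hgtl, hterml⟩ := hH.drawing_both
    let X'' : ℕ → ℝ := fun u => if u < k + 3 then X u else X' (u - (k - 1)) + (w - v')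
    let Y'' : ℕ → ℝ := fun u => if u < k + 3 then Y u else Y' (u - (k - 1))
    have hXl : ∀ u < k + 3, X'' u = X u := fun u hu => by simp [X'', hu]
    have hYl : ∀ u < k + 3, Y'' u = Y u := fun u hu => by simp [Y'', hu]
    -- on the terminals the two drawings agree
    have hr : ∀ u, 1 ≤ u → X'' (u + (k - 1)) = X' u + (w - v') ∧ Y'' (u + (k - 1)) = Y' u := by
      intro u hu
      by_cases h : u + (k - 1) < k + 3
      · obtain ⟨i, hi, rfl⟩ : ∃ i < 3, u = 1 + i := ⟨u - 1, by omega, by omega⟩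
        have e : 1 + i + (k - 1) = k + i := by omega
        rw [hXl _ h, hYl _ h, e, (hterm i hi).1, (hterm i hi).2, (hterml i hi).1, (hterml i hi).2]
        exact ⟨by ring, rfl⟩
      · simp [X'', Y'', h]
    have hA : IsStraightDrawing (_root_.glueAt k G H) (Set.Iio (k + 3)) X'' Y'' := by
      have := (hd.mono (B := Set.Iio (k + 3)) (by simp)).map (H := _root_.glueAt k G H)
        (X' := X'') (Y' := Y'') id 0 (fun a ha b hb h => (glueAt_adj_left hG hH ha hb).1 h)
        (fun a ha => by rw [add_zero]; exact hXl a ha) (fun a ha => hYl a ha)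
      rwa [Set.image_id] at this
    have hB : IsStraightDrawing (_root_.glueAt k G H) (Set.Ico k (k + j + 3)) X'' Y'' := by
      have := (hd'.mono (B := Set.Ico 1 (j + 4)) (fun u hu => hu.2)).map
        (H := _root_.glueAt k G H) (X' := X'') (Y' := Y'') (fun u => u + (k - 1)) (w - v')
        (fun a ha b hb h => (glueAt_adj_right hG ha.1 hb.1).1 h) (fun a ha => (hr a ha.1).1)
        (fun a ha => (hr a ha.1).2)
      rw [image_add_Ico] at this
      convert this using 2 <;> omega
    refine ⟨X'', Y'', v + (w - v'), ?_, ?_, ?_, ?_⟩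
    · rw [← hunion]
      refine IsStraightDrawing.union (w := w) hg hA hB ?_ ?_ ?_
      · intro t ht
        obtain ⟨i, hi, rfl⟩ : ∃ i < 3, t = k + i := ⟨t - k, by simp at ht; omega, by simp at ht; omega⟩
        rw [hXl _ (by omega), (hterm i hi).1]
      · intro a ha haT
        rw [hXl a ha]
        exact hlt a (by simp at ha haT; omega)
      · intro b hb hbT
        obtain ⟨u, rfl⟩ : ∃ u, b = u + (k - 1) := ⟨b - (k - 1), by simp at hb; omega⟩
        simp at hb hbT
        rw [(hr u (by omega)).1]
        have := hgtl u (by omega) (by omega)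
        linarith
    · intro u hu
      have hvv : v' < v := by
        have := hgtl j (by omega) (by omega)
        rwa [← (hterm' 0 (by omega)).1]
      by_cases h : u < k + 3
      · rw [hXl u h]
        by_cases h' : u < k
        · have := hlt u h'
          linarith
        · obtain ⟨i, hi, rfl⟩ : ∃ i < 3, u = k + i := ⟨u - k, by omega, by omega⟩
          rw [(hterm i hi).1]; linarith
      · obtain ⟨z, rfl⟩ : ∃ z, u = z + (k - 1) := ⟨u - (k - 1), by omega⟩
        rw [(hr z (by omega)).1]
        have := hlt' z (by omega)
        linarith
    · have e : k + j - 1 + 3 = (j + 3) + (k - 1) := by omega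
      rw [e, (hr _ (by omega)).1]
      linarith
    · intro i hi
      have e : k + j - 1 + i = (j + i) + (k - 1) := by omega
      rw [e, (hr _ (by omega)).1, (hr _ (by omega)).2, (hterm' i hi).1, (hterm' i hi).2]
      exact ⟨rfl, rfl⟩

/-- The graph of a right cap, on the vertex type `Fin (k + 4)`, has all the required properties. -/
theorem IsRightCap.exists_graph (hG : IsRightCap k G) :
    ∃ G' : SimpleGraph (Fin (k + 4)), G'.Connected ∧ IsPlanar G' ∧ IsK2Hypohamiltonian G' := by
  have hk := hG.pos
  have hrange : Set.range (Fin.val : Fin (k + 4) → ℕ) = Set.Iio (k + 4) := by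
    ext u; simp
  have hsub : ∀ (P : Fin (k + 4) → Prop) (D : Set ℕ), (∀ x, P x ↔ (x : ℕ) ∉ D) →
      HasCycleOn G (Set.Iio (k + 4) \ D) →
      HasCycleOn ((G.comap (Fin.val : Fin (k + 4) → ℕ)).induce {x | P x}) Set.univ := by
    intro P D hP hc
    have e : Set.range (fun x : {x : Fin (k + 4) | P x} => ((x : Fin (k + 4)) : ℕ)) =
        Set.Iio (k + 4) \ D := by
      ext u
      constructor
      · rintro ⟨x, rfl⟩
        exact ⟨x.1.2, (hP x.1).1 x.2⟩
      · rintro ⟨hu, huD⟩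
        exact ⟨⟨⟨u, hu⟩, (hP ⟨u, hu⟩).2 huD⟩, rfl⟩
    rw [← e] at hc
    have hne : Nonempty {x : Fin (k + 4) | P x} := by
      obtain ⟨a, _, _, _, _, _, _, ha⟩ := hc
      obtain ⟨x, -⟩ := (ha a).1 (by simp)
      exact ⟨x⟩
    exact hc.comap (f := fun x : {x : Fin (k + 4) | P x} => ((x : Fin (k + 4)) : ℕ))
      (fun x y hxy => Subtype.ext (Fin.ext hxy))
  refine ⟨G.comap Fin.val, ?_, ?_, ?_, ?_⟩
  · -- the graph without the terminal `k` is Hamiltonian, and `k` is adjacent to the last vertex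
    have h := (hsub (fun x => (x : ℕ) ≠ k) {k} (fun x => by simp)
      (hG.ham_sdiff_terminal k (by simp))).isHamiltonian.connected
    rw [SimpleGraph.connected_iff_exists_forall_reachable]
    have hreach : ∀ x : Fin (k + 4), (x : ℕ) ≠ k →
        (G.comap (Fin.val : Fin (k + 4) → ℕ)).Reachable ⟨k + 3, by omega⟩ x := by
      intro x hx
      exact (h.preconnected ⟨⟨k + 3, by omega⟩, by simp⟩ ⟨x, hx⟩).map
        (SimpleGraph.Embedding.induce _).toHom
    refine ⟨⟨k + 3, by omega⟩, fun x => ?_⟩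
    by_cases hx : (x : ℕ) = k
    · refine SimpleGraph.Adj.reachable ?_
      change G.Adj (k + 3) x
      rw [hG.adj_last, hx]; simp
    · exact hreach x hx
  · obtain ⟨X, Y, -, hd, -⟩ := hG.drawing
    refine IsStraightDrawing.isPlanar (X := fun u => X u) (Y := fun u => Y u) ⟨?_, ?_, ?_⟩
    · exact fun u _ v _ h1 h2 => Fin.ext (hd.injOn u u.2 v v.2 h1 h2)
    · exact fun a _ b _ hab v _ => hd.vertex a a.2 b b.2 hab v v.2
    · intro a _ b _ hab c _ d _ hcd hne
      refine hd.edge a a.2 b b.2 hab c c.2 d d.2 hcd ?_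
      intro e
      apply hne
      rw [Sym2.eq_iff] at e ⊢
      simpa only [Fin.ext_iff] using e
  · intro v w hvw
    exact (hsub (fun x => x ≠ v ∧ x ≠ w) {(v : ℕ), (w : ℕ)} (fun x => by
      simp [Fin.ext_iff]) (hG.ham_sdiff_edge v w hvw)).isHamiltonian
  · intro hham
    have := (hham.hasCycleOn (by simp)).of_comap Fin.val_injective
    rw [hrange] at this
    exact hG.not_ham this

end Chain

/-! ### Certificates for pieces -/

section Certificates

/-- A numerical certificate that a graph is a piece. An edge is the number
`u + 2 ^ 7 * v + 2 ^ 14 * l + 2 ^ 21 * r`, where `u < v` are its ends and `l`, `r` the two faces along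
it. The coordinates of the vertex `u` are the `u`-th digits of `xs` and `ys` in base `2 ^ 24`, and
its neighbours the digits `4 * u`, …, `4 * u + 3` of `neighbors` in base `2 ^ 7`, repeated if there are
fewer than four. A cycle is coded by `start + 2 ^ 7 * c`, where the digits of `c` in base four tell
which neighbour comes next. There is one cycle for each edge, missing the ends of this edge, and one
for each of the terminals `1, 2, 3, k, k + 1, k + 2`, missing this terminal. -/
structure PieceData where
  k : ℕ
  faces : ℕ
  edges : List ℕ
  xs : ℕ
  ys : ℕ
  neighbors : ℕ
  edgeCycles : List ℕ
  terminalCycles : List ℕ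

namespace PieceData

/-! The checks are evaluated by the kernel. They are written with `Nat.mod`, `Nat.add`, … instead of the
overloaded notation because unfolding the latter would take most of the time. -/

/-- The smaller end of a coded edge. -/
def src (e : ℕ) : ℕ := Nat.mod e 128

/-- The larger end of a coded edge. -/
def tgt (e : ℕ) : ℕ := Nat.mod (Nat.div e 128) 128

/-- The first face of a coded edge. -/
def lft (e : ℕ) : ℕ := Nat.mod (Nat.div e 16384) 128

/-- The second face of a coded edge. -/
def rgt (e : ℕ) : ℕ := Nat.div e 2097152

variable (d : PieceData)

/-- The graph described by a certificate. -/
def graph : SimpleGraph ℕ := SimpleGraph.fromRel fun a b => ∃ e ∈ d.edges, src e = a ∧ tgt e = b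

/-- The abscissa of a vertex. -/
def x (u : ℕ) : ℕ := Nat.mod (Nat.shiftRight d.xs (Nat.mul 24 u)) 16777216

/-- The ordinate of a vertex. -/
def y (u : ℕ) : ℕ := Nat.mod (Nat.shiftRight d.ys (Nat.mul 24 u)) 16777216

/-- The neighbour number `c` of a vertex. -/
def neighbor (u c : ℕ) : ℕ :=
  Nat.mod (Nat.shiftRight d.neighbors (Nat.add (Nat.mul 28 u) (Nat.mul 7 c))) 128

/-- Whether `w` is a bit of `m`. -/
def hasBit (m w : ℕ) : Bool := Nat.beq (Nat.mod (Nat.shiftRight m w) 2) 1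

/-- The number whose bits are the values of `key` on a list. -/
def bitsOf (key : ℕ → ℕ) (l : List ℕ) : ℕ := l.foldr (fun e a => Nat.lor (Nat.pow 2 (key e)) a) 0

/-- Whether the edge `uv` is listed. -/
def hasEdge (u v : ℕ) : Bool :=
  hasBit (bitsOf (fun e => Nat.mod e 16384) d.edges) (Nat.add u (Nat.mul 128 v))

/-- Every vertex below `n` satisfies `p`. -/
def allBelow (p : ℕ → Bool) : ℕ → Bool
  | 0 => true
  | n + 1 => p n && allBelow p n

theorem allBelow_iff {p : ℕ → Bool} {n : ℕ} : allBelow p n = true ↔ ∀ u < n, p u = true := by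
  induction n with
  | zero => simp [allBelow]
  | succ n ih =>
    rw [allBelow, Bool.and_eq_true, ih, Nat.forall_lt_succ_right, and_comm]

/-- The conditions on a single edge: the ends are sorted, and the first vertex, the last vertex and the
terminals are joined only as required. -/
def edgeCheck (e : ℕ) : Bool :=
  Nat.blt (src e) (tgt e) && Nat.blt (tgt e) (d.k + 4) && Nat.blt (lft e) d.faces &&
    Nat.blt (rgt e) d.faces && !(Nat.beq (lft e) (rgt e)) &&
    -- the neighbours of the first and the last vertex
    (Nat.blt 0 (src e) || Nat.blt (tgt e) 4) &&
    (Nat.blt (tgt e) (d.k + 3) || Nat.ble d.k (src e)) &&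
    -- no edges among the terminals of one side
    !(Nat.ble 1 (src e) && Nat.blt (tgt e) 4) &&
    !(Nat.ble d.k (src e) && Nat.blt (tgt e) (d.k + 3))

/-- Whether the neighbour number `c` of `u` is joined to `u`. -/
def neighborCheck (u c : ℕ) : Bool :=
  d.hasEdge u (d.neighbor u c) || d.hasEdge (d.neighbor u c) u

/-- The conditions on the adjacencies of the graph. -/
def adjacencyCheck : Bool :=
  Nat.ble (d.k + 4) 128 && Nat.ble 4 d.k && d.edges.all d.edgeCheck &&
    (d.hasEdge 0 1 && d.hasEdge 0 2 && d.hasEdge 0 3) &&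
    (d.hasEdge d.k (d.k + 3) && d.hasEdge (d.k + 1) (d.k + 3) && d.hasEdge (d.k + 2) (d.k + 3)) &&
    allBelow (fun u => d.neighborCheck u 0 && d.neighborCheck u 1 && d.neighborCheck u 2 &&
      d.neighborCheck u 3) (d.k + 4)

variable {d}

theorem hasBit_iff (m w : ℕ) : hasBit m w = true ↔ m.testBit w = true := by
  rw [hasBit, Nat.beq_eq, Nat.testBit_eq_decide_div_mod_eq, decide_eq_true_iff,
    ← Nat.shiftRight_eq_div_pow]
  rfl

theorem testBit_bitsOf (key : ℕ → ℕ) (l : List ℕ) (i : ℕ) :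
    (bitsOf key l).testBit i = true ↔ ∃ e ∈ l, key e = i := by
  induction l with
  | nil => simp [bitsOf]
  | cons e l ih =>
    change (2 ^ key e ||| bitsOf key l).testBit i = true ↔ _
    rw [Nat.testBit_or, Bool.or_eq_true, ih, Nat.testBit_two_pow, decide_eq_true_iff]
    simp

theorem hasEdge_iff {u v : ℕ} (hu : u < 128) (hv : v < 128) :
    d.hasEdge u v = true ↔ ∃ e ∈ d.edges, src e = u ∧ tgt e = v := by
  rw [hasEdge, hasBit_iff, testBit_bitsOf]
  refine exists_congr fun e => and_congr_right fun _ => ?_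
  change e % 16384 = u + 128 * v ↔ e % 128 = u ∧ e / 128 % 128 = v
  omega

theorem neighbor_lt (u c : ℕ) : d.neighbor u c < 128 := Nat.mod_lt _ (by norm_num)

theorem k_spec (h : d.adjacencyCheck = true) : d.k + 4 ≤ 128 ∧ 4 ≤ d.k := by
  simp only [adjacencyCheck, Bool.and_eq_true, Nat.ble_eq] at h
  exact h.1.1.1.1

theorem edge_spec (h : d.adjacencyCheck = true) {e : ℕ} (he : e ∈ d.edges) :
    (src e < tgt e ∧ tgt e < d.k + 4) ∧
    (lft e < d.faces ∧ rgt e < d.faces ∧ lft e ≠ rgt e) ∧ (0 < src e ∨ tgt e < 4) ∧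
    (tgt e < d.k + 3 ∨ d.k ≤ src e) ∧ (1 ≤ src e → 4 ≤ tgt e) ∧
    (d.k ≤ src e → d.k + 3 ≤ tgt e) := by
  simp only [adjacencyCheck, Bool.and_eq_true, List.all_eq_true] at h
  have := h.1.1.1.2 e he
  simp only [edgeCheck, Bool.and_eq_true, Bool.or_eq_true, Nat.blt_eq, Nat.ble_eq, Nat.beq_eq,
    Bool.not_eq_true', ← Bool.not_eq_true] at this
  omega

theorem adj_iff (h : d.adjacencyCheck = true) {a b : ℕ} : d.graph.Adj a b ↔
    ∃ e ∈ d.edges, (src e = a ∧ tgt e = b) ∨ (src e = b ∧ tgt e = a) := by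
  rw [graph, SimpleGraph.fromRel_adj]
  constructor
  · rintro ⟨-, ⟨e, he, h'⟩ | ⟨e, he, h'⟩⟩
    · exact ⟨e, he, Or.inl h'⟩
    · exact ⟨e, he, Or.inr h'⟩
  · rintro ⟨e, he, h'⟩
    have := (edge_spec h he).1.1
    refine ⟨by omega, ?_⟩
    exact h'.imp (fun h' => ⟨e, he, h'⟩) (fun h' => ⟨e, he, h'⟩)

theorem adj_of_hasEdge (h : d.adjacencyCheck = true) {u v : ℕ} (hu : u < 128) (hv : v < 128)
    (huv : d.hasEdge u v = true) : d.graph.Adj u v := by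
  obtain ⟨e, he, h'⟩ := (hasEdge_iff hu hv).1 huv
  exact (adj_iff h).2 ⟨e, he, Or.inl h'⟩

theorem lt_of_adj (h : d.adjacencyCheck = true) {a b : ℕ} (hab : d.graph.Adj a b) :
    a < d.k + 4 := by
  obtain ⟨e, he, h'⟩ := (adj_iff h).1 hab
  have := edge_spec h he
  omega

theorem adj_neighbor (h : d.adjacencyCheck = true) {u : ℕ} (hu : u < d.k + 4) (c : ℕ) :
    d.graph.Adj u (d.neighbor u (c % 4)) := by
  have hk := (k_spec h).1
  have h0 := h
  simp only [adjacencyCheck, Bool.and_eq_true, allBelow_iff] at h0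
  obtain ⟨⟨⟨h1, h2⟩, h3⟩, h4⟩ := h0.2 u hu
  have key : ∀ c, d.neighborCheck u c = true → d.graph.Adj u (d.neighbor u c) := by
    intro c hc
    rw [neighborCheck, Bool.or_eq_true] at hc
    rcases hc with hc | hc
    · exact adj_of_hasEdge h (by omega) (neighbor_lt u c) hc
    · exact (adj_of_hasEdge h (neighbor_lt u c) (by omega) hc).symm
  have h5 : c % 4 = 0 ∨ c % 4 = 1 ∨ c % 4 = 2 ∨ c % 4 = 3 := by omega
  rcases h5 with h5 | h5 | h5 | h5 <;> rw [h5] <;> apply key <;> assumption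

theorem adj_zero (h : d.adjacencyCheck = true) (u : ℕ) :
    d.graph.Adj 0 u ↔ u ∈ Set.Ico 1 4 := by
  constructor
  · intro hu
    obtain ⟨e, he, h'⟩ := (adj_iff h).1 hu
    have := edge_spec h he
    rw [Set.mem_Ico]
    omega
  · have h0 := h
    simp only [adjacencyCheck, Bool.and_eq_true] at h0
    obtain ⟨⟨h1, h2⟩, h3⟩ := h0.1.1.2
    rintro ⟨hu, hu'⟩
    have h5 : u = 1 ∨ u = 2 ∨ u = 3 := by omega
    rcases h5 with rfl | rfl | rfl
    exacts [adj_of_hasEdge h (by omega) (by omega) h1, adj_of_hasEdge h (by omega) (by omega) h2,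
      adj_of_hasEdge h (by omega) (by omega) h3]

theorem adj_last (h : d.adjacencyCheck = true) (u : ℕ) :
    d.graph.Adj (d.k + 3) u ↔ u ∈ Set.Ico d.k (d.k + 3) := by
  have hk := (k_spec h).1
  constructor
  · intro hu
    obtain ⟨e, he, h'⟩ := (adj_iff h).1 hu
    have := edge_spec h he
    rw [Set.mem_Ico]
    omega
  · have h0 := h
    simp only [adjacencyCheck, Bool.and_eq_true] at h0
    obtain ⟨⟨h1, h2⟩, h3⟩ := h0.1.2
    rintro ⟨hu, hu'⟩
    have h5 : u = d.k ∨ u = d.k + 1 ∨ u = d.k + 2 := by omega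
    rcases h5 with rfl | rfl | rfl
    exacts [(adj_of_hasEdge h (by omega) (by omega) h1).symm,
      (adj_of_hasEdge h (by omega) (by omega) h2).symm,
      (adj_of_hasEdge h (by omega) (by omega) h3).symm]

theorem not_adj_left (h : d.adjacencyCheck = true) :
    ∀ u ∈ Set.Ico 1 4, ∀ v ∈ Set.Ico 1 4, ¬ d.graph.Adj u v := by
  rintro u ⟨hu, hu'⟩ v ⟨hv, hv'⟩ huv
  obtain ⟨e, he, h'⟩ := (adj_iff h).1 huv
  have := edge_spec h he
  omega

theorem not_adj_right (h : d.adjacencyCheck = true) :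
    ∀ u ∈ Set.Ico d.k (d.k + 3), ∀ v ∈ Set.Ico d.k (d.k + 3), ¬ d.graph.Adj u v := by
  rintro u ⟨hu, hu'⟩ v ⟨hv, hv'⟩ huv
  obtain ⟨e, he, h'⟩ := (adj_iff h).1 huv
  have := edge_spec h he
  omega

variable (d)

/-- Follows the code of a cycle for `n` further vertices from the vertex `u`; the bits of `mask` are
the vertices still to be visited, and the last vertex has to be joined to `start`. -/
def walkCheck (start : ℕ) : ℕ → ℕ → ℕ → ℕ → Bool
  | 0, code, u, mask => Nat.beq mask 0 && Nat.beq (d.neighbor u (Nat.mod code 4)) start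
  | n + 1, code, u, mask => hasBit mask (d.neighbor u (Nat.mod code 4)) &&
      walkCheck start n (Nat.div code 4) (d.neighbor u (Nat.mod code 4))
        (Nat.xor mask (Nat.pow 2 (d.neighbor u (Nat.mod code 4))))

/-- Whether `code` is the code of a cycle through the `n + 1` vertices that are the bits of `mask`. -/
def cycleCheck (n mask code : ℕ) : Bool :=
  hasBit mask (Nat.mod code 128) && d.walkCheck (Nat.mod code 128) n (Nat.div code 128)
    (Nat.mod code 128) (Nat.xor mask (Nat.pow 2 (Nat.mod code 128)))

variable {d}

theorem testBit_xor_two_pow {m w : ℕ} (hw : m.testBit w = true) (z : ℕ) :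
    (m ^^^ 2 ^ w).testBit z = true ↔ m.testBit z = true ∧ z ≠ w := by
  rw [Nat.testBit_xor, Nat.testBit_two_pow]
  rcases eq_or_ne z w with rfl | hz
  · simp [hw]
  · simp [hz, hz.symm]

theorem exists_of_walkCheck (h : d.adjacencyCheck = true) {s : ℕ} :
    ∀ (n c u m : ℕ), d.walkCheck s n c u m = true → u < d.k + 4 →
      ∃ l : List ℕ, l.length = n ∧ (u :: l).IsChain d.graph.Adj ∧ l.Nodup ∧
        (∀ w, w ∈ l ↔ m.testBit w = true) ∧
        d.graph.Adj ((u :: l).getLast (List.cons_ne_nil _ _)) s := by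
  intro n
  induction n with
  | zero =>
    intro c u m hw hu
    rw [walkCheck, Bool.and_eq_true, Nat.beq_eq, Nat.beq_eq] at hw
    obtain ⟨rfl, rfl⟩ := hw
    exact ⟨[], rfl, by simp, by simp, by simp, adj_neighbor h hu c⟩
  | succ n ih =>
    intro c u m hw hu
    rw [walkCheck, Bool.and_eq_true, hasBit_iff] at hw
    obtain ⟨h1, h2⟩ := hw
    have hadj : d.graph.Adj u (d.neighbor u (Nat.mod c 4)) := adj_neighbor h hu c
    generalize d.neighbor u (Nat.mod c 4) = w at *
    change d.walkCheck s n _ w (m ^^^ 2 ^ w) = true at h2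
    obtain ⟨l, hl, hc, hn, hm, hlast⟩ := ih _ _ _ h2 (lt_of_adj h hadj.symm)
    simp only [testBit_xor_two_pow h1] at hm
    refine ⟨w :: l, by simp [hl], ?_, ?_, ?_, ?_⟩
    · exact List.isChain_cons_cons.2 ⟨hadj, hc⟩
    · exact List.nodup_cons.2 ⟨fun hwl => ((hm w).1 hwl).2 rfl, hn⟩
    · intro z
      rw [List.mem_cons, hm]
      rcases eq_or_ne z w with rfl | hz
      · simp [h1]
      · simp [hz]
    · rwa [List.getLast_cons (List.cons_ne_nil _ _)]

theorem hasCycleOn_of_cycleCheck (h : d.adjacencyCheck = true) {n m c : ℕ} (hn : 2 ≤ n)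
    (hm : ∀ w, m.testBit w = true → w < d.k + 4) (hc : d.cycleCheck n m c = true) :
    HasCycleOn d.graph {w | m.testBit w = true} := by
  rw [cycleCheck, Bool.and_eq_true, hasBit_iff] at hc
  obtain ⟨h1, h2⟩ := hc
  generalize Nat.mod c 128 = u at *
  change d.walkCheck u n _ u (m ^^^ 2 ^ u) = true at h2
  obtain ⟨l, hl, hch, hnd, hmem, hlast⟩ := exists_of_walkCheck h _ _ _ _ h2 (hm u h1)
  simp only [testBit_xor_two_pow h1] at hmem
  rcases List.eq_nil_or_concat l with rfl | ⟨p, v, rfl⟩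
  · simp at hl; omega
  rw [List.concat_eq_append] at *
  refine ⟨u, v, p, ?_, ?_, hch, ?_, ?_⟩
  · rintro rfl
    simp at hl; omega
  · simpa using hlast
  · exact List.nodup_cons.2 ⟨fun hu => ((hmem u).1 hu).2 rfl, hnd⟩
  · intro z
    rw [List.mem_cons, hmem, Set.mem_ofPred_eq]
    rcases eq_or_ne z u with rfl | hz
    · simp [h1]
    · simp [hz]

/-- The lists have the same length and corresponding entries satisfy `p`. -/
def all₂ (p : ℕ → ℕ → Bool) : List ℕ → List ℕ → Bool
  | [], [] => true
  | a :: l, b :: l' => p a b && all₂ p l l'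
  | _, _ => false

theorem exists_of_all₂ {p : ℕ → ℕ → Bool} : ∀ {l l' : List ℕ}, all₂ p l l' = true →
    ∀ a ∈ l, ∃ b, p a b = true
  | [], _, _ => by simp
  | _ :: _, [], h => by simp [all₂] at h
  | a :: l, b :: l', h => by
    rw [all₂, Bool.and_eq_true] at h
    intro z hz
    rcases List.mem_cons.1 hz with rfl | hz
    · exact ⟨b, h.1⟩
    · exact exists_of_all₂ h.2 z hz

variable (d)

/-- The conditions on the codes of cycles. -/
def hamiltonCheck : Bool :=
  all₂ (fun e c => d.cycleCheck (d.k + 1) ((2 ^ (d.k + 4) - 1) ^^^ 2 ^ src e ^^^ 2 ^ tgt e) c)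
    d.edges d.edgeCycles &&
  all₂ (fun t c => d.cycleCheck (d.k + 2) ((2 ^ (d.k + 4) - 1) ^^^ 2 ^ t) c)
    [1, 2, 3, d.k, d.k + 1, d.k + 2] d.terminalCycles

variable {d}

theorem hasCycleOn_sdiff_edge (h : d.adjacencyCheck = true) (h' : d.hamiltonCheck = true) (a b : ℕ)
    (hab : d.graph.Adj a b) : HasCycleOn d.graph (Set.Iio (d.k + 4) \ {a, b}) := by
  rw [hamiltonCheck, Bool.and_eq_true] at h'
  obtain ⟨e, he, hab'⟩ := (adj_iff h).1 hab
  obtain ⟨c, hc⟩ := exists_of_all₂ h'.1 e he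
  have hs := edge_spec h he
  have hk := k_spec h
  have hbit : ∀ w, ((2 ^ (d.k + 4) - 1) ^^^ 2 ^ src e ^^^ 2 ^ tgt e).testBit w = true ↔
      w < d.k + 4 ∧ w ≠ src e ∧ w ≠ tgt e := by
    intro w
    rw [testBit_xor_two_pow, testBit_xor_two_pow, Nat.testBit_two_pow_sub_one, decide_eq_true_iff,
      and_assoc]
    · rw [Nat.testBit_two_pow_sub_one, decide_eq_true_iff]; omega
    · rw [testBit_xor_two_pow, Nat.testBit_two_pow_sub_one, decide_eq_true_iff]
      · omega
      · rw [Nat.testBit_two_pow_sub_one, decide_eq_true_iff]; omega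
  have := hasCycleOn_of_cycleCheck h (by omega) (fun w hw => ((hbit w).1 hw).1) hc
  convert this using 1
  ext w
  rw [Set.mem_ofPred_eq, hbit]
  simp only [Set.mem_sdiff, Set.mem_Iio, Set.mem_insert_iff, Set.mem_singleton_iff]
  omega

theorem hasCycleOn_sdiff_terminal (h : d.adjacencyCheck = true) (h' : d.hamiltonCheck = true) {t : ℕ}
    (ht : t ∈ Set.Ico 1 4 ∪ Set.Ico d.k (d.k + 3)) :
    HasCycleOn d.graph (Set.Iio (d.k + 4) \ {t}) := by
  rw [hamiltonCheck, Bool.and_eq_true] at h'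
  have hk := k_spec h
  simp only [Set.mem_union, Set.mem_Ico] at ht
  obtain ⟨c, hc⟩ := exists_of_all₂ h'.2 t (by simp; omega)
  have hbit : ∀ w, ((2 ^ (d.k + 4) - 1) ^^^ 2 ^ t).testBit w = true ↔ w < d.k + 4 ∧ w ≠ t := by
    intro w
    rw [testBit_xor_two_pow, Nat.testBit_two_pow_sub_one, decide_eq_true_iff]
    rw [Nat.testBit_two_pow_sub_one, decide_eq_true_iff]; omega
  have := hasCycleOn_of_cycleCheck h (by omega) (fun w hw => ((hbit w).1 hw).1) hc
  convert this using 1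
  ext w
  rw [Set.mem_ofPred_eq, hbit]
  simp

end PieceData

end Certificates

/-! ### Non-Hamiltonicity of pieces from the face structure -/

section FaceCertificates

namespace PieceData

variable (d : PieceData)

/-- The incidences between vertices and faces at an edge, where the vertex `u` and the face `f` are
coded by the bit `128 * u + f`. -/
def incidence (e : ℕ) : ℕ :=
  Nat.xor
    (Nat.xor (Nat.pow 2 (Nat.add (Nat.mul 128 (src e)) (lft e)))
      (Nat.pow 2 (Nat.add (Nat.mul 128 (src e)) (rgt e))))
    (Nat.xor (Nat.pow 2 (Nat.add (Nat.mul 128 (tgt e)) (lft e)))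
      (Nat.pow 2 (Nat.add (Nat.mul 128 (tgt e)) (rgt e))))

/-- The number whose digits in base `1024` are the lengths of the faces. -/
def lengths : ℕ :=
  d.edges.foldr (fun e a => Nat.add (Nat.add (Nat.pow 1024 (lft e)) (Nat.pow 1024 (rgt e))) a) 0

/-- The conditions making the two faces along each edge a face structure to which Grinberg's criterion
applies, with the face `0` as the exceptional one. -/
def faceCheck : Bool :=
  -- around each vertex, every face is met an even number of times
  Nat.beq (d.edges.foldr (fun e a => Nat.xor (incidence e) a) 0) 0 && Nat.ble d.faces 128 &&
  -- every face except the face `0` has a neighbour with a smaller number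
  allBelow (fun f => Nat.beq f 0 ||
    hasBit (bitsOf (fun e => bif Nat.ble (lft e) (rgt e) then rgt e else lft e) d.edges) f) d.faces &&
  -- Euler's formula
  Nat.beq (d.k + 4 + d.faces) (d.edges.length + 2) &&
  -- the lengths of the faces
  Nat.blt d.edges.length 512 &&
  allBelow (fun f => Nat.beq f 0 || Nat.beq (Nat.mod (Nat.mod (Nat.div d.lengths (Nat.pow 1024 f))
    1024) 3) 2) d.faces &&
  !(Nat.beq ((d.k + 4) % 3) 2)

variable {d}

/-- The linear functional given by the weights `b` on the sets of faces at the vertex `u`. -/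
def bitSum {N : ℕ} (u : ℕ) (b : Fin N → ZMod 2) (m : ℕ) : ZMod 2 :=
  ∑ f : Fin N, if m.testBit (128 * u + f) then b f else 0

theorem bitSum_xor {N : ℕ} (u : ℕ) (b : Fin N → ZMod 2) (m m' : ℕ) :
    bitSum u b (m ^^^ m') = bitSum u b m + bitSum u b m' := by
  rw [bitSum, bitSum, bitSum, ← Finset.sum_add_distrib]
  refine Finset.sum_congr rfl fun f _ => ?_
  rw [Nat.testBit_xor]
  generalize b f = z
  cases m.testBit (128 * u + f) <;> cases m'.testBit (128 * u + f) <;> revert z <;> decide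

theorem bitSum_two_pow {N : ℕ} (hN : N ≤ 128) (u v : ℕ) (b : Fin N → ZMod 2) {f : ℕ} (hf : f < N) :
    bitSum u b (2 ^ (128 * v + f)) = if v = u then b ⟨f, hf⟩ else 0 := by
  have h : ∀ g : Fin N, 128 * v + f = 128 * u + g.val ↔ v = u ∧ g = ⟨f, hf⟩ := by
    intro g
    simp only [Fin.ext_iff]
    omega
  simp only [bitSum, Nat.testBit_two_pow, h, decide_eq_true_iff]
  by_cases hv : v = u <;> simp [hv]

theorem bitSum_foldr {N : ℕ} (u : ℕ) (b : Fin N → ZMod 2) (w : ℕ → ℕ) (l : List ℕ) :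
    bitSum u b (l.foldr (fun e a => Nat.xor (w e) a) 0) =
      (l.map fun e => bitSum u b (w e)).sum := by
  induction l with
  | nil => simp [bitSum]
  | cons e l ih =>
    rw [List.foldr_cons, List.map_cons, List.sum_cons, ← ih]
    exact bitSum_xor u b _ _

theorem sum_mul_pow_div_mod (b : ℕ) : ∀ (N : ℕ) (c : ℕ → ℕ), (∀ f, c f < b) → ∀ g < N,
    (∑ f ∈ Finset.range N, c f * b ^ f) / b ^ g % b = c g
  | 0, _, _, _, hg => by omega
  | N + 1, c, hc, g, hg => by
    have hb : 0 < b := (Nat.zero_le _).trans_lt (hc 0)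
    have h : ∑ f ∈ Finset.range (N + 1), c f * b ^ f =
        c 0 + b * ∑ f ∈ Finset.range N, c (f + 1) * b ^ f := by
      rw [Finset.sum_range_succ', Finset.mul_sum, add_comm, pow_zero, mul_one]
      exact congrArg _ (Finset.sum_congr rfl fun f _ => by ring)
    rw [h]
    rcases g with _ | g
    · rw [pow_zero, Nat.div_one, Nat.add_mul_mod_self_left, Nat.mod_eq_of_lt (hc 0)]
    · rw [pow_succ', ← Nat.div_div_eq_div_mul, Nat.add_mul_div_left _ _ hb,
        Nat.div_eq_of_lt (hc 0), zero_add]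
      exact sum_mul_pow_div_mod b N _ (fun f => hc _) g (by omega)

theorem lengths_eq (h : d.adjacencyCheck = true) : d.lengths = ∑ f ∈ Finset.range d.faces,
    (d.edges.countP (fun e => Nat.beq (lft e) f) + d.edges.countP (fun e => Nat.beq (rgt e) f)) *
      1024 ^ f := by
  have key : ∀ l : List ℕ, (∀ e ∈ l, lft e < d.faces ∧ rgt e < d.faces) →
      l.foldr (fun e a => Nat.add (Nat.add (Nat.pow 1024 (lft e)) (Nat.pow 1024 (rgt e))) a) 0 =
      ∑ f ∈ Finset.range d.faces, (l.countP (fun e => Nat.beq (lft e) f) +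
        l.countP (fun e => Nat.beq (rgt e) f)) * 1024 ^ f := by
    intro l hl
    induction l with
    | nil => simp
    | cons e l ih =>
      have h1 : ∀ g < d.faces, (1024 : ℕ) ^ g = ∑ f ∈ Finset.range d.faces,
          (if Nat.beq g f = true then 1 else 0) * 1024 ^ f := by
        intro g hg
        simp [Finset.mem_range.2 hg]
      rw [List.foldr_cons, ih fun e he => hl e (List.mem_cons_of_mem _ he)]
      change (1024 ^ lft e + 1024 ^ rgt e) + _ = _
      rw [h1 _ (hl e List.mem_cons_self).1, h1 _ (hl e List.mem_cons_self).2,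
        ← Finset.sum_add_distrib, ← Finset.sum_add_distrib]
      refine Finset.sum_congr rfl fun f _ => ?_
      rw [List.countP_cons, List.countP_cons]
      ring
  exact key _ fun e he => ⟨(edge_spec h he).2.1.1, (edge_spec h he).2.1.2.1⟩

theorem ncard_fin_length (l : List ℕ) (p : ℕ → Bool) :
    {i : Fin l.length | p l[i] = true}.ncard = l.countP p := by
  rw [Set.ncard_eq_toFinset_card', List.countP_eq_length_filter]
  have := Fin.sum_univ_fun_getElem l fun e => if p e = true then 1 else 0
  rw [← Finset.card_filter] at this
  have hsum : ∀ l : List ℕ, (l.map fun e => if p e = true then 1 else 0).sum = (l.filter p).length := by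
    intro l
    induction l with
    | nil => rfl
    | cons a l ih => by_cases h : p a = true <;> simp [h, ih, Nat.add_comm]
  rw [hsum] at this
  convert this using 1
  congr 1; ext; simp

/-- The face structure described by a certificate. -/
def faceStructure (h : d.adjacencyCheck = true) (h' : d.faceCheck = true) :
    FaceStructure ℕ (Fin d.edges.length) (Fin d.faces) (d.k + 4) where
  src i := src d.edges[i]
  tgt i := tgt d.edges[i]
  left i := ⟨lft d.edges[i], (edge_spec h (List.getElem_mem _)).2.1.1⟩
  right i := ⟨rgt d.edges[i], (edge_spec h (List.getElem_mem _)).2.1.2.1⟩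
  even_vertex b u := by
    simp only [faceCheck, Bool.and_eq_true, Nat.beq_eq, Nat.ble_eq] at h'
    have h1 := congrArg (bitSum u b) h'.1.1.1.1.1.1
    have h2 : bitSum u b 0 = 0 := by simp [bitSum]
    rw [bitSum_foldr, ← Fin.sum_univ_fun_getElem, h2] at h1
    rw [Finset.sum_filter]
    refine (Finset.sum_congr rfl fun i _ => ?_).trans h1
    have hs := edge_spec h (List.getElem_mem i.2)
    have key := bitSum_two_pow h'.1.1.1.1.1.2 u
    simp only [Fin.getElem_fin]
    change _ = bitSum u b ((2 ^ (128 * src d.edges[i.val] + lft d.edges[i.val]) ^^^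
      2 ^ (128 * src d.edges[i.val] + rgt d.edges[i.val])) ^^^
      (2 ^ (128 * tgt d.edges[i.val] + lft d.edges[i.val]) ^^^
      2 ^ (128 * tgt d.edges[i.val] + rgt d.edges[i.val])))
    rw [bitSum_xor, bitSum_xor, bitSum_xor, key _ b hs.2.1.1, key _ b hs.2.1.2.1,
      key _ b hs.2.1.1, key _ b hs.2.1.2.1]
    by_cases hsrc : src d.edges[i.val] = u
    · have htgt : tgt d.edges[i.val] ≠ u := fun htgt => hs.1.1.ne (hsrc.trans htgt.symm)
      rw [if_pos (Or.inl hsrc)]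
      simp only [if_pos hsrc, if_neg htgt, add_zero]
    · by_cases htgt : tgt d.edges[i.val] = u
      · rw [if_pos (Or.inr htgt)]
        simp only [if_neg hsrc, if_pos htgt, zero_add]
      · rw [if_neg (by tauto)]
        simp only [if_neg hsrc, if_neg htgt, add_zero]
  dual_connected S hS hc := by
    simp only [faceCheck, Bool.and_eq_true, allBelow_iff, Nat.beq_eq, Bool.or_eq_true,
      hasBit_iff, testBit_bitsOf] at h'
    have step : ∀ f : Fin d.faces, f.val ≠ 0 → ∃ g : Fin d.faces, g < f ∧ (f ∈ S ↔ g ∈ S) := by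
      intro f hf
      obtain ⟨e, he, h1⟩ := (h'.1.1.1.1.2 f f.2).resolve_left hf
      obtain ⟨i, hi, rfl⟩ := List.getElem_of_mem he
      have h2 := hc ⟨i, hi⟩
      have hs := edge_spec h he
      rcases hle : Nat.ble (lft d.edges[i]) (rgt d.edges[i]) with _ | _ <;>
        rw [hle] at h1 <;> simp only [cond_true, cond_false] at h1
      · rw [← Bool.not_eq_true, Nat.ble_eq] at hle
        refine ⟨⟨_, hs.2.1.2.1⟩, by rw [Fin.lt_def, ← h1]; exact not_le.1 hle, ?_⟩
        rw [← show (⟨_, hs.2.1.1⟩ : Fin d.faces) = f from Fin.ext h1]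
        exact h2
      · rw [Nat.ble_eq] at hle
        refine ⟨⟨_, hs.2.1.1⟩, by rw [Fin.lt_def, ← h1]; exact lt_of_le_of_ne hle hs.2.1.2.2, ?_⟩
        rw [← show (⟨_, hs.2.1.2.1⟩ : Fin d.faces) = f from Fin.ext h1]
        exact h2.symm
    obtain ⟨f₁, hf₁⟩ := hS
    have key : ∀ (m : ℕ) (f : Fin d.faces), f.val = m → (f ∈ S ↔ ⟨0, f.pos⟩ ∈ S) := by
      intro m
      induction m using Nat.strong_induction_on with
      | _ m ih =>
        intro f hf
        by_cases h0 : f.val = 0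
        · have : f = ⟨0, f.pos⟩ := Fin.ext h0
          rw [← this]
        · obtain ⟨g, hg, hfg⟩ := step f h0
          rw [hfg]
          exact ih g.val (by omega) g rfl
    exact Set.eq_univ_of_forall fun f => (key _ f rfl).2 ((key _ f₁ rfl).1 hf₁)
  euler := by
    simp only [faceCheck, Bool.and_eq_true, Nat.beq_eq] at h'
    simpa using h'.1.1.1.2

theorem not_hasCycleOn (h : d.adjacencyCheck = true) (h' : d.faceCheck = true) :
    ¬ HasCycleOn d.graph (Set.Iio (d.k + 4)) := by
  have h0 := h'
  simp only [faceCheck, Bool.and_eq_true, allBelow_iff, Nat.beq_eq, Bool.or_eq_true,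
    Bool.not_eq_true', ← Bool.not_eq_true] at h0
  have hpos : 0 < d.faces := by
    obtain ⟨e, he, -⟩ := (adj_iff h).1 ((adj_zero h 1).2 (by simp))
    have := edge_spec h he
    omega
  rintro ⟨u, v, m, hm, hvu, hc, hnd, hmem⟩
  set l := u :: (m ++ [v]) with hl
  have hlen : l.length = d.k + 4 := by
    have : l.toFinset = Finset.range (d.k + 4) := by
      ext z; rw [List.mem_toFinset, hmem, Finset.mem_range, Set.mem_Iio]
    rw [← List.toFinset_card_of_nodup hnd, this, Finset.card_range]
  have hval : ∀ i : ZMod (d.k + 4), i.val < l.length := fun i => by rw [hlen]; exact i.val_lt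
  have hadj : ∀ i : ZMod (d.k + 4), d.graph.Adj (l[i.val]'(hval i))
      (l[(i + 1).val]'(hval (i + 1))) := by
    intro i
    have hi := i.val_lt
    rcases Nat.lt_or_ge (i.val + 1) (d.k + 4) with h1 | h1
    · have h2 : (i + 1).val = i.val + 1 := by
        have : (1 : ZMod (d.k + 4)).val = 1 := ZMod.val_one'' (by omega)
        rw [ZMod.val_add_of_lt (by omega), this]
      simp only [h2]
      exact List.isChain_iff_getElem.1 hc i.val (by omega)
    · have h2 : (i + 1).val = 0 := by
        have : i + 1 = 0 := by
          rw [← ZMod.natCast_zmod_val i, show i.val = d.k + 3 by omega]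
          have := ZMod.natCast_self (d.k + 4)
          push_cast at this ⊢
          linear_combination this
        rw [this, ZMod.val_zero]
      have h3 : i.val = l.length - 1 := by omega
      simp only [h2, h3]
      rw [← List.getLast_eq_getElem (by simp [hl])]
      simpa [hl] using hvu
  have hex : ∀ i : ZMod (d.k + 4), ∃ j : Fin d.edges.length,
      (src d.edges[j] = l[i.val]'(hval i) ∧
        tgt d.edges[j] = l[(i + 1).val]'(hval (i + 1))) ∨
      (src d.edges[j] = l[(i + 1).val]'(hval (i + 1)) ∧
        tgt d.edges[j] = l[i.val]'(hval i)) := by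
    intro i
    obtain ⟨e, he, h1⟩ := (adj_iff h).1 (hadj i)
    obtain ⟨j, hj, rfl⟩ := List.getElem_of_mem he
    exact ⟨⟨j, hj⟩, h1⟩
  choose e he using hex
  refine (faceStructure h h').not_isCycle ⟨0, hpos⟩ ?_ h0.2
    (fun i => l[i.val]'(hval i)) e ⟨by omega, ?_, he⟩
  · intro f hf
    have h1 := (h0.1.2 f f.2).resolve_left fun hh => hf (Fin.ext hh)
    change d.lengths / 1024 ^ f.val % 1024 % 3 = 2 at h1
    rw [lengths_eq h, sum_mul_pow_div_mod _ _ (fun f => d.edges.countP (fun e => Nat.beq (lft e) f) +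
      d.edges.countP (fun e => Nat.beq (rgt e) f)) (fun g => ?_) f f.2] at h1
    swap
    · have h2 := List.countP_le_length (p := fun e => Nat.beq (lft e) g) (l := d.edges)
      have h3 := List.countP_le_length (p := fun e => Nat.beq (rgt e) g) (l := d.edges)
      have h4 := (Nat.blt_eq ▸ h0.1.1.2 : d.edges.length < 512)
      change _ + _ < _
      omega
    rw [← ncard_fin_length, ← ncard_fin_length] at h1
    simpa [FaceStructure.faceLength, faceStructure, Fin.ext_iff] using h1
  · intro i j hij
    exact ZMod.val_injective _ ((List.Nodup.getElem_inj_iff hnd).1 hij)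

end PieceData

end FaceCertificates

/-! ### Checking straight-line drawings with integer coordinates -/

section DrawingCertificates

/-- Twice the signed area of a triangle. -/
def signedArea (X Y : ℕ → ℝ) (a b c : ℕ) : ℝ :=
  (X b - X a) * (Y c - Y a) - (Y b - Y a) * (X c - X a)

/-- The segments from `a` to `b` and from `c` to `e` have no points in common except possibly common
ends. -/
def MeetAtEnds (X Y : ℕ → ℝ) (a b c e : ℕ) : Prop :=
  ∀ t ∈ Set.Icc (0 : ℝ) 1, ∀ t' ∈ Set.Icc (0 : ℝ) 1,
    AffineMap.lineMap (X a) (X b) t = AffineMap.lineMap (X c) (X e) t' →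
    AffineMap.lineMap (Y a) (Y b) t = AffineMap.lineMap (Y c) (Y e) t' →
    (t = 0 ∨ t = 1) ∧ (t' = 0 ∨ t' = 1)

section MeetAtEnds

variable {X Y : ℕ → ℝ} {a b c e : ℕ}

theorem MeetAtEnds.symm (h : MeetAtEnds X Y a b c e) : MeetAtEnds X Y c e a b :=
  fun t ht t' ht' h1 h2 => (h t' ht' t ht h1.symm h2.symm).symm

theorem lineMap_swap (x y t : ℝ) : AffineMap.lineMap x y t = AffineMap.lineMap y x (1 - t) :=
  (AffineMap.lineMap_apply_one_sub y x t).symm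

theorem MeetAtEnds.swap (h : MeetAtEnds X Y a b c e) : MeetAtEnds X Y b a c e := by
  intro t ht t' ht' h1 h2
  rw [lineMap_swap] at h1 h2
  obtain ⟨h3, h4⟩ := h (1 - t) ⟨by linarith [ht.2], by linarith [ht.1]⟩ t' ht' h1 h2
  refine ⟨?_, h4⟩
  rcases h3 with h3 | h3
  · right; linarith
  · left; linarith

theorem signedArea_comm : signedArea X Y b a c = -signedArea X Y a b c := by
  rw [signedArea, signedArea]; ring

/-- At a common point of two segments, the signed areas of the ends of one of them relative to the
other balance. -/
theorem signedArea_eq_zero {t t' : ℝ}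
    (hx : AffineMap.lineMap (X a) (X b) t = AffineMap.lineMap (X c) (X e) t')
    (hy : AffineMap.lineMap (Y a) (Y b) t = AffineMap.lineMap (Y c) (Y e) t') :
    (1 - t') * signedArea X Y a b c + t' * signedArea X Y a b e = 0 := by
  simp only [AffineMap.lineMap_apply, vsub_eq_sub, vadd_eq_add, smul_eq_mul] at hx hy
  rw [signedArea, signedArea]
  linear_combination (Y b - Y a) * hx - (X b - X a) * hy

theorem eq_zero_or_one_of_pos_nonneg {p q t : ℝ} (ht : t ∈ Set.Icc (0 : ℝ) 1)
    (h : (1 - t) * p + t * q = 0) (hpq : (0 < p ∧ 0 ≤ q) ∨ (0 < q ∧ 0 ≤ p)) : t = 0 ∨ t = 1 := by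
  have h0 := ht.1
  have h1 : 0 ≤ 1 - t := by linarith [ht.2]
  rcases hpq with ⟨hp, hq⟩ | ⟨hq, hp⟩
  · right
    have := mul_nonneg h0 hq
    have h2 : (1 - t) * p = 0 := le_antisymm (by linarith) (mul_nonneg h1 hp.le)
    rcases mul_eq_zero.1 h2 with h2 | h2 <;> linarith
  · left
    have := mul_nonneg h1 hp
    have h2 : t * q = 0 := le_antisymm (by linarith) (mul_nonneg h0 hq.le)
    rcases mul_eq_zero.1 h2 with h2 | h2 <;> linarith

theorem not_eq_zero_of_pos {p q t : ℝ} (ht : t ∈ Set.Icc (0 : ℝ) 1) (hp : 0 < p) (hq : 0 < q) :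
    (1 - t) * p + t * q ≠ 0 := by
  intro h
  rcases eq_zero_or_one_of_pos_nonneg ht h (Or.inl ⟨hp, hq.le⟩) with rfl | rfl <;> simp at h <;>
    linarith

end MeetAtEnds

namespace PieceData

variable (d : PieceData)

/-- Whether the vertices `a`, `b`, `c` form a positively oriented triangle. -/
def ccw (a b c : ℕ) : Bool :=
  Nat.blt
    (Nat.add (Nat.add (Nat.mul (d.x b) (d.y a)) (Nat.mul (d.x a) (d.y c))) (Nat.mul (d.x c) (d.y b)))
    (Nat.add (Nat.add (Nat.mul (d.x b) (d.y c)) (Nat.mul (d.x c) (d.y a))) (Nat.mul (d.x a) (d.y b)))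

/-- Whether `c` and `e` are strictly on the same side of the line through `a` and `b`. -/
def strictSide (a b c e : ℕ) : Bool :=
  (d.ccw a b c && d.ccw a b e) || (d.ccw b a c && d.ccw b a e)

/-- Whether `c` and `e` are on the same closed side of the line through `a` and `b` and not both on
this line. -/
def weakSide (a b c e : ℕ) : Bool :=
  (d.ccw a b c && !d.ccw b a e) || (d.ccw a b e && !d.ccw b a c) ||
    (d.ccw b a c && !d.ccw a b e) || (d.ccw b a e && !d.ccw a b c)

/-- Whether two edges, drawn from left to right, meet at most in a common end. -/
def sepCheck (e f : ℕ) : Bool :=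
  Nat.blt (d.x (tgt e)) (d.x (src f)) || Nat.blt (d.x (tgt f)) (d.x (src e)) ||
    d.strictSide (src e) (tgt e) (src f) (tgt f) || d.strictSide (src f) (tgt f) (src e) (tgt e) ||
    (d.weakSide (src e) (tgt e) (src f) (tgt f) && d.weakSide (src f) (tgt f) (src e) (tgt e))

/-- Any two entries of the list, in this order, satisfy `p`. -/
def pairwiseCheck (p : ℕ → ℕ → Bool) : List ℕ → Bool
  | [] => true
  | a :: l => l.all (p a) && pairwiseCheck p l

/-- Whether the terminals number `i` on both sides are in their prescribed places. -/
def terminalCheck (i : ℕ) : Bool :=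
  Nat.beq (d.x (d.k + i)) (d.x d.k) && Nat.beq (d.y (d.k + i)) ((i + 1) * 1000000) &&
    Nat.beq (d.x (1 + i)) (d.x 1) && Nat.beq (d.y (1 + i)) ((i + 1) * 1000000)

/-- The conditions on the coordinates. -/
def drawingCheck : Bool :=
  pairwiseCheck d.sepCheck d.edges &&
  d.edges.all (fun e => Nat.ble (d.x (src e)) (d.x (tgt e))) &&
  allBelow (fun u => allBelow (fun v =>
    !(Nat.beq (d.x u) (d.x v) && Nat.beq (d.y u) (d.y v))) u) (d.k + 4) &&
  -- the terminals are in their prescribed places, and all other vertices on the right side of them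
  allBelow d.terminalCheck 3 &&
  allBelow (fun u => Nat.blt (d.x u) (d.x d.k)) d.k &&
  Nat.blt (d.x d.k) (d.x (d.k + 3)) &&
  allBelow (fun u => Nat.blt u 4 || Nat.blt (d.x 1) (d.x u)) (d.k + 4)

variable {d}

theorem ccw_iff {a b c : ℕ} : d.ccw a b c = true ↔
    0 < signedArea (fun u => d.x u) (fun u => d.y u) a b c := by
  rw [ccw, Nat.blt_eq, signedArea]
  change d.x b * d.y a + d.x a * d.y c + d.x c * d.y b <
    d.x b * d.y c + d.x c * d.y a + d.x a * d.y b ↔ _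
  rw [← Nat.cast_lt (α := ℝ)]
  push_cast
  constructor <;> intro h <;> nlinarith

theorem not_ccw_iff {a b c : ℕ} : d.ccw b a c = false ↔
    0 ≤ signedArea (fun u => d.x u) (fun u => d.y u) a b c := by
  rw [← Bool.not_eq_true, ccw_iff, signedArea_comm]
  constructor <;> intro h <;> linarith

theorem meetAtEnds_of_strictSide {a b c e : ℕ} (h : d.strictSide a b c e = true) :
    MeetAtEnds (fun u => d.x u) (fun u => d.y u) a b c e := by
  intro t ht t' ht' hx hy
  have h0 := signedArea_eq_zero (X := fun u => (d.x u : ℝ)) (Y := fun u => (d.y u : ℝ)) hx hy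
  simp only [strictSide, Bool.or_eq_true, Bool.and_eq_true, ccw_iff] at h
  rcases h with ⟨h1, h2⟩ | ⟨h1, h2⟩
  · exact absurd h0 (not_eq_zero_of_pos ht' h1 h2)
  · rw [signedArea_comm] at h1 h2
    exact absurd (by linear_combination -h0) (not_eq_zero_of_pos ht' h1 h2)

theorem eq_zero_or_one_of_weakSide {a b c e : ℕ} (h : d.weakSide a b c e = true) {t t' : ℝ}
    (ht' : t' ∈ Set.Icc (0 : ℝ) 1)
    (hx : AffineMap.lineMap (d.x a : ℝ) (d.x b : ℝ) t =
      AffineMap.lineMap (d.x c : ℝ) (d.x e : ℝ) t')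
    (hy : AffineMap.lineMap (d.y a : ℝ) (d.y b : ℝ) t =
      AffineMap.lineMap (d.y c : ℝ) (d.y e : ℝ) t') : t' = 0 ∨ t' = 1 := by
  have h0 := signedArea_eq_zero (X := fun u => (d.x u : ℝ)) (Y := fun u => (d.y u : ℝ)) hx hy
  have h0' : (1 - t') * signedArea (fun u => (d.x u : ℝ)) (fun u => (d.y u : ℝ)) b a c +
      t' * signedArea (fun u => (d.x u : ℝ)) (fun u => (d.y u : ℝ)) b a e = 0 := by
    rw [signedArea_comm (a := a), signedArea_comm (a := a)]
    linear_combination -h0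
  simp only [weakSide, Bool.or_eq_true, Bool.and_eq_true, Bool.not_eq_true', ccw_iff,
    not_ccw_iff] at h
  rcases h with ((h | h) | h) | h
  · exact eq_zero_or_one_of_pos_nonneg ht' h0 (Or.inl h)
  · exact eq_zero_or_one_of_pos_nonneg ht' h0 (Or.inr h)
  · exact eq_zero_or_one_of_pos_nonneg ht' h0' (Or.inl h)
  · exact eq_zero_or_one_of_pos_nonneg ht' h0' (Or.inr h)

theorem lineMap_mem_Icc {x y t : ℝ} (hxy : x ≤ y) (ht : t ∈ Set.Icc (0 : ℝ) 1) :
    AffineMap.lineMap x y t ∈ Set.Icc x y := by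
  simp only [AffineMap.lineMap_apply, vsub_eq_sub, vadd_eq_add, smul_eq_mul, Set.mem_Icc]
  have h1 := mul_nonneg ht.1 (sub_nonneg.2 hxy)
  have h2 := mul_nonneg (sub_nonneg.2 ht.2) (sub_nonneg.2 hxy)
  constructor <;> linarith

theorem meetAtEnds_of_lt {a b c e : ℕ} (hab : d.x a ≤ d.x b) (hce : d.x c ≤ d.x e)
    (h : d.x b < d.x c) : MeetAtEnds (fun u => d.x u) (fun u => d.y u) a b c e := by
  intro t ht t' ht' hx hy
  have h1 := (lineMap_mem_Icc (Nat.cast_le (α := ℝ).2 hab) ht).2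
  have h2 := (lineMap_mem_Icc (Nat.cast_le (α := ℝ).2 hce) ht').1
  have h3 := Nat.cast_lt (α := ℝ).2 h
  simp only at hx
  rw [hx] at h1
  exact absurd (h2.trans h1) (not_le.2 h3)

theorem meetAtEnds_of_sepCheck {e f : ℕ} (he : d.x (src e) ≤ d.x (tgt e))
    (hf : d.x (src f) ≤ d.x (tgt f)) (h : d.sepCheck e f = true) :
    MeetAtEnds (fun u => d.x u) (fun u => d.y u) (src e) (tgt e) (src f) (tgt f) := by
  simp only [sepCheck, Bool.or_eq_true, Bool.and_eq_true, Nat.blt_eq] at h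
  rcases h with (((h | h) | h) | h) | ⟨h1, h2⟩
  · exact meetAtEnds_of_lt he hf h
  · exact (meetAtEnds_of_lt hf he h).symm
  · exact meetAtEnds_of_strictSide h
  · exact (meetAtEnds_of_strictSide h).symm
  · exact fun t ht t' ht' hx hy => ⟨eq_zero_or_one_of_weakSide h2 ht hx.symm hy.symm,
      eq_zero_or_one_of_weakSide h1 ht' hx hy⟩

theorem pairwise_of_pairwiseCheck {p : ℕ → ℕ → Bool} : ∀ {l : List ℕ}, pairwiseCheck p l = true →
    l.Pairwise fun a b => p a b = true
  | [], _ => List.Pairwise.nil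
  | a :: l, h => by
    rw [pairwiseCheck, Bool.and_eq_true, List.all_eq_true] at h
    exact List.pairwise_cons.2 ⟨h.1, pairwise_of_pairwiseCheck h.2⟩

theorem meetAtEnds (h : d.adjacencyCheck = true) (h' : d.drawingCheck = true) {a b c e : ℕ}
    (hab : d.graph.Adj a b) (hce : d.graph.Adj c e) (hne : s(a, b) ≠ s(c, e)) :
    MeetAtEnds (fun u => d.x u) (fun u => d.y u) a b c e := by
  simp only [drawingCheck, Bool.and_eq_true, List.all_eq_true, Nat.ble_eq] at h'
  have hle := h'.1.1.1.1.1.2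
  have hp := (pairwise_of_pairwiseCheck h'.1.1.1.1.1.1).imp_of_mem
    (S := fun e f => MeetAtEnds (fun u => d.x u) (fun u => d.y u) (src e) (tgt e) (src f) (tgt f))
    fun he hf hs => meetAtEnds_of_sepCheck (hle _ he) (hle _ hf) hs
  obtain ⟨f, hf, hf'⟩ := (adj_iff h).1 hab
  obtain ⟨g, hg, hg'⟩ := (adj_iff h).1 hce
  have hfg : f ≠ g := by
    rintro rfl
    apply hne
    rcases hf' with ⟨rfl, rfl⟩ | ⟨rfl, rfl⟩ <;> rcases hg' with ⟨rfl, rfl⟩ | ⟨rfl, rfl⟩ <;>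
      simp [Sym2.eq_swap]
  have : Std.Symm fun e f =>
      MeetAtEnds (fun u => d.x u) (fun u => d.y u) (src e) (tgt e) (src f) (tgt f) :=
    ⟨fun _ _ h => h.symm⟩
  have hm := hp.forall hf hg hfg
  rcases hf' with ⟨rfl, rfl⟩ | ⟨rfl, rfl⟩ <;> rcases hg' with ⟨rfl, rfl⟩ | ⟨rfl, rfl⟩
  exacts [hm, hm.symm.swap.symm, hm.swap, hm.swap.symm.swap.symm]

theorem injOn (h' : d.drawingCheck = true) {u v : ℕ} (hu : u < d.k + 4) (hv : v < d.k + 4)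
    (hx : d.x u = d.x v) (hy : d.y u = d.y v) : u = v := by
  simp only [drawingCheck, Bool.and_eq_true, allBelow_iff, Bool.not_eq_true',
    ← Bool.not_eq_true, Nat.beq_eq] at h'
  have := h'.1.1.1.1.2
  rcases lt_trichotomy u v with huv | huv | huv
  · have := this v hv u huv; omega
  · exact huv
  · have := this u hu v huv; omega

theorem isStraightDrawing (h : d.adjacencyCheck = true) (h' : d.drawingCheck = true) :
    IsStraightDrawing d.graph (Set.Iio (d.k + 4)) (fun u => d.x u) (fun u => d.y u) where
  injOn u hu v hv hx hy := injOn h' hu hv (Nat.cast_injective hx) (Nat.cast_injective hy)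
  vertex a ha b hb hab v hv t ht := by
    rintro ⟨hx, hy⟩
    have ht0 := ht.1
    have ht1 := ht.2
    have hI : t ∈ Set.Icc (0 : ℝ) 1 := ⟨ht0.le, ht1.le⟩
    have hends : v = a ∨ v = b := by
      by_contra hcon
      rw [not_or] at hcon
      -- compare `ab` with an edge at `v`
      have hvw := adj_neighbor h hv 0
      generalize d.neighbor v (0 % 4) = w at hvw
      have := meetAtEnds h h' hab hvw (by
        intro heq
        have : v ∈ s(a, b) := by rw [heq]; simp
        simp only [Sym2.mem_iff] at this
        tauto) t hI 0 (by simp) (by simpa using hx) (by simpa using hy)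
      rcases this.1 with h0 | h0 <;> linarith
    have heq : (d.x a : ℝ) = d.x b ∧ (d.y a : ℝ) = d.y b := by
      simp only [AffineMap.lineMap_apply, vsub_eq_sub, vadd_eq_add, smul_eq_mul] at hx hy
      rcases hends with rfl | rfl
      · constructor
        · have : t * ((d.x b : ℝ) - d.x v) = 0 := by linarith
          rcases mul_eq_zero.1 this with h0 | h0 <;> linarith
        · have : t * ((d.y b : ℝ) - d.y v) = 0 := by linarith
          rcases mul_eq_zero.1 this with h0 | h0 <;> linarith
      · constructor
        · have : (1 - t) * ((d.x v : ℝ) - d.x a) = 0 := by linarith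
          rcases mul_eq_zero.1 this with h0 | h0 <;> linarith
        · have : (1 - t) * ((d.y v : ℝ) - d.y a) = 0 := by linarith
          rcases mul_eq_zero.1 this with h0 | h0 <;> linarith
    exact hab.ne (injOn h' ha hb (Nat.cast_injective heq.1) (Nat.cast_injective heq.2))
  edge a _ b _ hab c _ e _ hce hne t ht t' ht' := by
    rintro ⟨hx, hy⟩
    have ht0 := ht.1
    have ht1 := ht.2
    have := (meetAtEnds h h' hab hce hne t ⟨ht0.le, ht1.le⟩ t' ⟨ht'.1.le, ht'.2.le⟩ hx hy).1
    rcases this with h0 | h0 <;> linarith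

theorem drawing_spec (h' : d.drawingCheck = true) :
    (∀ u < d.k, d.x u < d.x d.k) ∧ d.x d.k < d.x (d.k + 3) ∧
    (∀ u, 4 ≤ u → u < d.k + 4 → d.x 1 < d.x u) ∧
    ∀ i < 3, d.x (d.k + i) = d.x d.k ∧ d.y (d.k + i) = (i + 1) * 1000000 ∧
      d.x (1 + i) = d.x 1 ∧ d.y (1 + i) = (i + 1) * 1000000 := by
  simp only [drawingCheck, Bool.and_eq_true, allBelow_iff, Nat.blt_eq, Nat.beq_eq, terminalCheck,
    Bool.or_eq_true] at h'
  refine ⟨h'.1.1.2, h'.1.2, fun u hu hu' => (h'.2 u hu').resolve_left (by omega), fun i hi => ?_⟩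
  obtain ⟨⟨⟨h1, h2⟩, h3⟩, h4⟩ := h'.1.1.1.2 i hi
  exact ⟨h1, h2, h3, h4⟩

variable (d)

/-- All the checks on a certificate. -/
def check : Bool := d.adjacencyCheck && d.faceCheck && d.drawingCheck && d.hamiltonCheck

variable {d}

theorem isPiece (h : d.check = true) : IsPiece d.k d.graph := by
  simp only [check, Bool.and_eq_true] at h
  obtain ⟨⟨⟨ha, hf⟩, hd⟩, hh⟩ := h
  obtain ⟨h1, h2, h3, h4⟩ := drawing_spec hd
  have hr : ∀ i < 3, (d.x (d.k + i) : ℝ) = d.x d.k ∧ (d.y (d.k + i) : ℝ) = terminalHeight i := by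
    intro i hi
    rw [(h4 i hi).1, (h4 i hi).2.1, terminalHeight]
    exact ⟨rfl, by push_cast; ring⟩
  have hl : ∀ i < 3, (d.x (1 + i) : ℝ) = d.x 1 ∧ (d.y (1 + i) : ℝ) = terminalHeight i := by
    intro i hi
    rw [(h4 i hi).2.2.1, (h4 i hi).2.2.2, terminalHeight]
    exact ⟨rfl, by push_cast; ring⟩
  have hk := (k_spec ha).2
  exact {
    pos := by omega
    lt_of_adj := fun a b hab => lt_of_adj ha hab
    adj_last := adj_last ha
    not_adj := not_adj_right ha
    not_ham := not_hasCycleOn ha hf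
    ham_sdiff_edge := hasCycleOn_sdiff_edge ha hh
    ham_sdiff_terminal := fun t ht => hasCycleOn_sdiff_terminal ha hh (Or.inr ht)
    drawing := ⟨_, _, d.x d.k, isStraightDrawing ha hd, fun u hu => Nat.cast_lt.2 (h1 u hu),
      Nat.cast_lt.2 h2, hr⟩
    four_le := hk
    adj_zero := adj_zero ha
    not_adj_left := not_adj_left ha
    ham_sdiff_left := fun t ht => hasCycleOn_sdiff_terminal ha hh (Or.inl ht)
    drawing_both := ⟨_, _, d.x d.k, d.x 1, isStraightDrawing ha hd,
      fun u hu => Nat.cast_lt.2 (h1 u hu), Nat.cast_lt.2 h2, hr,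
      fun u hu hu' => Nat.cast_lt.2 (h3 u hu hu'), hl⟩ }

end PieceData

end DrawingCertificates

/-! ### The certificates -/

section Data

namespace PieceData

/-- A piece of order 46 with 73 edges. -/
def piece46 : PieceData where
  k := 42
  faces := 29
  edges := [
    0x343c080, 0x1e60100, 0x3068180, 0x203c301, 0x3440501, 0x1e2c202, 0x1660282, 0x304c383,
    0x2669603, 0x1e14304, 0xa2c484, 0x1860385, 0x1630405, 0x2014586, 0x184c787, 0x160c488, 0x630688,
    0xa0c709, 0x244060a, 0x3448c8a, 0x201860b, 0x21470b, 0xc0480b, 0x241888c, 0x103078d, 0x62098d,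
    0xc98e, 0x200a8e, 0x104cf0f, 0xc1c910, 0xe04a10, 0x2218911, 0x2444c11, 0x221cb92, 0x8a93,
    0x421113, 0x804a94, 0xe10b14, 0x808d95, 0xe34b96, 0x1a10d16, 0x2234e17, 0x246cc98, 0x3644e18,
    0x346d519, 0x1c10d9a, 0x1a38e9a, 0x1c28f9b, 0x140901b, 0x3234e9c, 0x366531c, 0x323909d,
    0x105111e, 0x284d61e, 0x1c5d09f, 0x2e2919f, 0x1209120, 0x14252a0, 0x325d221, 0x12515a2,
    0x2c292a3, 0x2e593a3, 0x3271324, 0x385d3a4, 0x2c25425, 0x3671526, 0x38594a7, 0x2c554a8,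
    0x2a255a8, 0x3855529, 0x34556aa, 0x2a516ab, 0x28696ac]
  xs := 0xc65d40b71b00b71b00b71b00ab6edeaaa9f3a087a89ef7939d73fc9b85219aa2f893a471931029930f0891ed44904aee8bbe158a46998814ac85e37d843e2b7fc6ad7e9e0e7dd7b87572e575059c741ccc73bbd870cf436bc63866215964947f62c75e5eeb445a91345161554e31164e17f33f51c03afed6394f6637e6cf1e84801e84801e84800f4240
  ys := 0x1e84802dc6c01e84800f4240141d2918e58c142fb0106906180efa12a35515ce921df42713514a1978cf152d0d24f84512237b0f557b16674c13c3ab030d400a3bdd108d9012c03c1733a813ef771adb070f92fa0c50db11da82232de8179cd61ea7760b23bb120d15030d401a57941ded7325e9fd13994220c950197c722dc6c01e84800f4240249f00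
  neighbors := 0x54b15aa06b4f0344b54225aa53194ea94274aad4a546a522338a921c40a11a0429d3213e9d29f5680f133a90f9d369511b368d09b1eb110f3484e1a4c74c17407cd152c74d9614a8c0a2270c912470b122868b94365098e2058a90445470d205c890186090c165090b0e786872a4c589104c788144458a2038606026460108384040a34485063c283022c2010420382042430200b038000142000028300020c101
  edgeCycles := [
    0x30c8b200b5500b4308c88e95, 0x233a0d08ca5d523b203b2415, 0x233a0d0a20dd523b203f4815,
    0x36a135522200d43534b00295, 0x30210cc082ed321734c88415, 0x4533533228a45494cb00115,
    0x4533533228a455302214115, 0x30210cc082fc8dcd30032215, 0x54ca0208f32035a534230a15,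
    0x36b00a5cc88433020bb32295, 0x30210cc082fd5200dcd30215, 0x36b0a85cc88433020bb32295,
    0x30200f532055402d3ccc0015, 0x30210cc082eb734c00d40295, 0x352296b40054a0d200d515,
    0x30210cc082fc8dcd300c2215, 0x434c8555a432053235ac2015, 0x36a32210cc4521154c0a0095,
    0x4333280a555a432053235a15, 0x4333280a5558053554054a15, 0xd4354c0054a04d5252915,
    0x30210cc082ed321734c22095, 0x23322b20352296b40a232295, 0x30200f3402975500eccc8a95,
    0x42d55a432053235ac2a08815, 0x30210cc4521154c032834a15, 0x352296b408cca0d200d515,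
    0xca080c89548ec80b4f33005, 0x4533533228a450c82214115, 0x2254b4a04d480350d5300095,
    0xcd4c88a2eccca029742a95, 0x36a2c802d5402d40a20f4815, 0x30210cc082eccca029742a95,
    0xcd55a08a2ed32175088415, 0x4a3282320352296b40a2320e, 0x30210cc082bcd300a5332215,
    0x5281355480880350d530010e, 0x8234ccca029534b4034ea95, 0x4cb02820008d134f4885490e,
    0x308b203522d0c803295b2415, 0x36a32082d5402d40a20f4815, 0xd4354c0054a08224d5515,
    0x90c811552c0d480235c8295, 0xd4354c0054a04d5332115, 0x8234d321534f48d6b088415,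
    0x233a0a234b534b508d202415, 0x3523d235a816b035208295, 0x30200f532883400534d74815,
    0x20088fd5200dd4f4e8342015, 0x36a32220352296b40a232295, 0x36a32200d40316b40a232295,
    0x5548035a0d3202d4d5ac2015, 0x30200f532055402d40322415, 0x3688880350f354d08d202415,
    0x90b344c5530015283480d15, 0x4333280a555a025734230a15, 0x8222f53cc08d72054c08415,
    0x36888802fd5200dcd5342015, 0x36a32210d5402d0c82223c15, 0x3522954c0054a0d200d515,
    0x554803732028bb8d55ac2015, 0x22cd4354c0054a0d200d515, 0x3b4c85d53556884d088415,
    0x36a32220cd0cad0c82223c15, 0x5548035ba432053235ac2015, 0x20835d5200d4d554e8342015,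
    0x45322954c0054a0d200d515, 0x3022342cd0f34c054c232095, 0x36a32210cc08450c82223c15,
    0x4333280a555a084f34230a15, 0x30210cc082eb408cca0d2a95, 0x3688803500d7342233213c15,
    0x55480255a432053235ac2015]
  terminalCycles := [
    0xc322c802d5402d4083d32215, 0xc08433020bf23734c0232215, 0x114cd4cc8a29154c82214115,
    0xda8c88433020ad0c82223c15, 0xda22200d5d5200dcd5342015, 0xd48a5b4c0054a0d200d515]

/-- A piece of order 49 with 78 edges. -/
def piece49 : PieceData where
  k := 45
  faces := 31
  edges := [
    0x3440080, 0x203c100, 0x1e68180, 0x2240201, 0x3444581, 0x2014282, 0xa3c382, 0x1e60303,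
    0x3069783, 0xc40284, 0x2218404, 0xc14485, 0x1e30386, 0x1860a86, 0xa0c687, 0x630707, 0xe18508,
    0x221c608, 0xc04509, 0x214689, 0xe0478a, 0x244460b, 0x344920b, 0x241c80c, 0x20088d, 0xc90d,
    0x62c98e, 0x1630b8e, 0xe3880f, 0x80488f, 0x1c10a0f, 0x2438c90, 0x400911, 0x808b11, 0x100c992,
    0x420f12, 0x102ce13, 0x1a10c14, 0x1c34d14, 0x185cb95, 0x2e61495, 0x824c16, 0x1208d96, 0x165d097,
    0x1a24e98, 0x3238d19, 0x2465219, 0x3234f9a, 0x1408f1b, 0x122901b, 0x262d09c, 0x104d11c,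
    0x1a54f9d, 0x2a2501d, 0x282111e, 0x145129e, 0x325519f, 0x2a29320, 0x265d521, 0x284d3a2,
    0x3271223, 0x3855323, 0x34716a4, 0x1459325, 0x2c51425, 0x38595a6, 0x286d427, 0x364d527,
    0x2c6d628, 0x2e79529, 0x3c617a9, 0x367972a, 0x3a5962b, 0x38756ab, 0x3a6d72c, 0x347582d,
    0x3a7982e, 0x3c6982f]
  xs := 0xc65d40b71b00b71b00b71b00a44633a22ee9960f8f93a93c9388af8e02ae8b2b8888512e843e2b8363d8806fca7f77527eca337ac1d47a3f527919c3790d5f78194d73c7e173ae2b71c1436f49096f42616dd1256ce7a46b410168230363ec94630476612dc96092a2571f2454316d51615550de76493f1c482e7c472ddc46812b33bfba337b921e84801e84801e84800f4240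
  ys := 0x1e84802dc6c01e84800f424018c763132f0b1f887225aa4518a29c1b6d9c11838015b2d6030d400b4ccf1a1dc61e856811df4f0d55ad16f267100bed1bf94e140e7f0ca84b093c8110eecd200e791359c623af9e0f66b21b48bb17ea811510080bfff8109cff1df663185ed90a2667030d4011fd4b15f4e60f65fc1e8bf625561c17828e120e432dc6c01e84800f4240249f00
  neighbors := 0x5abd72d06c148354c162a48c15a450b95a84cb56265ca53a12abd5154ab13a544a942256951a03ca131e5a8cc8b3e9921f389cf1c2ea8e173698e9b348ce9a4a88d923080f9826890932c80f16287cc942090d102874b141c84a8e226cc110ca4b861e68c0f1c7090e3c4c88d2c4878d186478c284480a0e5c987244448710405880290601103c4880a3450508305041c3430206543830424202022028100bc300001c280002c200020c101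
  edgeCycles := [
    0x103484ad0c20a2894836853391, 0x8d3a9484d0adb2d28cc8c2211, 0x10350a28cc2812b54836853391,
    0x12308488f30ca0800d23557e11, 0x14c80308a354912b54c8cc0111, 0x802d48553ac0085d2d28cca11,
    0xa8cc0822944ad520db2f32211, 0x53a208f30ca0000d23557e11, 0x53a208adcc32808550037e11,
    0x12308ea2520d5244ad0c830a11, 0x53cc8b020845a0b530255e11, 0x14c88308a354912b54c8cc0111,
    0x12308ea2520d5244ad40a30a11, 0x1034c0555c20a203680adb3391, 0x10220d22d4bad334c03280c511,
    0x12308e80d5244ad54cc0a30a11, 0x10220d4f2020b52eb4cd308911, 0xa820956ca3332832825530011,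
    0x10354a028cc012b54836853391, 0x14ca231092414e8d22d020c391, 0x25568cc88c3203323548911,
    0x88cc88d550ecb4a3332030211, 0x14c80a08255a488954c000c391, 0x14c84c21222557ae8882b40211,
    0xb402c8882132a8955eba220aa, 0x1034c0328200348d55a03b3391, 0x802d7522540554ccc200dca11,
    0xa25402d74b4a2d0153080ca11, 0x28b30b42800d5d2c80f534511, 0xb40a0ca0955b28d428ba220aa,
    0x2334c0082d4bad20d4f082911, 0x14c8834008b4d0880a5d4d1611, 0xb52eb4cc8220d4e4a30a8082a,
    0x34d685322d0153080ca2820aa, 0x2245d202d0154d72083732211, 0x53a211682d48553ac0a30a11,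
    0x88d5c8035543b2d28cc8c2211, 0x80bad3332308d200d7534511, 0x223480bd32308d200d7534511,
    0x10350a2eb02812b54836853391, 0x1034c020a20356a555a03b3391, 0x10350ca05d2c80b554ccc01611,
    0x10095350ca04ad408550037e11, 0x53a208f30ca0000b49557e11, 0x155a24ad40a30b215400df11,
    0xae8882b40a0ca0955b2ed0a11, 0xa8208d35b22556cc054c20a11, 0x100955301530828a08234d6d91,
    0x14a28208d355254054c200c391, 0x2222557ae8882b40a136d0a11, 0x1343284c212225568ad0231611,
    0x1034c054c20a2813680adb3391, 0x80d480d32152eb528cc8c2211, 0xae8882b40a1208955b2ed0a11,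
    0x14ca082352f40030848a2cd611, 0x1343284c2122254d22d0231611, 0x13428ba220ad0284c082556d91,
    0xa8208d35b2254054c200dca11, 0x12308e80d5244ad4dac0a30a11, 0x802d752254054c8cc200dca11,
    0x102202d74cd300ca1553321611, 0x10213350ca04ad408550037e11, 0x80d480d32153d2d28cc8c2211,
    0x12308491328d4896bac0a30a11, 0x8cbcc8822944ad48553ac0211, 0x12308490557ae8882b40a30a11,
    0xa8cc854910adb2d28cc8c2211, 0xa82402d74b4a2d0153080ca11, 0x14a28208d6e9254054c200c391,
    0x12308eba220d5244ad40a30a11, 0x802d752254008553c200dca11, 0x12308490548823bebac0a30a11,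
    0x1034c054c20a28248228db3391, 0xea082d32155553c808542211, 0x14a288d5a2c9249500c200c391,
    0xa8240a4f4b4a2d0153080ca11, 0x82ecc8ccc8300a530255e11, 0x10350a2eb02812ec8836853391]
  terminalCycles := [
    0xa3332084ad54cc000354b3e11, 0x14e8823cc3280800d23557e11, 0x4088353a20b52eb4cd30082911,
    0x5203088352034c854f49508911, 0x2a082d3215b2835b28cc8c2211, 0x48c212414e8ac896bac0a30a11]

/-- A piece of order 55 with 88 edges. -/
def piece55 : PieceData where
  k := 51
  faces := 35
  edges := [
    0x226c080, 0x3634100, 0x1a44180, 0x426c201, 0x3c84581, 0x2279001, 0x3670282, 0x3838302,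
    0x1c34502, 0x1a18c83, 0xc45a83, 0x446c284, 0x4288384, 0x4470485, 0x384c406, 0x2638606,
    0x4088687, 0x4280707, 0x3850488, 0x284c788, 0x447c689, 0x3e50889, 0x1c1080a, 0x834c8a,
    0x348470b, 0x3c68e0b, 0x123880c, 0x262490c, 0x407c98d, 0x3480b8e, 0x104c90f, 0x2820a0f,
    0x1210c10, 0x2a50a11, 0x3e54a91, 0x1024b12, 0x2c7ca93, 0x4058b93, 0x2a20d94, 0x2c54d15,
    0x424c16, 0x1008d96, 0x1858e97, 0x3430f17, 0x410f98, 0x804f99, 0x219399, 0x1454d9a, 0x2c28e9a,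
    0x140909b, 0x2e68f1c, 0x3c5d19c, 0x182911d, 0x2e3121e, 0x40109f, 0x529f, 0x30791a0, 0x2261620,
    0x140d121, 0x6012a1, 0x180d222, 0x305d323, 0x2e2d324, 0x160d424, 0x615425, 0xa054a5, 0x302d526,
    0x21d4a7, 0xe197a7, 0x16415a8, 0x2015728, 0xa1d6a9, 0x322d5aa, 0x306562a, 0x32418ab, 0x22659ac,
    0xa3d72d, 0x1e1d82d, 0x203d92e, 0xe4982f, 0x2419aaf, 0x1e49a30, 0x3a41931, 0x32759b1, 0x3a3da32,
    0x2275b33, 0x3a49b34, 0x2445b35]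
  xs := 0xc65d40b71b00b71b00b71b009f39439ddca39c74609638e888b425880938843e2b8341a7790e5c72f32372d9f56f1b5763ab4461b4da5dbd2d54364252ebf052337b5161554ed2d54d838b48d32947962d455a4d4456444425fb433d05433746411ef93ed5553dc07e3d86e23ac5993aa2d939c54039445338ff8336880b35ed7e3508bb34253e3352b73346e432be882d3da128d91628b40a1e84801e84801e84800f4240
  ys := 0x1e84802dc6c01e84800f4240194905137cfe20983325a0d419d9921da347030d4011ebb60ba5ba1e780f16a0692283870df8391b4160137afd0ac7f516d00c1a6634030d401d86d2128345168ef20f52651a009418205b2371b31d020114bc6e1b944f17d18d19e7721670481bba5718e4021deae21ad1c1136f3916c2dd1cc8f510abf51ff5b218f3071ad37a14e5491cb5a51951c4147dc42dc6c01e84800f4240249f00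
  neighbors := 0x66d5a3306d978360d993058d98ac5cd18ae56cd92b5ad17ad4ed582750c96a852c172940cd52050c55284cb15a64ab53a55cad2a432bd49946a922352a109f509911e389901c3a9109d4a88f9b02b11814a84c982e90e172e88d17168cf0b4268b142a74d954e7c503207cb103c7498e246cc1222689911e6c88f1a5ca8d185878c1254a09146060a10509080e5c5870e4c4870c488060270701046480222344050c3c486083868404304020424202021c28100d4c801418280402c200020c101
  edgeCycles := [
    0x125534d280d403a2434088b323d9f, 0x13322a9558008b323f7522322939f,
    0x1482a488d560022d3f7522334c29f, 0x140d403ca154d302434088b323d9f,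
    0x140d403a243552a154c888b323d9f, 0x140d403a24340d4d2a1548b323d9f,
    0x1320a4a3224cd5c820540036a2a9f, 0x12c824a3224cd4881502532232a9f,
    0x1024cd205408a232210d52220379f, 0xad95235208022d3c23558030221f,
    0x14c08c824bdd5208023322356029f, 0x13322e855548e3108ca120e0b369f,
    0x140d40235285562142c808b323d9f, 0x13322e85533cc00c8a483e88b369f,
    0x128b6534332a9558082008b323d9f, 0x14a9558082008b323f7522320939f,
    0x14c08cf289224a3224cd48815029f, 0x14c08c824a3224cd5d5280815029f,
    0x140a354cd420330154c888b323d9f, 0xa8c893354d22215525548014401f,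
    0x13322a954822cc8fcd0081322939f, 0xf5308088dc80360555023370821f, 0xa0e0b369554e003320322554921f,
    0xa8c893355005400235200555481f, 0x14822a21503394cc834c20934379f,
    0x1482a4a3224ca150257522334c29f, 0xa0fd548d48034055208b3760221f, 0xad9532a5560008d482008b323d9f,
    0x14c320c33953222a215020934379f, 0x13322e8555382553320820e0b369f,
    0xa8c893354d2a00510c288554921f, 0x134a824cd20540a0810d52220379f,
    0x15a1558008b323f752233480a939f, 0xa8c893348144233202555222521f, 0xa8c89335555320d222220510821f,
    0x14c023520142cd00a55208b323d9f, 0xa8c89335553aca8208814430221f,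
    0x140d400355a8c2a154c888b323d9f, 0x13322a9558082008b323f7500939f,
    0x14c08ce884a3224cd48815034a29f, 0x1423321558008b323f7522322939f,
    0x1488824a3224cd48815025322c29f, 0x13322e8555388233222520e0b369f,
    0x134b802352083815555420e0b369f, 0x1ad9552a955800235208022cc8f25,
    0x1ea3752233480ce85560022cc8f25, 0xb548d4800408cd54014b4030221f,
    0x134aa5560008d482008b323f6139f, 0x14c08c8d48034254a3224ca15029f,
    0x134aa55600082375482008b323d9f, 0x1024ca1500350084355483090379f,
    0x14c08c824a3224cd5d520c015029f, 0xeccc834c8208815233442310821f,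
    0x140d403a243552a1558008b323d9f, 0x235581608ccc80c8a372008b4f25, 0x2288c8843548880c893348145a01,
    0x134b80235200d015555420e0b369f, 0x134b80235200550838d54054b369f,
    0x14c08c835520c02954c888b323d9f, 0x1482a2033481548d00f522334c29f,
    0xeb0808b4f08d563488cd2033a09f, 0x1024a5400d4023520142cd04c379f,
    0x140d403a2434238d2a1548b323d9f, 0x140d403a2434202320d58d2a14f9f,
    0xea3752233480ce848d58008cce9f, 0xb548d4800084cd540156c030221f, 0xea3752233480ce8020500934379f,
    0x1482b05288b40053354d22334c29f, 0x1482b05201582540554d22334c29f,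
    0x10235034d280d403a24340893379f, 0xea3752233480ce803558008b579f,
    0x13322e8552d80575223229283369f, 0xb548d4800d5013700356c030221f,
    0x13322e8555b383d488c8a4823369f, 0x13034d280d403a243408854815d9f,
    0x140d403a2434238d2a1532233459f, 0x140d403a2434238d2a155402ccf9f,
    0x13005354d280d403a2434002d4f9f, 0xea20354e0f52233480ce8035579f,
    0x108e355012b50035008d48015439f, 0x13322e8080d58008df7522322939f,
    0xb548d4800408cd540156c030221f, 0x108e3550052d0035008d48015439f,
    0x13322e85562d8057522322920369f, 0xb548d4800d504894cf0ec030221f,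
    0x13322e84932d8057522322928ce9f, 0x13322e84c8b5800ddd488c8a48e9f,
    0xea3752233480ce8024b5800c379f]
  terminalCycles := [
    0x5302320928c89335754820815029f, 0x5035008d48050b34055208b323d9f,
    0x503500e890d00213354d2a0054f9f, 0x2d5235200354123700356c030221f,
    0x4cc8ba1558008df7522322920369f, 0x2d5235200102335500536c030221f]

/-- A piece of order 79 with 128 edges. -/
def piece79 : PieceData where
  k := 75
  faces := 51
  edges := [
    0x58c4080, 0x62c0100, 0x60b0180, 0x5cc4281, 0x64b8681, 0x58c9581, 0x6290202, 0x4ac0302,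
    0x4894402, 0x6084383, 0x4270d83, 0x38b2683, 0x62b4284, 0x5a90484, 0x5cb4705, 0x5ec0386,
    0x4abc586, 0x5e84787, 0x4850508, 0x2a94608, 0x2854888, 0x3c90509, 0x5a78909, 0x3c50a0a,
    0x4a8c60b, 0x44bc80b, 0x4688a8b, 0x2a8c98c, 0x50b8c8d, 0x64a128d, 0x3eb490e, 0x5c7cc8e,
    0x5e8080f, 0x4084e0f, 0x4480f10, 0xe54b91, 0x281cd11, 0x1a78c12, 0x3e35012, 0x268cb13,
    0x2a4cb93, 0x3c38c14, 0x1c50d14, 0x4648b15, 0x2488e95, 0x2648f96, 0xe4d217, 0x1a39198,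
    0x327d119, 0x5065499, 0x1c1d31a, 0x4240e1b, 0x2071c9b, 0x404151c, 0x2288f1d, 0x244509d,
    0x228151e, 0xc4909f, 0x261921f, 0x3e3d120, 0x1e353a0, 0xc45421, 0x323d6a2, 0x839323, 0x1a113a3,
    0xe05324, 0x219724, 0x52a1625, 0x64a57a5, 0x805926, 0x1e118a7, 0xa45528, 0xc15728, 0x5061629,
    0x3065829, 0xa41c2a, 0x54c97ab, 0x58aa0ab, 0x52619ac, 0x322582d, 0x123d8ad, 0x215a2e, 0x54a5b2f,
    0x3025ab0, 0x411931, 0x1209bb1, 0x5a32, 0x401d32, 0x3461ab3, 0x5269b33, 0x615c34, 0xdd34,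
    0x1425bb5, 0x3429db5, 0x5469eb6, 0x1409e37, 0x1641cb8, 0x62dfb8, 0x1672339, 0x421e3a, 0x100e03a,
    0x346debb, 0x3629f3b, 0x145df3c, 0x2e221bc, 0x54ae0bd, 0x566e23d, 0x365e13e, 0x63203f,
    0x182e43f, 0x10323c0, 0x58ae5c1, 0x369e242, 0x4e5e2c2, 0x2e5a2c3, 0x2c223c3, 0x569e4c4,
    0x4e5a545, 0x1676446, 0x3a726c6, 0x2c32647, 0x1876648, 0x4c9e549, 0x569a5c9, 0x4c5a64a,
    0x589a74b, 0x4c7674c, 0x3ab274d]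
  xs := 0xc65d40b71b00b71b00b71b00a43bc6a2beb4995f8b96c64b93d10392d99d8ce5578b00488950c9843e2b82379881329f7c33677aa0887760f073e87c6eaddf6af87e6800b867a23265762264e5856286f25f6ccd5e98035aa022589e9756551154d52c54ca8453eac25161555150d4502bbd50209e4f7bcf4e8b194c27bb4bd7f34b35334b20d34a3bd9489e17486a904757c046285f45ca3b4517bd44873c43f9de4398b14394f8432be440e58340573d4033983f3da43eb35e3e8e0c3af61e3a63893a375d39d9ec395c4638e5ca365c3d33fde52c8a142c239e2bf31b2af1481e84801e84801e84800f4240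
  ys := 0x1e84802dc6c01e84800f424018347512e82321eea71c4e4c2712f41730ba1141b619146a144950030d401d51fa20348014697f0c93ae17be391134f51b7323258376215cde1607d70ccacd12a1b11d9f170fd3831b1d4317b79b13767509f9361e8f18157ea4100e0b030d40221c6a12430b203c78183aae1bab360e13941dd1ba19d21e154ddc2009e51726511f1c3021d2da20c50725057a281a901bebbf1344a01990751df0681f78f22072551af4d81edc4f17ea681d232f22971c24d974154e1b10337c1f2b942119081b625519a4c01d8d6626efc4222f1914bb4a19a1832dc6c01e84800f4240249f00
  neighbors := 0x973664b073a3039d2a447833a4c18b324c5892e5447f3233f81321c07336439852a1c27b2613d791e2bc7d1623e572deab751dfba71220387709e3b8905db686f9d376af9eb580f1a323719c1b7ee5a2a62f1ab15ef59af76dd9b074e192e58d9aac74d18a66ec96a752d56a94ad95a548d142444c58224acd4a5030578170a0f1c32c161942b952140c51a0649119a1abd60d5c98f97309d31832b50193aa0f9d249d1122c9109620a8e902a84f151ea8d8f06e4e032298a11528870d248ca122290991267ca931674b0b1468c0a185cb0c40607091068b88167878b0e708070a649050294c81104c5882a40606105048808485042230502063c303042c382023820104242829a6c38010182005634280020c1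01
  edgeCycles := [
    0x1c500d32233a29224cb03b22e29549283520d5f32, 0x112d08d30134e908d888b8c8852903b323220cfb2,
    0x1d4e8a4894ea81482413520d5f20d5622e2220932, 0x1ac895222504c8d5ecc8c88354d122d8ca0888132,
    0x4c8d5ecc8c88354c20a2575522e82229304c132, 0x4c8d5ecc8c8835495523500d6c8ba088a48c132,
    0x1b2d88c808880ecc8c88354d0213220355a094fb2, 0x1d236c8a1488953330008334d288154803322df32,
    0x154cc888db0088a103b323220d53020355a094fb2, 0x4c8d5ecc8c88354c20a257530022e32214a4132,
    0x1b2c543220128941323568d5308d30080d3422132, 0x15481482413520cd58032214b14c88c8948375c32,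
    0x4c8d5ecc8c8835580095322d34cba088a48c132, 0x1d14cb00224c8a33540ec8052cc8b3b322d4883b2,
    0x1ad8b632800843ecc8c882d2334d34a2058888132, 0x1d224c880d4d5a4235b4c8c55340ec80285222132,
    0x1d4ca020c8820a4dbd680c81608cb40488f20cfb2, 0xfc82d740037522d320817008353200cb4048932,
    0x1c0ecc8c88354c080d575b034a088a48c88094fb2, 0x154cca0223680a33481620aa14cc882cc8b3ea3b2,
    0x1d4ca020c8820a4dbd680c81622203b323220cfb2, 0x1d541224c8a33540eca8016208cc882cc8b3ea3b2,
    0x14c8a3355005532322403322df7532c08894c8032, 0xfb32352082d740037522d3520205c000d608132,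
    0x1d236c8a108c882d2334d34a2058c800843eca132, 0x1d4c8820b36f5a03205c020c8820b3f32d01223b2,
    0x1b2c14d0c888823c83c020548207492334d4825b2, 0x154a538c8b0088da028cd2052cc8b3b3308caa3b2,
    0x4c8d5f48cb3280d53082895d24d33200a048932, 0x1d534822848da82548c81608c888f20c84da03db2,
    0x14c8a42348cd354094b14cb00ca0154c8c8915c32, 0x1a94e2c532c03280814b48cd352090ecc8b522132,
    0x1d4f2954d03b200a0a4893220355a093492088fb2, 0x1b2c54322012890c8d48b54c234c0285b4d0883b2,
    0x1d4c8820b36f5a03205c020c8820b3ed5b04083b2, 0xeccc0accd0c8b008c82052d740037522d4a4132,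
    0x1b3320c88ca9223c83213752348205c0201003db2, 0x1acd480817008d8203b3235208321375229003db2,
    0x354888232cec8cc8cc88b8ca12b535020d4a4132, 0x1accc0280d5308a4a2504c8d5f48db0c88b048932,
    0xfb323220b5d000dd48b5332808c820588c04132, 0xfb323220b5d000dd48b4d632808c82058888132,
    0xfb323220b5d000dd48b4c8205888b8ca020c132, 0x1323b34bd6c80328814db334b00a0a48d32a932,
    0x1c0834d302882cca9224cb03b205524a0d48357b2, 0x1323b34bd6c80328814db322d5cb00a0a48c132,
    0x1d60088f36220d5340ec80c08893220355a094fb2, 0x1d5414ca08233220d52534081500904d48357a932,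
    0x1b2d8ca08880ecc8c88354d40813220355a094fb2, 0x1d534800ccec8a122043f20b48cd3481608c88932,
    0x154cc814cb0088da028cd2052cc8b3b322d4883b2, 0x154cc888db0022108d53020355a094fdd3d00a032,
    0x1d4e0823d4c0a0a4893220355a08d4d03b204cfb2, 0x1323b34bd6c80328814db500a0a48d4f2220932,
    0x1c0ecce220d5340ec80c0a0a4893220355a094fb2, 0x1d4e0a8834d302829224cb03b205524a0d48357b2,
    0x1323b34bd6c80328814db334b00a0a48d480932, 0x1d248db2008334d28814b322ceccd2c02808aa3b2,
    0x1b2c43b0c888823c83c020548207492334d4825b2, 0x4c8d5ecc8c8835588ba088a4ca80254c8b4c132,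
    0x1b4c80358210fb32352082d2334d205c023608132, 0x1d156803b22224ca20588220b48cd34a43f322132,
    0x1b2d8ca00885323325534480548890c8d48d213b2, 0x15236c08b632822203b323220d53020355a094fb2,
    0x1538a40ecc8c883888b8ca028207492334d4825b2, 0x154b150c8b0088da028cd2052cc8b3b3308caa3b2,
    0x14c880d568253eeccae20c88354d0254c80c08832, 0x1d2322104d48357d232cca0354935b008ca048932,
    0x1c08348cc8cc88a48db22e85560095222432357b2, 0xebd505328208cc88354c080d575b020c88094fb4,
    0x1b2c532c0328052d2334d512232290ecc8b522132, 0x1b2c43b0c8b0081520814b48cd352090ecc88a132,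
    0x14c880d568253ef22ce03888354d0254c80c08832, 0x1042348cd34cd4852c532c032808154c8c8915c32,
    0x1c08348cc8cc88a48db22e85560093202432357b2, 0x8d34c032055253000835355d25320a153820932,
    0x4c8d5ecc8c8835548575a832d08ba088a48c132, 0x1c5323322292212d08ceac22e85568055c2348532,
    0x4c8d5ecc8c8835580095560d6c8ba088a48c132, 0x154b14cb00c88c228cd540154c8c8900cc8b7dc32,
    0x1acd22c532c03280814b48cd352090ecc8b522132, 0x1d4f2954d03b200a0a4893220355a0934c8840fb2,
    0x1c08348cc8cc88a48db22e855600d6080d48357b2, 0x3750888232cec8cc8cc88b8ca12b5350214a4132,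
    0x172d8b14cb00c883228cd540154c8c8900cc8b7b4, 0x1ad8b14cb00c883220037550052d70ecc8b522132,
    0xdd24d10ec0d48a052003b6029532934c88a503ba, 0x1548b380e220ad8c802134f52354888d00410cf34,
    0x4c8d5ecc8c8835580328095d6c8ba088a48c132, 0x4c8d5ecc8c8835495528e00d6c8ba088a48c132,
    0x1c548ce220d5340ec80c0a0a4893220355a094fb2, 0x110433ebccc882b6320084d3d48d52288aa4c1232,
    0x156a0c8894132357b323220d53508ba088a48c132, 0x4d575a83220357b323220d53508ba088a48c132,
    0x1042348cd6c8d4852c532c032808154c8c8915c32, 0x1c532332229224c8802937540ec8ba00588233f32,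
    0x156c8ba00748cd3540322908b88cc8cc88a48c132, 0x156c8ba155803284a413520d348cc8cc88a48c132,
    0x1020b7a0cdbac81624c88f5233208a132a08c9232, 0x1b2d8c8804b4234c017022233a21520b3680b3d32,
    0x1ac8820a4dbd235122c43b0ca017022229520dd32, 0x1c532332229236a082232c8b524d2d08ba15213b2,
    0x1323d522216320d00d6c8a0a48c548ce220dd32, 0x110d48d4852914c8d22e32808155408003322df32,
    0x1100157dd20548902d56d80523548ba088a4c1232, 0x1041255ecc8c88354d6b3808d522e82229304c132,
    0x1041356b4234c04cdc032214b14c88c8948375c32, 0x15ecc8c883558032848833dd6c8ba088a48c132,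
    0x34c8b4c53233222930d48ba15580082329348532, 0x4d573284883356024c5323322293322e8548532,
    0x23520d5ecc8c88355803284bd6c8ba088a48c132, 0x1d534825300cec8a12210835423608c888f20cfb2,
    0x1c50cc88cf2c00a53220c88335035b01328d33f32, 0x1b2d8c8804b4234c017022233a21520b3690cf3b2,
    0x1022357dd20548902d56003b23548ba088a4c1232, 0x1b4002036eb2072e32008d5223608548ce2243f32,
    0x11323548ba088a4c1303b323220d5600201525db2, 0x1c5323322292213233aa00823588ba17348097732,
    0x1b2d8c880082936eb4234c017022233a215243f32, 0x1c548ce2240b560300a53220cc800355b2280df32,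
    0x1c50cc88cf2c00a53220c8808cd35035b00533f32, 0x1c548ce220d560300a53220cc8148a420d50cf3b2,
    0x1b2d8c8804b4234c017022233a21520b4ce943d32, 0x110437dd20548902dd4ed80523548ba088a4c1232,
    0x1ac884135748d448b10ec3284097022229520dd32, 0x1c532332229224ca12908d2334b603b22e8548532,
    0x5b220b588ba136c8cc8cc88a4ca81483d24c132, 0xfb323220b5b220b5803284bd6c8ba088a48c132]
  terminalCycles := [
    0x703b323220d5340ec8ba088a4893220355a094fb2, 0x132357b323220d53082895d4c0222e32214a4132,
    0x4da03d523500d6c8ba00536c8cc8cc88a48c132, 0x714c8cc88a4893284a32d80ec8ba17322c8d213b2,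
    0x4037a0d22f333321558000d56c8d52288aa4c1232, 0x703b323220c93520cd580ec8ba088a4893284a5b2]

/-- A piece of order 94 with 153 edges. -/
def piece94 : PieceData where
  k := 90
  faces := 61
  edges := [
    0x3cc0080, 0x60c4100, 0x6278180, 0x5ec0381, 0x3cbd701, 0x60ec202, 0x72c4282, 0x76e4402,
    0x627c303, 0x3e79783, 0x60e8384, 0x74ec484, 0x66c4305, 0x72cc585, 0x667c906, 0x5ee8987,
    0x76e0508, 0x70e4608, 0x78ec509, 0x74f0789, 0x78e068a, 0x72b060b, 0x58cc80b, 0x70ac70c,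
    0x56b0a0c, 0x6ee070d, 0x78dc88d, 0x6eacb8e, 0x6cf088f, 0x74b898f, 0x5cd8b0f, 0x40cc910,
    0x5880d10, 0x6cdca91, 0x407d292, 0x38b8e13, 0x5e71413, 0x5664c94, 0x32b0d14, 0x54dcb95,
    0x6ca8c15, 0x52d8c16, 0x5ca4d96, 0x30acc97, 0x5461017, 0x52a8e98, 0x3065099, 0x3268f9a,
    0x348111a, 0x5c74e1b, 0x3aa4f1b, 0x387531c, 0x525cf1d, 0x2ea901d, 0x3a5d19e, 0x322509f,
    0x126939f, 0x2e21220, 0x10614a0, 0x30254a1, 0x1c812a2, 0x3439522, 0x185d223, 0x3a31323,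
    0x18216a4, 0x1a7d7a5, 0x1c35c25, 0x382d5a6, 0x1631826, 0x1469527, 0x1229627, 0x36715a8,
    0x5eb5728, 0x5a6da28, 0x425629, 0x1009aa9, 0x14398aa, 0x362d92b, 0x4299ac, 0x180d82d, 0x621aad,
    0x64b5eae, 0x3ccad2e, 0x1a7ae2f, 0x160dbb0, 0x14119b1, 0x839c31, 0x363db32, 0x1e2dbb2, 0x411db3,
    0x426db34, 0x5a85cb4, 0x601d35, 0x9db5, 0x423de36, 0xa0dd37, 0x1e15f37, 0x836238, 0x5a89eb9,
    0x4485fb9, 0x201dba, 0xa060ba, 0x21223b, 0x203df3c, 0x4241fbc, 0x648a1bd, 0x201603e, 0x444213f,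
    0x22160c0, 0x208e140, 0x46462c0, 0x221e341, 0xe06441, 0x44d21c2, 0x688e6c2, 0x64d2ac3, 0x21a444,
    0xc36e44, 0x48463c5, 0x4692545, 0x22563c6, 0x2a1e4c6, 0x48565c7, 0xe4a648, 0x241aa48, 0x2c1e649,
    0x2a5a749, 0x46d66ca, 0x6a927ca, 0x505674b, 0x48a27cb, 0x2c4a84c, 0x68d6bcd, 0x505a8ce,
    0x6aa294f, 0x2c968d0, 0x4a4a9d0, 0x5096951, 0x4c96b52, 0x6a9abd2, 0x264aa53, 0x4a4eb53,
    0x261ac54, 0x4ed2bd5, 0x649ed55, 0x4c4ecd6, 0x4e9add7, 0x2652cd8, 0x281ae58, 0x4c52dd9,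
    0x3c9eeda, 0x4e52edb, 0x287aedc]
  xs := 0xc65d40b71b00b71b00b71b00acd7b3abd280a3d4a0a39998a2e75e9f84ce9f4a759eaaa19aca869ac0f99871c596f3f996a581962df095ba0594f0a994576193717591c8518fe4398fbab58e861e8dc67b8b2b39898cf98877257fc9c47d69ac7b40d97b05c37a7ec87a6711792c50750d3b74c01b73ddda70d067707a53703d8a7019786e43c56b16376acfc06acfc069f57867f61267ae7465808a64664c6464cf633e60628d13625dcd61f9c95f94405eff7a5c6f125c63a55c44835a35e258a30a57db62566a5d55201654a268534f96528b73512dd3501de54eecb34e9ab74a9ac14a7ea64a4fa849cf874909db458e8543039a3f34223d230e3cf6ec34e3b8345b223322cd3049252ff22f1e84801e84801e84800f4240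
  ys := 0x1e84802dc6c01e84800f424021b9b42660921a78f620480a14104a23a1422175101da95b1ef0072075e31cf4661eb0d619a5b120fc921db0cc1b830a1f71af230e251d6d281ea7a51bef072882a71275a916f5141f18181adce314dc1219775a0c5b9c16889523fcec1fcdb411168c2d38ca1b0097154653212135120bf7268222173e6c2a00a01b7ee04c4b400186a01e246d2588d915745a2a46f52295c50fc7062782a619579d3527171dcd341bb52d2d5199241f041f8e0026b8231bfab61d859518b60c1ab5602886bf230f251d0809204f741b6f5d1e232824bef61615282dc6b81d11fb2952491a90af207d841e821a22a6fe25a9641df6d01bac3b1fb61a1546de2adaca2502e41a7d332dc6c01e84800f4240249f00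
  neighbors := 0xb572ddabb6222faf76cd75d76aaead6ec56a972cd4b75694da5669d2876abc391629c8a15aa50af5a8cf9d4a84e994e8cc954a5ca93465c9855e54291424c88f3e7478b3e6c58d3a646a9322418b2e34583263c1812a3c0b921db87b5613d9b0e03f911a03a8b0a0be7309e396f01e375d0dcae6cfdf3688e9ab382edbb568fdeb44b118a57ce993064f1a3276e96a950e5b2858ed8ac56ddb2b54e19aa4cdd6a60771283b4f540148d58244ecd4a74cc942644c53a26ab10a068b95933eb151f60ad19c70bd11240b51a03c9921e34a929a32a4f995290e97349d09a368ce9b3080f182698d932c78e16447ca102884b942a74b154064a8e1e6cc0f2260b911868c8c50707870c948061a5478d166890b2c4c889185c68c144470a28385880a406051034488083c5040430502024c2010648283042c302042438200bc300101420000b8380020c101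
  edgeCycles := [
    0x55c88f333232888f022234308208c14d8d2022352354ecbb,
    0x5532c882342302334a053635c290088d48d32ce3222340bb,
    0x5522234f14c88cc020894a08290088d48d32cf2053635cbb,
    0x34d3633c08cd2820895808b76322304e02214c09552d3b3b,
    0x34d3633c2322234a82089544d8d2022353b24f0ec332813b,
    0x4a3534b00208c14d8d2022352354f7333232803025c8893b,
    0x54532f322330208230953088ca122bd3c0888eca332d033b,
    0x73cc228d480ccecb02223223308230536348088d48d53b3b,
    0x34d3633c08cd2800895808b76322304e02214c09552d3b3b,
    0x5532d302334a0208235808b76322304e02214c09552d3b3b,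
    0x55c8895808952200d488a5554150c858ccc8ca223c0889bb,
    0x34d62c8ce8cce82202372256022dc020885302554b4f293b,
    0x558cc88290a480352234cb3c81555055002332223c0889bb,
    0x558cc88290a480352234cb3c81555054f3300233200889bb,
    0x558cc8c30823320088ef5481a0d535c29008d20d532d0abb,
    0x5532c8823823320122f74b209d08c08cd2842d4c88c1233b,
    0x74ca228eca332cf2153088ca122bd480ccecb0032222033b,
    0x73cc228d008ccb5482223223308230536348088d48d53b3b,
    0x34d3633d8a020895808b7636c882304e02214c09552d3b3b,
    0x34d363383538a020895808b76322304e02214c09552d3b3b,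
    0x54532f560330208230953088ca122bd3c0888eca332d033b,
    0x5532ccc02334a048235808b76322304e02214c09552d3b3b,
    0x5488d40838cf02334a053635c290088d48d32ce3222340bb,
    0x55ed4e0330202330823055523548022254f0222235d722bb,
    0x55353380008d530208230853635c290088d48d32d0cca0bb,
    0x643343332300020b50554cce8305520333b2c0a0888229bb,
    0x4a382333a2048bb507534b02820cd00c0973308213dc893b,
    0x73cdd20002308a3520333b2c008230536348088d48d53b3b,
    0x4a3534b00208c14d8d2022352354f7333332003025c8893b,
    0x7fb4c03020a3823320122f74b209d4d2c03290b53222233b,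
    0x5532c88234230ca008d52014a0332010088d48d414d8d73b,
    0x5522234f14c8cb0020894a08290088d48d32cf2053635cbb,
    0x5533b208235002334a053635c290088d48d32ce3222340bb,
    0x34d7cce03202202372256022dc82214c09552d3dcc88893b,
    0x73cc88c228d0800ccf02334a008230536348088d48d53b3b,
    0x34d362f34d3222f628082256022dc82214c09552d3dc893b,
    0x55328088ca23548f4ccc8802305552225534b0280c8880bb,
    0x7380f8c88c4d3300c08cd28155328b493a28c230548829bb,
    0x55353223321208d6328f3c2c85d2222dc2082302d0cca0bb,
    0x34d363388cb8a020895808b76322304e02214c09552d3b3b,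
    0x552f223cdb22b2208d08c3280208c14d8d2022352354ecbb,
    0x4a3534b0022ecd20300c0914a0332010088d48d414d8d73b,
    0x74cd4d2020228eca332ca54c2232848af520333b2c00033b,
    0x5522234f63380cc08208c208c14d8d2022352354f74a093b,
    0x34d5283334a15808b7000cc820885302554b4f736808893b,
    0x5532808d4d2c00cca053635c290088d48d32ce03356880bb,
    0x55568cc02334a048235808b76322304e02214c09552d3b3b,
    0x34d32d0208cce232038cc8c20275808f302554b523d4293b,
    0x36d0208cce232022358cc8c20275808f302554b523d4293b,
    0x55ec8888e03f2235a01d0823c0888ea3088ca122ed24ecbb,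
    0x7f4e8ccc800c0828eca332ca54c2232848af534b0012233b,
    0x4a3534b00208c14d8d2022352354f335680f33200302413b,
    0x34d7cce0208d202202372256022dc82214c09552d3dc893b,
    0x34d48dc55000f4a082256022dc020885302554b4f720893b,
    0x34d362955520c30888bda082256022d5302554ca332d033b,
    0x2eca332ca54c2232848af44d3733022e085203a22852833b,
    0x554ed008cd280200e9bb2894c2232848ad8cb38552208cbb,
    0x34d48cb403224533281d6023b4c88302554dd38da022293b,
    0x553533280350080e9a0d534808d20d553d808d636808893b,
    0x55403b408b88c85203a228a03a1eea3088ca122ed24f293b,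
    0x554a088ea3088ca122ed24f603e334d281d408cc0848893b,
    0x73808d6322314ed008cd2802002e9a0d534808d20d553b3b,
    0x55ec88c8290a480352234cb3c88d6805554150823c0889bb,
    0x34d363383538023348082256022dc82214c09552d3cd013b,
    0x7fd00c0828eca332ca54c2232848af534b0037480008833b,
    0x4a358d202222d8174f523d3c8035008cc8030258cc88293b,
    0x4d7021633230c208cc88cc81a0d535c29008d20d532d0abb,
    0x6000d48f4b2115541570acccd54e0034812332cc880229bb,
    0x34d36338014cd54e00348082256022dc82214c09552d3b3b,
    0x7a28d6022dd8cd34a04e33a33008488e02214c09552d3b3b,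
    0x4d633c08cd280322304e20020b50554ccf32a030542081bb,
    0x7f223ccd488d708ca805552225420888288ca234ca8a4f3b,
    0x55222343208a223c5203a228a022548022352294d8d74abb,
    0x4bcd286eb4853088ca122b7008372803025f20088e00ecbb,
    0x4ba68354d2023483554f602358cd34a0080cced00848893b,
    0x2d134d8cf021223ccd3480cc008230536348088d48d53b3b,
    0x55328835023302334a053635c290088d48d32ce3222340bb,
    0x55328088ca23484f0cfc8155488954d2c0008333552000bb,
    0x3534334a158d202222d8174f523d3c8008cc8038cc88293b,
    0x4a3534b00214d8d70a402235234cb536808dccc800c090bb,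
    0x34d362e33520c30888bda082256022d5302554ca332d033b,
    0x558cc8c00227432082332223c088882f2489532ef0cd0abb,
    0x558cc8c0210f432082332223c08888354d70008d3d4d0abb,
    0x552f22200c0adc020885205333b4f7334d2823022b2209bb,
    0x34d3633d822014cd482008d720208958ca274888b5548f3b,
    0x3734a158d202222d8174f523d3c8008cc8030258cc88293b,
    0x55c88e38ccc8ca008dd48340a07a0bb4ca8a092254cbbcbb,
    0x7fd00c082885534b00374800088e20c1554d202348d53b3b,
    0x7fd00c0828d4d2c00dd20002238888022352354c14d8d73b,
    0x5b22358d202222d8174f578cd34a04e33a33008488e00eba,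
    0x34d3633da082255136348088d4ec93d4333520c30888013b,
    0x558cc88290200d488a5554150c805533c82332223c0889bb,
    0x4bcd2853332002dc0003025f3320da022388215d4a0835bb,
    0xc174d7ccc8322408cb400da0223880082d4155333ccaba,
    0x6000d48855505555005750ccd4834812332cc8d8220229bb,
    0x7f4808f5208cce23203020bb41208952200d488a555417bb,
    0x7fccc800c08288ca234da155488954d2c00da02238024f3b,
    0x4d7520d00233200858cc8d2075808ed2488c0955743b0abb,
    0x553280882f2489532ef0a227534b0003490b4333552000bb,
    0x7fd00c082882ea7534b00374800088e08ce842489532ef3b,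
    0x5cda0223fccc800c0828d4d2c008230536348088d48d53b7,
    0x7243b4d3343522a0ca8bb408cc328155328b4922308c17bb,
    0x53cc88c22f4800ccf02334a056022dc020885302554b4eba,
    0x65081200d4885550555530ccd54e0034812332cc880229bb,
    0x552f222000d4885550555577334d2082340294cc08a809bb,
    0x55d2023d482332223c0888ea3088ca122ea743212084ecbb,
    0x36c0d480db4d33480d5202a03529240889d6023cc095573b,
    0x73cd334a8488c8827423083522b2232a2882f2489532ef3b,
    0x558cc88290a22554ca3308c150c80cb3c82332223c0889bb,
    0x36d0233022a0352954880b4b38cd34a009cbcc223284ff3b,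
    0x754880a25200b632ce334d280a533022a0ca8a34ccc8df3b,
    0x553280ed023302334a0554b48d32ce322234042900cc17bb,
    0x553280ed023302334a05552c8d32ce3222340429022097bb,
    0x553280f33023348322304e22a2cd00a1a0ad52489532ef3b,
    0x7a28d6322222dc0334d2848ccb32302122388a8b21756f3b,
    0x558cc8c0b4290b30554cc80dc8305432082332223c0889bb,
    0x553280ed023302334a074d32ef0a09220ed32ce3222340bb,
    0x553280ed023302334a053635c290088d48d32ce3222340bb,
    0x2d400c02375204d13820892232d253e32236cd2814d8d73b,
    0x558cc8c3082332233213c0888d28b54c881d480d6dd4293b,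
    0x558cc8c30a082354f08c1552d3305432082332223c0889bb,
    0x7f223cccc8ca00c082f34a14a2dc020822174f4e8808d5bb,
    0x558cc8d208cc888f022220d5200dd3c220954950c84c293b,
    0x553280ed023302334a0555488d378c88c1380256800897bb,
    0x558cc88290a08533a082350c805b4cb3c82332223c0889bb,
    0x558cc8d208cc888f022238bdc088954c92225432036c293b,
    0x558cc8c0305525432082332223c088882d4dc008d54d0abb,
    0x754880a25d2222d8cb38cd34a0294cc08a832a28d632ef3b,
    0x6428194cce8302b54cb2c032223422f4800ccf02334a07bb,
    0x54532f32233213c0888d63281222dc2082302d00b215cf3b,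
    0x55223bc5203a228a290203528f532085922b708a233207bb,
    0x553280ed023302334a05525b80352234de322304e0095b3b,
    0x738e322308a350208ccb4c08cd2832a28894d8c888d56f3b,
    0x73cc88c22f4800ccf02334a0682b7008221654d2033d3b3b,
    0x558cc882803054320155332234c895d3c82332223c0889bb,
    0x553280ed023302334a05525a228b494f8c88c138208c373b,
    0x54532f32233213c0888d63284882dc2082302d00b215cf3b,
    0x558cc8c30a0820b2354f08c155505432082332223c0889bb,
    0x55223bc5322332068ca12222b708208c20885748f5d282bb,
    0x553280ed023302334a58c88c1380882554cb3d3a208c17bb,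
    0x558cc8c0210dc208cc88cc84f022233552035f003d4d0abb,
    0x4bcd28682b7008372803025f20088e2085d3d4a002335cbb,
    0x55223bc532233206808b708208c20885302554b4f74a093b,
    0x7380f8c88c228d4082332d302334a0536348088d4ec93b3b,
    0x54532f32233213c0888d4d8ca122336d4208230053400f3b,
    0x558cc8c08c8437082332233213c0888d35600d48f5d4293b,
    0x553280ed023302334a009e8354d20234f578c88c13803b3b,
    0x55223bc5203a228a29020b523328f5320843708a233207bb,
    0x558cc8c0b4290b215c830ccc800b7082332233213c0889bb,
    0x558cc8c3082332233213c088885552489532ef0a332d0abb,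
    0x55223bc5203a228a290a0814cce8302ed32cb08a233207bb,
    0x55223bc5322332068354d202348bc20823082254f74a093b,
    0x558cc8c0b4290b24205333a0c0baf082332233213c0889bb]
  terminalCycles := [
    0x128d4d2c08208c14d8d2022352354f7333232803025c8893b,
    0xd34d8cf02334a020895808b76322304e02214c09552d3b3b,
    0x1514cbcc88cc8208230953088ca122bd3c0888eca332d033b,
    0x154ca03b408cc08cd296322304e02214814cced3a0302bfbb,
    0x1514cbcc88cc84f022235c2082302d00b2174888d8ca3cf3b,
    0x15633230c208cc88cc84f022220d535c29008d20d532d0abb]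

/-- A piece of order 97 with 158 edges. -/
def piece97 : PieceData where
  k := 93
  faces := 63
  edges := [
    0x4cd8080, 0x6c9c100, 0x4e98180, 0x72d8201, 0x56e4801, 0x4cadb01, 0x6cb0282, 0x589c302,
    0x4e54383, 0x2a99b83, 0x74d8284, 0x72e8404, 0x74b4485, 0x5ab0585, 0x3a9c386, 0x5874606,
    0x3a54f07, 0x7ce8508, 0x72f8688, 0x74ec509, 0x76b4789, 0x7cec70a, 0x38b060b, 0x5a7098b,
    0x3874b8c, 0x72dc80d, 0x6ef888d, 0x7ce088e, 0x70ec90e, 0x76b890f, 0x5cb498f, 0x50dcb10,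
    0x56a1510, 0x6ee0a91, 0x70b8a12, 0x5c78c13, 0x3c70c93, 0x70a8a94, 0x54b8c14, 0x6ea4b15,
    0x52a8d15, 0x50a5016, 0x3834c97, 0x1a74f17, 0x5460d98, 0x3078e18, 0x3c38e99, 0x1c35299,
    0x2ea8d9a, 0x525d21a, 0x2e6109b, 0x3278e9c, 0x3064f9c, 0x323911d, 0x1a1d71e, 0xe55a9e,
    0x302509f, 0x126519f, 0x2ca5220, 0x50594a0, 0x2e25421, 0x32291a2, 0x1439322, 0x12293a3,
    0x105d424, 0x2c21624, 0x1c11325, 0x835725, 0x14115a6, 0x1209427, 0x4295a7, 0x1009828, 0x5069529,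
    0x34596a9, 0x36699aa, 0x566ddaa, 0x4118ab, 0x2c316ac, 0x18217ac, 0x343192d, 0x8058ae, 0x21deae,
    0x62182f, 0x180da2f, 0x98b0, 0x601c30, 0x5c31, 0x342d9b2, 0x1631a32, 0x362dcb3, 0x160dd34,
    0x2855bb5, 0xe51fb5, 0x62addb6, 0x4cc6eb6, 0x289afb7, 0x615d38, 0xa05f38, 0x1e2dd39, 0x363de39,
    0x1e160ba, 0x406de3b, 0x62821bb, 0x403e03c, 0x219f3d, 0x241dfbd, 0xc4a23d, 0xa1a13e, 0x24528bf,
    0x3e3e0c0, 0x407e2c0, 0x2016141, 0x3e42341, 0x221a3c2, 0x20467c2, 0x60822c3, 0x62c2bc3,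
    0xc4e3c4, 0x264a644, 0x5e7e445, 0x60be5c5, 0x3e86446, 0x42424c6, 0x224e847, 0x5e86548,
    0x428a6c9, 0x44427c9, 0x64866ca, 0x5eca74a, 0x78be74b, 0x60f294b, 0x4a4a8cc, 0x2696a4c,
    0x648aacd, 0x78ca9ce, 0x4646b4f, 0x448eccf, 0x484ea50, 0x2292b50, 0x4a52fd1, 0x60f6bd2,
    0x7af2c52, 0x66caad3, 0x78cec53, 0x4896dd4, 0x668acd5, 0x4692e56, 0x62f6ed7, 0x7aced58,
    0x66d6d59, 0x6a8ef59, 0x7ad6eda, 0x48d2e5b, 0x6896fdb, 0x46d2f5c, 0x4cd705d, 0x6ad305e,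
    0x689b05f]
  xs := 0xc65d40b71b00b71b00b71b00aaae5faa697faa079da5dc12a11fc69eecf29e869d9e1eac9d731e9cf0769c673d98db4f98b67a982eff9792f1978f7c953962952900949f5c93f06c8ebba88e29b28c12c98b80d2895db98944998868e2818c4780da067e3d8a79be8f78b6187580fa71600870db6c6e48df6c1cb26acfc06acfc0692738677bd7647e386346fc631cfa62bbd362511e617e8e5ddae55cbbaf5c1cd75beacd598e035964825904c65834c357bec956070a558cfa54c2ab53ca6452e45852df7c52685d5086444f47174f1b2d4f17a04d89094a6f854951cc4917fb4824a746ce83448d4c41d75e41947f403ef23f93403f24573d747e3c03fd3aa9623a0128385517368a0a35a9e33010cb2f6adc2c28771e84801e84801e84800f4240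
  ys := 0x1e84802dc6c01e84800f424022379527574f1503d41a5b54156de811e35a20caf118cce226079716ffbc1446292ba2502311251d181916c46a190b9627ae5015813a17cc471a899a1794d52260e719791d15791a25610a1221a41eb0861a4cea16acb82d71e020fc2f2613e71440220f08771a5d4c170b391e301f4c4b400186a0369f6919eced16843c1848041fe8e61d7e1b1b21782480831866e319f9601f74dd14397616f3451cbdf01e37d7203dd921e4231a63c41e74b81f608a1cde091839771dc5c62a211b1f6f0e1dfe911c16671a9e4b20ee0e1cc6df245c4717555a1960b71afdc31e08c11ad1b21891731465e11bea25198d2e16c6742205ad1e83f31944661ae3fd175c072908382330cc1b7d6b16093b2dc6c01e84800f4240249f00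
  neighbors := 0xbb7ef5dc16e8b7b382e59c16abb6ad7add6a97ee54b176cd8bd6aacfa56a9d287769439f7284f9b669cd996e84c9d62ace9762bcb7f7e63f8f5aa47b35a4c2954e5ca935654989528c48b4a745913a6c88d3e6c68b2a3458542242832644197221c07b323bd775e2bb9f1e0be8d0a03a79160bc6b45eb57109eb888fdf2e7301db986f1b2a82e5c3466f1d337ce98b0077da830375d813cfdb9e5ee992f54e592a5ad19ad70c172b70c57a858d182c7ac529e52c962948bd6a44cc53a676cd49040b5520609d22146ad42344ad2a232b931958a101a3e9d11f3a9919d36a0f9b2ca5216388d09c6ab8b873288e19307ce983084d182a90d954a74b93386ca131878c8c2080a903458a112460a92326078b1c5078e1a5470d5458681124c909144888a10448080c5c5860a4c60510384880a3c5050834504067830304303821624202022028100dc38000182806c40200020c101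
  edgeCycles := [
    0x1494322088b4a2f2085d2233d54cc88cf4c88cd2820b224fb1,
    0x15520a37394c8880f2024c38d23284c88d52223d52335437b1,
    0x15494c20b4c08f480d5200213085b4ca0cc8b2490823355731,
    0x1494322088b4a2f2085d2233d54cc88cf5233088b23a824fb1,
    0x14950d5088cf4c8d4a8220a25323496808c8953220bce2c9b1,
    0x1494334c88cf4c88cd2a0882894a2f5378a2008bc33a234fb1,
    0x16b2d3ccb0025322223322084c216d33208cd5080cc8b24fb1,
    0x15520b4c0d22394c8880f2024c216d33208cd5080cc8b24fb1,
    0x15494c20b4f480d5234800213085b4ca0cc8b2490823355731,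
    0x1494c8c88c88222d28bc8217488cf55354c88c33a0c0204fb1,
    0x150c890b3048f523308cd2082115494cd08a933d54cc888ab1,
    0x149424c216d33208cd5080cc8b423a82080f2233d522284fb1,
    0x1509300c89535550b24cd0248af6002cd2048f34803c888ab1,
    0x15522200008da54cdf522000f20d4ecc154802532230208ab1,
    0x124c216d3283322d4023d2022333d52003ab2c124208cd55b1,
    0x1494322088b4a2f2085d2233d54cc88cf4c88cd2000b224fb1,
    0x15522200008da54cdf522000f20d4ecd002532235a02208ab1,
    0x1494d2cc0254a220833a03a24c216d33208cd5080cc8b24fb1,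
    0x1494d2cc0248832233553328085b4cc823354a080cc8b24fb1,
    0x149424c0217488cf54222d28bd803a0803c88cf3228b224fb1,
    0x149424c0217488cf54222d28bd803a0034803c88cf0b224fb1,
    0x1494322088b4a2f2085d2233d54cc88cf4d200d0020b224fb1,
    0x1494c8c88c88222d28bc8217488cf55354c88c2cc20c024fb1,
    0x1552222d3034a023d3222080008b52368532d5a22c93b52331,
    0x150cd322228dcc003d322334804c88d40a43ce28808cd3b7b1,
    0x15520d548352c8d20e2c8a088a933a2115494cd2cc12208ab1,
    0x15094e88002332234da15494cd70b3048f54c8334810888ab1,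
    0x15094e88002332234da15494cd70b3048f4b34822890888ab1,
    0x15520d520b52c8d20e2c8a088a933a2115494cd2cc12208ab1,
    0x15520d534888b4d20e2c8a088a933a2115494cd2cc12208ab1,
    0x1494d2cc0388083223355548085b4cc823354a080cc8b24fb1,
    0x102cc13d2022333d5234805525335a008cc88d378b4d2acab1,
    0x14950d5088cf4c8d480d4828233480a45e0cc8b40125b2c9b1,
    0x149424c0217488cf54222d28bd803a0803c88cf5488b224fb1,
    0x1253a20008cc88d3685525335c2cc13d235234810c2322cab1,
    0x1552220080d08a3d4db84cc8d48d20488228c932235db52331,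
    0x16b2d4e8b0025322223322084c216d33208cd5080cc8b24fb1,
    0x149424c0217488cf54222d28bd803a08cc803c88cf0b224fb1,
    0x1553b2232c80208a3305520e0088a933a2115494cd6d548331,
    0x15520a25a0082236952e0bd3234c1394c8d48d200b4d3201b1,
    0x15554c8d480208a25a0082236952e0bd3234c154802322c9b1,
    0x154cf208828c9322340f533208cd4e234813d2888e892437b1,
    0x102dc84c88d76808cd20290f38b4d5400e80352208cc8acab1,
    0x15522200008da54cdf522000f20d4ecc23a802532230208ab1,
    0x15228223b4cbda0823355087534c1548000d76cc8d48022131,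
    0x149424c216d33208cd5080cc8b432088280f2235d2c8884fb1,
    0x1522d4e8b000352203223354085b4cc823354a080cc8b24fb1,
    0x154e8b000352208153223354085b4cc823354a080cc8b24fb1,
    0x1253b3752208002332234da15494cd70b34094ea308808cab1,
    0x15555203548d200088008d433b55309532228f36cc12208ab1,
    0x132242cd0253a0880d7533082115494cd08a933d54d40acab1,
    0x15488a25a0082236952e0bd3234c13d2c8d208823a2322c9b1,
    0x14b52009554c8d4a2c040880008b52368532d5a22c93b52331,
    0x14a25a0082236952e0bd3234c13d2c8d208820153a2322c9b1,
    0x15520ece8b002254c90848213085b4cc823354203322c93f31,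
    0x15520a232254320d22394c8880f2024c2155488b52335437b1,
    0x15228dd3a0883888c8800290f20cd5553534cc0284c88d77b1,
    0x155420a3721322350290f38008cd3b6d555000f680c8880331,
    0x15520a3304e53235234820d5228f32235da00d552d33908131,
    0x1494c8cec0085d2233d533a20222d28bd803a032230b224fb1,
    0x155620d534cc0284c88d40a43ce2c8a02334ecb74e82200ab1,
    0x1334cd5488222cb53a2c000c085b4ca0cc8b2490823354a5b1,
    0x15530d4e8b002254c9084880008b52368532d5a22c93b52331,
    0x1550d4e8b000352203223354085b4cc823354a080cc8b24fb1,
    0x1494d7480833d520302225323497480232254c882f3e0089b1,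
    0x1553c83528800c88cb24c88d03d4cc8233550e234812208ab1,
    0x1535d2020cf5480c088324cd680922bc832254d555800d6931,
    0x1557480805488213655480c08894a2f20c89535540388d3f31,
    0x1582424d803c8dd480d52030222528bc832254d5500e234fb1,
    0x153320d502155488b523354b22328c894f4e8b00035220c2b1,
    0x14cc824c216d33208cd5080cc8b432088280f30dd2c8884fb1,
    0x1494d284803322d089480832208480008df9552a016d337db1,
    0x149420222d28bc8217488cf54ced400e80088cf5488b224fb1,
    0x1553c835288204c388d20488228c9322354888f548cd50df31,
    0x1553b4028482bc832254d555548204094edd3a032230208ab1,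
    0x1334ab2d3ccb02032222333b405b4cc823354a080cc8b24fb1,
    0x1a480232254c882f3e00f20d5d480d5200ca14c8d720289738,
    0x15520a25a0082236952e0bd3234c1394c8d48d20421222c9b1,
    0x1720242cc1394c8d48d2082115494cd08a933d55908c88cab1,
    0x1553b402853235d3a032230208a24082f20c89535553201731,
    0x1a480232254c882f3e00f20b3835d480d52030222532349738,
    0x15520ea03225423a802254c9084821308555222d48cd50df31,
    0x158f52088854354c236a0032240b5cce88538a2088a83357b1,
    0x15520a3304e53235234820d5228f32235da00d5533a3908131,
    0x3322d005c95208480008df9088cf4c8d480d4805b4cdf38,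
    0x15520f94c8d48880c8950c81084821308555222d48cd50ceb1,
    0x1480082237e5548d2054b82f4c8d304f48088cc8823aca25ba,
    0x1494c8cec0e00e80c88c2c89208b4a2f53222f0ced5534a1b1,
    0x15520a3304e53235234820d5228f32235da00d555908482331,
    0x1553b0208cd3f55208040a43d80a120d4edd3a032230208ab1,
    0x15520a3304e5323523483e42036808088a933a2115494cd7b1,
    0x15520ea08c895544a5634a82214c8880f2024c0332cd5437b1,
    0x15520b4e5322334803284dba808cd3a08d40a43ce2d34c8131,
    0x15520ea0222f534c23a802254c908488020348d522fdb52331,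
    0x10057a0022d48de2d34ab3f680c8888cced000c88215553eb1,
    0x15520d54c88d32c083014d35c882282356da8008b52378b331,
    0x1720848088a933a2115494cd2cc1394c8d48d20f908c88cab1,
    0x1334ab3f680c8888ccec0085d2233d528222d28bd800c896b1,
    0x172084d908c88ca3304e5323523482888a933a2115494cd7b1,
    0x1553b402853235d3a032230208a2488c8953220bce35201731,
    0x17208480082237e42322328cc1394c8d48d2054a3cc88d77b1,
    0x102cc13d2022333d5234805525331488b52333b2d3382acab1,
    0x16b3a8088bd4d308948088cc882136554a8132254d5500f7b1,
    0x15520a3304e5323523481080da0234254c88a3cc88d433b7b1,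
    0x10888d73d2022333d5200ca14a2f2085d2233d55800d6acab1,
    0x1552220002df522000cc8b5cc8156e02094c88d328f2208ab1,
    0x1701554d200ca15f488ce8853803c008d35ce532208c88cab1,
    0x108094edcf48088ccf5480328482bc832254d555800d6acab1,
    0x1552220008cc88555752208057536e02094c88d328f2208ab1,
    0x152253233cc88d3289088d2d6d2d80820233a209088cc8f7b1,
    0x155222040c895323dd4882222f602094c88d32854d72208ab1,
    0x1494c8cf32230a020af423a8020233a20802088da54b94efb1,
    0x152253233cc88d3289088d2d732055b80820233a20800af7b1,
    0x1494334c88cf4c88cd2a0e28820348d522e48af4220a036fb1,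
    0x1494322003555332233d322334a820d5228f4220a020d4efb1,
    0x1494372233d322200835438d2a088289534222f32254c8f7b1,
    0x1494372233d322200835438d2a088289534222f5483588f7b1,
    0x1494c8cf32230a308ea00803a24c25523354252223cd334fb1,
    0x1494c8cf32230a308ea00803a24c2155488b52335420954fb1,
    0x155208cd532234cb020c20d4b4cb6d548014e882bcf2208ab1,
    0x14943220d5332233d322334a82095480b14d2d0882842377b1,
    0x1701554d2a0e002352d32bdc2222f534c2214c88232233a8b1,
    0x14943220d5332233d322334a82094e08b14d2d0882842377b1,
    0x15522088108a83568d732054d5530e02094c88d328f2208ab1,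
    0x155208cd532234cb020c154da08cdb548014e882bcf2208ab1,
    0x1494372233d322200808212b53550e34a8220a254d342377b1,
    0x155208cd532234cb020c2094f55481088b1553a214f2208ab1,
    0x16b3a8088bd4d308948088cc882136554a820d522f4d5437b1,
    0x1701554003c003d4ccc0db808008dd52332848353b7208cab1,
    0x1494322003555332233d322334a82092b14d2d0882842377b1,
    0x16b3a8088bd4d308948088cc882136554a820d548f4d5437b1,
    0x1494c8cf32230a1089508ea00803a24c2155488b52335437b1,
    0x1494c8cf32230a308ea00803a24c214d508d488b52335437b1,
    0x15522088008d5a35f5b55300d8025602094c88d328f2208ab1,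
    0x152253233cc88d3289088d2d74d0055b80820233a20820f7b1,
    0x1494c8cf32230a102d08ea00808ce882080d08ad36853357b1,
    0x155208cd532234cb020c20cd55548100291553a214f2208ab1,
    0x1552208828cd08a835732054d5530e02094c88d328f2208ab1,
    0x1494372233d322200808a932054d5438d2a088289534d0d7b1,
    0x15520b4e532233480328925a0232254c89480af38b4d3201b1,
    0x1701554003c052223d53bb808008dd52332848353b7208cab1,
    0x155208cd532234cb020c20d4ce0b6d548014e882bcf2208ab1,
    0x16b3a8088bd4d308948088cc882136554a815b42082205f7b1,
    0x170155400023dc2222f5488db808008dd52332854d7208cab1,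
    0x15520d54c88d32c083054bf6802088de2c828c88bcf2208ab1,
    0x1494322003555332233d322334a820c8914d2d0882842377b1,
    0x1494c8cf32230a308ea00803a24c25523354252223d3234fb1,
    0x152253233cc88d3289088d2d6d5bb80820233a20822032f7b1,
    0x17208480f0b304e532352348055253304d2cc0df908c88cab1,
    0x155208c80530c8b368ed354c88d32c08301553a214f2208ab1,
    0x149432209488cf55332233d322334a8208474220a020d4efb1,
    0x152253233cc88d3289088d2d74d08cdb80820233a20820f7b1,
    0x15520d54c88d32c0830552378b200e88b57a00223cf2208ab1,
    0x170155400022f0cfc03a228bd4db808008dd523328f208cab1,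
    0x1494c8cf32230a308ea00803a24c21d2d488b5233542234fb1,
    0x170155400023323dc2223b4db808008dd52332854d7208cab1,
    0x1494372233d322200808a932054d5438d2a0882895003557b1,
    0x17002088a922f33a214e3553480328f394c8823223288cd7b1]
  terminalCycles := [
    0x5acb4f32c0825322223322084c216d33208cd5080cc8b24fb1,
    0x52532322322088b4a2f2085d2233d54d532230b23a0c024fb1,
    0x5253233cc88c2c8ea00803a24c216d33208cd5080cc8b24fb1,
    0x5acea0222f534c22520223322084d9552a0832254d5500f7b1,
    0x5c055534803285ce00232254c8f70888d35ce532208c88cab1,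
    0x5253233cc88c28c23a80200e893085b4cc8233542033234fb1]

/-- A piece of order 103 with 168 edges. -/
def piece103 : PieceData where
  k := 99
  faces := 67
  edges := [
    0x48d8080, 0x6cb8100, 0x5c90180, 0x6ed8281, 0x48dc501, 0x6cac202, 0x56b8302, 0x5c98383,
    0x4c93283, 0x6ca8284, 0x54ac404, 0x6ea8485, 0x3ab8386, 0x5674586, 0x3a99707, 0x30ac588,
    0x5460608, 0x72a8609, 0x6f04689, 0x82e4709, 0x6adc68a, 0x48d6d0a, 0x303878b, 0x1c74a0b,
    0x72a480c, 0x526088c, 0x6b04c0d, 0x84e490e, 0x8308b0e, 0x302488f, 0x123900f, 0x72e0910,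
    0x70a4a90, 0x5264991, 0x3224b91, 0x84e0e12, 0x52a0a93, 0x5064c93, 0x1c35414, 0x1a75714,
    0x709cd95, 0x4ea0e95, 0x82f4c16, 0x7b09196, 0x3228d17, 0x1424f97, 0x6af6718, 0x2e64d19,
    0x505cf19, 0x2e2909a, 0x70b4e1b, 0x5a9d21b, 0x84ed19c, 0x76b531c, 0x2ca0f1d, 0x4e5929d,
    0x2c5d11e, 0x42501f, 0x140939f, 0x839420, 0x412520, 0x2e21121, 0x10293a1, 0x2c215a2, 0x78ed6a3,
    0x7af1c23, 0x389d2a4, 0x5a714a4, 0x3831525, 0x18595a5, 0x74b54a6, 0x76e97a6, 0x1009da7,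
    0x836928, 0x5871629, 0x74b1929, 0x386962a, 0x343182a, 0x180db2b, 0x621dab, 0x58698ac, 0x7eed7ad,
    0x78fdead, 0x1a56b2e, 0x2a9afae, 0x7ce99af, 0x7ef9a2f, 0x342dab0, 0x1631b30, 0x3669ab1,
    0x586dbb1, 0x74c59b2, 0x46b1bb2, 0x628df32, 0x7cc5cb3, 0x80f9d34, 0x7f01e34, 0x362e0b5,
    0x160e5b6, 0x466dfb7, 0x60f22b8, 0x7ac2738, 0x7cd1d39, 0x68c61b9, 0x80d203a, 0xa53b, 0x6029bb,
    0x7ec9ebc, 0x650213c, 0x78be2bd, 0x5eca4bd, 0x627e1be, 0x3e8e3be, 0x226e0bf, 0x46463bf,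
    0x80ce140, 0x66d2240, 0x222e5c1, 0x64ce342, 0x6886243, 0x427e643, 0x6686444, 0x60be845,
    0x40ce446, 0x64824c6, 0x3e467c7, 0x40866c8, 0x5e828c9, 0x69ca, 0x212bca, 0x22167cb, 0xa0e9cb,
    0x423e6cc, 0x1e7e7cc, 0x403e8cd, 0x44c2a4e, 0x6a8ad4e, 0x1e16acf, 0x3cbe8d0, 0x607aa50,
    0x3c3ead1, 0xe36b52, 0x81ebd2, 0xa06cd3, 0x447ac54, 0x3c42c55, 0x2016cd5, 0xe56ed6, 0x21ee57,
    0x4442dd8, 0xc06e59, 0x201af59, 0x248adda, 0x484b1da, 0x2442f5b, 0x281eedc, 0xc530dc, 0x285705d,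
    0x241b15e, 0x2a9705f, 0x4a9b2df, 0x2897260, 0xc4f161, 0x2653261, 0x244f1e2, 0x484f363,
    0x2697364, 0x4a93365]
  xs := 0xc65d40b71b00b71b00b71b00a207b5a146a19d951a961a868db57c8b89c98ab13084ebfb843e2b822cc57cd04b7bc7907a57117a42ea7741fb76097d75dbf275651874d28374a98174232373c37d73554472dd9272c98d72bb7672901b723044722e2e71d07771bea77192ce713ef871263671190a70fc7c70eacf709f1d7075af70520f704d81704c806fffc56f9efa6f9d156f98946f82f86f05306efd5a6ee3176ec06e6dc5b86d9f776d7ad86d71b86d393e6d0ba16c666f6b75366b3bf56b13de6af0bf6a16cc6a0bb46a0515693239690319682f9867a3c767674f670f7366ed386655a1657ef2650ca0644fb863a4c163a16763809662836e6031035e69f05dada85d9e0b5bd5ed575dfe55368f516d165161554fac044916a1428baf3b7f1736459634a03d1e84801e84801e84800f4240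
  ys := 0x1e84802dc6c01e84800f4240129ba01868021ff60624e3de10289e1c79b31817e70abbcb030d401322700cfd82185b751d5f2d1017050c25b61432361ab5000f2fe60db088110c3c09c3190fc8a31066a9128c6e1645790f2f660fc35b1126d50f831c0dbbfc0ffe52105f1b0f96931212710fd881118f9910d8aa0edb300f681c14d4820ff49d103ec60ca83c11758612e0d5121b4b0fc69110689a11040f11ccea1272850ff6fa20eed50f194311d5ee13a38d125b6f1159711a645d1536ce10937912c9da11f84c0e799e140f0014b16b17b3b6161e7c13d80a133022106a0111c59a14ce721448fb0b31321570f10dbafb12ee811cc46214347510d5511565e4128fd21806840f86200a158213eba51af9f4030d4010021417b6ca24b3e61f661e128109183ec62dc6c01e84800f4240249f00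
  neighbors := 0xc797263079af83c19b0e0b59b15abd8f0deb99315cbb92fdd5d9702eb38add9ad82e56c376cd7b17ad58c76e70abd72ad3a96ead4957294a5d7692eb3628cf9d6284eb32e53b515eb28ab426c98b528c5ab325c7b551c189146648873e6c3a73e0b6af4dda07b4633d89363447d3dfbe85264427141eb881221c09911f39791a03c6b2dfb5751213a6f1e0b7651e1b29315e2d6909eb4a7295a76901cb4670dd33473a2a362fd931572d82b61058b05ef1d2f5ee592f7cdd9a958ddaac54d9aaa68cd6a6bf58a0746f57a352c552976d92a24ac162564b132429490143eed09f38bd49c56a921d36a529b70b4e163cad09e349d11a94a0f8f2e9d0173288e992a94f154c8cd922a90e152e84c972678d131b38b0d227cd111c8cc0e3a6c99016b940b2264a911c7080e2e4c78c185490c168088b125890912605092240488283c40603686811c34605083058406b8303042c38202242010420282019438000182000028280020c101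
  edgeCycles := [
    0x1cf2023424d5548143080015ccd322284c82036834808c3f4b2ca,
    0x1cf4a0142008d09355540015ccd322284c82036834808c3f4b2ca,
    0x1612cb3432cb3221231b3d02322d0cd08bb220d7400008b52974a,
    0x495f3a1553335285730258c82348a082e8822cf205205322094a,
    0x495f7334c800822cf3215f54885382284c82036834808d52c94a,
    0x17d488d2289480e81b38cd322008adcd204d32c8808ba24c8aca,
    0x1ce08a1323320053a4c922820bcc88c9a2b5300149355552203ca,
    0x1612cb3432cb3221231b3d02322d0cd08a8d7400c80008b52974a,
    0x1612cb3432cb3221231b3d02322d0cd08bb200022b74020d2974a,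
    0x1532214c80da0d20231dccd32228cf2023424a50c81d400083f4a,
    0x538308ed888222f5c80a57205523088b3857d02cb3432d3328ca,
    0x495f4836834808c354c056a2cf30214e08a132332005732232ca,
    0x1ce08a1323320053a4c922820bcc88c9a2b424d555480540203ca,
    0x1640b22d34d0cb4d22d0cc88222208adc85d720008ac934a5f54a,
    0x17d488d2289480e81b38cd322008adcd204d33d0008ba24c8aca,
    0x1612cb3432cb3221231b3d02322d0cd08acc200022b7404d2974a,
    0x495b54c056a2cf3080015ccd323304c22080da0d202354b4a14a,
    0x53b280a57210208b3857dccd2d08c8c22080da0d202354b4a14a,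
    0x495f483682332213088b3cc85742214e08a132332214e32232ca,
    0xcce8230cc8822235cc815028824d53ed22d34d0ca33237228ca,
    0x495f7334cf2057c80208b3cc085382284c82036834808d52c94a,
    0x490cf30a0555554c85201f233328014e93248a082f3680888f4a,
    0x15204b2cd0cb2cc8848c6cf5c80c003223328aa35c8008b52974a,
    0x1640b22d34d0cb4d22d0cc88222208b5435c85d7203002225f54a,
    0x53b200d00a54b3851553d033230888884d3432d202c8af54a14a,
    0x1d322c00003520570204d575323334c88a132080da08354b20dca,
    0x1c8d322023424a50c8180ff54c884d3432c8b22b3d0233284894a,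
    0xcce80c8c22002cb3432d54822f2215034a209355548c3f528ca,
    0x495f5320b22cca082f40530d53015a8b3cc232148c88cca122ca,
    0x1b0cd4ca4d5025ed22a88add008014f40822134d0ca33237228ca,
    0xcca24d555334c80d52a0050880c01cc882122820a4e93288f4a,
    0xcce8230c80ed728824d4150211482824ed2029328a4fd7228ca,
    0x1612cb3432cb3221231b3d02322d0d6c80c082a35c8008b52974a,
    0x152102c8b4d3432d32222208adc85d720008c328d4a4d5025f54a,
    0x17488888822b72175c800232233529354097d22d34d0ca332254a,
    0x1d322c00003520570204d575323335500a132080da08354b20dca,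
    0x17d40b22d34d0cb4d32f888222208b5328d72175c80c0824894a,
    0xcca24d55523b3432154d233f4a001480222b481420219028f4a,
    0x4c35d00c201740d520d8227488888822d57d22d34d0ca332254a,
    0x1a20b52f40308014f40d5220a132222134d0ca332326d22a8edca,
    0x1652229ce9522820bcccc8b43588d7203020a8d7210208b52974a,
    0xcca24d555334cc8034814320882538018848a08293a4ca23eca,
    0x495ed22a88b3cc2815cc03548520a132223095134d0ca33232ca,
    0x4c351552d212b432088520a133d202294c880f335015215236ca,
    0x172cd4a4d5025f328a08adc84533548d72000020848a0924ca54a,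
    0x1d4a4d5025f328a08adc84533548d72000089d20848a0924ca54a,
    0xcce80c8c220848a082f334c8008415034a20937e9ce932d28ca,
    0x5280b080d88cd4a000348a2576d54ccc8a6522348a08293a154a,
    0x17cca2822b7d300014cd335284d32c808733880848a0924ca54a,
    0x155801dc88222208adc85d6c82b30a04d297d22d34d0ca332254a,
    0x490cf153200d00a5555548c3f40b2cd0cb4c888bd0c08ca122ca,
    0x1688b5328d723022553208d22820a4e855532e34c80c0824894a,
    0x1d322c020284c8d4a320570204d5504f32f322092282492d20dca,
    0x1d322c020284c8d4a034815c0813555482824328f5e2082d20dca,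
    0x495f328a08b3c54ca0295c84533548d680a126212282493296ca,
    0x175500cd008d09294320820c9dd20088883fd22d34d0ca332254a,
    0x154d034023424a50c82080348bed54cd3202522348a08293a154a,
    0x5280b0820c8cd4a000348a2576d54ccc8a6522348a08293a154a,
    0x1d4a4d5025f502c8b4d3432d32222208adc85d720008c3500894a,
    0x4d62354805d020888822b74029357d40b22d34d0cb4d3284894a,
    0x3538f48802d00000d4814d575323334c88a132080da08354b253,
    0x1534023424a50c82080348bed54cd3230222522348a08293a154a,
    0xcca24a5080c35d2800520088ad22fb5523540b2cd0cb4d2094a,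
    0x1548d0097d22d34d0ca334888822d50d72175c80c0003c888254a,
    0x1614c80da0d3ccc8b43580c8d4882a30c80154a0d550568230f4a,
    0x35328d555323020889523b3432154d32e34c80c0824840a3eca,
    0xcca24d5548143208836089d38cc80053a4c922820bcc8888f4a,
    0x4945500a54b3c54c805d0c0284ce208897502c8b4d3432d3294a,
    0x490cf153200d00a5555548c3f40b2cd0cb55208bd0c08ca122ca,
    0xcca24d5548143208830d680053a03f522348a082f334c8228ca,
    0x480dd00a5c54c8040823df502c8b7200d4cb4ccb43023284894a,
    0x155823225355520a8d7403080c08302232808b5297cd548548d4a,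
    0x17cca2822b7d3034a134cb203608cf280536801228249334854a,
    0x115554a2c012b4d5680c8c22332004f32f322092282492d4a14a,
    0x4945500a54b3c54c8005ccd40548548d532080cf43023284894a,
    0x1d322c00302328489d03533200a082f5320570204d55053a02dca,
    0x17a3b08b4348ba0a0354a2c00562884d55520a08293bb2a4a0f4a,
    0x17d508aca022d4ca35c8804d3435208d6ccf203020c35808a14a,
    0xcca24d5548143208830d6800573200da0d20230fd34cc8228ca,
    0x495f48b4d34328cd222208b3c54ca0295c85d680a133c888254a,
    0x1614d322232cd0d21231b3d0822d0d6c80c082a35c8008b52974a,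
    0x1640b3552154d22d0d6c80c082a35c8c200e8953022288b52974a,
    0x4945617328cf00282493321754a3300a54b3c54c880a132216ca,
    0x1ce08a1323320053a4c922820bcc88c9a2a2c32005355552203ca,
    0x48177dccd320020894320754885382284c82036834808d52c94a,
    0x17cb4d34224cc85bc89608822d4ca35cd203020c35803229854a,
    0x1640b2354cb4d22d0d6c80c082a35c8c200e8208ca022d4a5f54a,
    0x480dd00a5c54c805d0c0284ce2322108b4d343488823df4b494a,
    0x53836089d3d52030223230b402952ce14555134d0c88af548d4a,
    0x490dfd22d34d0ca2d4c8888414b4085d728915200a133c88a94a,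
    0x53836089d3d52030223230b402952ce14555134d0c88af4ca54a,
    0x1558233d482a35d00c20302294c8c2022d4a5f2b44d3422548d4a,
    0x48177cca28225715322c020284cf28c9c552203480a0924b494a,
    0x495f55480a090ca2822cf153280a5721155680a133c88803494a,
    0xcca24d5554c8ab48143208830d680372003480b2830fd7228ca,
    0x1640b32e8952154d22cc8334c8808d092943208c0823012d2bf4a,
    0x480dd00a5c54c80c0d40284c888c2023ded14cca328354c8c94a,
    0x480d715322c0084f15544d343222bd55520c330c08ca126096ca,
    0x172d08ed888802cb3432d488bd7220a8a22c3208214d555230f4a,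
    0xcce0d82274f28d34a015020935558da2094d08a082e94e80f4a,
    0xcce8230cc88c8a612cb2230d56c32cb3235728824a54082bf4a,
    0x1c8284c820368a090ca3d4b200b3cc200ccc056d55335548095ca,
    0x1d322c00815c081355550cc035500a132080db0090ca3d4b20dca,
    0x480d715322c0084f1552cc300a1338294ce8208f354e215236ca,
    0x17cb68822d4ca35cd203020c35800f225880354855348a640d4a,
    0x7cb4d34224cc84c88822d54c35d00c20174035548520a1322153,
    0x1ae3d22c000053a4cc848a082f334c88a132208a84d5548158bca,
    0x4c35d00c2030d2148284ce0a533a202232808b55f355215236ca,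
    0x1d322c00815c08135551353b0cc035500a132080da02bd4b20dca,
    0x1688b5328d7230353203020d82274888c2552352cd0ca332254a,
    0x1640b3350152154d22cc8334c8808d092943208c0823012d2bf4a,
    0xcce80c8c223323528824a5402fb563220922820ba5352d4a14a,
    0x16134822e8ced082d3422d0d22e828d4a2c00562884d550530f4a,
    0x1d20328d4a2c00570204d5563680d328489d0922820ba53a02dca,
    0x1614d322042cd0d21231b3d0822d0d6c80c082a35c8008b52974a,
    0xcca24a50c82302332e34c8824812ca2ec32cb323014c34afeca,
    0x5280b0c8237220c3588222ec056823a553342299028d2a25774a,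
    0x5280b0c81d8c8ccc8d48830d6022990821cee8a082e88225774a,
    0xcca24a50c82302332e34c8824812cd2cb323015b000c34afeca,
    0xcd48284c8d5322224dfb448d520da235b081050c8230088c94a,
    0x480d715322c0084f1554556c3300d540284c820368802f52c94a,
    0x5280b0c8237220c358822223b6c053a553342299028d2a25774a,
    0x4c3515573212b432088520a133d202294c880f335015215236ca,
    0x1688b5328d7230353203020d82274888c2541352cd0ca332254a,
    0x480d715322c0084f1554880bda4cc848bb0cc035500a132216ca,
    0x17cee8a082e8822d4ca35f63680d32e328cc0308c8248420b6ca,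
    0xcd48284c8d5322224dfd20da2111b4556c204143208c02232ca,
    0x17ccc92548a28822d4ca35cd203020c3580c8963332299488d4a,
    0x1503548ba3288288b408010537f54d482134d0cb22c8acf4202bb,
    0x28b4005355ce85522348a082f334c800d54a20ce808ba24c8a53,
    0x1533d00a34c80c08a53230b4029354082d55544d3432c8b22af4a,
    0x17d22d34d0ca334888822d4d508d72175c80c000a133c88832ca,
    0x480dd00a5c54c80c035500a132209b44d34224cc84cc2023deca,
    0x1558d3220a8c3208c08cc8812cd2cb3230a154a0d55455000af4a,
    0x17da548a082e8822d4ca35cd203020c3580c8963332299488d4a,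
    0x490dfd20da0d202309052d022015cc88db33ca245480233400ca,
    0xcce80c8c220848a082f334cf28824a54088020fe9ce932d28ca,
    0x1558d3203020a8d72302332204b22b44d3432cb3230808b52974a,
    0xcca24a50c82302332e34c8824812cb3432cb3230448c34afeca,
    0x53836089d22222f23300d54a02952ce1455d22d34d0ca332254a,
    0x480df6334c8cc0297153220c01cc8821228249328ccba208f74a,
    0x8b40053555528915200c8014e9522820bcccc8cd00652228f4a,
    0x1aa02d5ded22a88f40308014f40d5220a132222134d0ca33232ca,
    0x35328d554d203020c35800f2258803532d202c8b689757228ca,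
    0xcce80c8c22080da2824328d4cd33ca2092950220abfd4b4a14a,
    0x4945488255334cf2054b3cc085382284c89488d22820a4e856ca,
    0x490cf15320300d540284c89488d220356c2d00a5555504e856ca,
    0x15204b2cd0cb2cc8848c6cf408cca323534200022cb5d0040974a,
    0x1d2000f20354a24082d0014d55522d202cca082930fd7233400ca,
    0xcce0d8227488888d7340355280540824dfd2352cd0ca332254a,
    0x1c8284c88884d34328cc8c9b48aa22d50d740308014f40d5203ca,
    0x490bb5530153cc20004f32f334cd21488ca126212282493296ca,
    0x490cf308c85200c81f728014e93248a082f3680888d530155f4a,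
    0x17d488d2289480e81b38cd322008ad40d28834ce808ba24c8aca,
    0x490bd0153cc201740d52148284c8888893ed22d34d0ca33232ca,
    0x4c24d555334a2850c8230cc88520532218848a08293a4ca23eca,
    0x480d7152000f20354a2c01555522d202cca082930fd7233400ca,
    0x1612cb3432cb3221231b3d02322d0cd08bb200022b7402962974a,
    0x490cf30800d3015b554cd3348522328498848a08293a4ca23eca,
    0x490b5005555528915200c8014e9522820bcccc8cd00652228f4a,
    0x552352200dd00c2017408222208f7d40b22d34d0cb4d3284894a,
    0x490d5554a2c005715200c8014e9522820bcccc8cd00652228f4a,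
    0x115554a20d00154ce80c8c22332004f32f322092282492d4a14a,
    0x1652229ce9522820bcccc8b4348ba00c800822540754a20d2974a,
    0x2d40754a20d33a03230882122820bccd320020fe9ce932d28ca,
    0x53a03230882036834808c77334c800822cb40754a2057d2d28ca,
    0x1c8d48082f404d5308000ff54c884d3432c8b22b3d0233284894a,
    0x1c8d4808d092f40308000ff54c884d3432c8b22b3d0233284894a]
  terminalCycles := [
    0x1257d532208d00748ecd0d22208b3cc8572174332214814c882ca,
    0x333c824a540754803230882036834808c77334c80083fd2d28ca,
    0x7382284c8cc8014e93248a082f3223268ad4c80149355552203ca,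
    0x59488a73a548a082f33322d0d22e803200208ad40754a20d2974a,
    0x120f3080cc057dd3485220222208f7d40b22d34d0cb4d3284894a,
    0x5ed22a88add00c20053d035488d3520a132222134d0ca33232ca]

/-- A piece of order 106 with 173 edges. -/
def piece106 : PieceData where
  k := 102
  faces := 69
  edges := [
    0x38b0080, 0x58b4100, 0x5a70180, 0x64b0201, 0x46c8401, 0x388d901, 0x58ec282, 0x7ab4302,
    0x76f4502, 0x5a74583, 0x3a73403, 0x78b0284, 0x64f0384, 0x7910485, 0x88ec705, 0x5cb4586,
    0x7ab8986, 0x62f0607, 0x64c4687, 0x40c8688, 0x4681688, 0x78fc609, 0x7f10889, 0x770478a,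
    0x6ef4a8a, 0x82dcc8a, 0x5c7618b, 0x62fc80c, 0x40c4a0d, 0x84ec78e, 0x890c90e, 0x8708b8e,
    0x8504c0f, 0x62cca10, 0x66fcb10, 0x8110911, 0x7ed0b11, 0x6900d11, 0x810cd92, 0x7abca93,
    0x5eb9593, 0x40cd194, 0x6ebd115, 0x66d0e96, 0x7508e17, 0x86e9017, 0x84e4e18, 0x7304f98,
    0x82d8f99, 0x6cdd499, 0x6b00f1a, 0x68d509a, 0x80f8f1b, 0x7d0d01b, 0x74e521c, 0x42d109d,
    0x668519d, 0x6af929e, 0x72d951f, 0x7ce1320, 0x70e93a0, 0x42d5421, 0x6ea54a2, 0x52bd622,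
    0x403d6a3, 0x1e85723, 0x74ad3a4, 0x56e5524, 0x60f9325, 0x6ac1425, 0x60e17a6, 0x70ad827,
    0x427d728, 0x3ec18a8, 0x6ca1a29, 0x50a5ba9, 0x56999aa, 0x4cd9a2a, 0x5e7962b, 0x3cba1ab,
    0x5279c2c, 0x46462ad, 0x223e8ad, 0x1e7e12e, 0x54e182f, 0x60898af, 0x44a9aaf, 0x36ad9b0,
    0x546db30, 0x3e89d31, 0x488e2b2, 0x3892fb2, 0x3699f33, 0x4c9de34, 0x4ea2034, 0x34a9cb5,
    0x4469db5, 0x5465cb6, 0x326deb6, 0x2ea5c37, 0x505e4b7, 0x2e7a3b8, 0x3465fb9, 0x2089dba,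
    0x3e4213a, 0x206a23b, 0x4c55f3c, 0x2a9e33c, 0x186df3d, 0x32320bd, 0x18566be, 0x16660bf,
    0x342e23f, 0x4e62440, 0x30a24c0, 0x1632541, 0xa42642, 0x1e168c2, 0x3c3a3c3, 0x1c770c3,
    0x202e644, 0x4846bc5, 0x2c9e446, 0x2a5a5c6, 0x2e3a947, 0x2c62748, 0x3026849, 0x125e949,
    0x160e64a, 0x6326ca, 0x2a226cb, 0x105a7cb, 0xa0eb4c, 0x622acd, 0x2c2a7ce, 0x146284e, 0x102a9cf,
    0x1426a50, 0x221ac51, 0xc16cd1, 0x123ad52, 0x42aa53, 0x100aad3, 0x426d54, 0x602b55, 0xadd5,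
    0xa06cd6, 0x202dd6, 0x2646c57, 0x484ee57, 0x261aed8, 0xc07059, 0x412dda, 0x83b0da, 0x212f5b,
    0x4896fdc, 0x4a4f15c, 0x241b05d, 0x264b15d, 0x21f05e, 0xe131de, 0x389735f, 0x241f260, 0x8371e1,
    0x1a77461, 0x4a4b2e2, 0xe373e3, 0x24532e4, 0x281f3e4, 0x4a53365, 0x38534e6, 0x28374e7,
    0x1a734e8]
  xs := 0xc65d40b71b00b71b00b71b009fd98e9e81d1959eac89efda85c9918490e5843e2b83f7727f69a57e8c5c71b6c770842e7060aa6fbc306d770e6a3d3c68223e67d4ac65b84362bbb66253dd6141926131df5f72e35edcb35ebb425e6a785d0fde5c7d275be5375b31cd5b30d65a1c9e59eaca59e86959b5255997a4590bed58671e57d638574fef5742d2569dff55bf8055b2eb54f14754eb685481f1542fb352c16851e96d51615550eb5c5082fa503e2f5005f34f7d764eb69f4da3744d63164d53cb4cc4664b62594b5ab34a37f64a0a1e49984d498f2247e8544799f346d7644688c9464c2b4558eb44b9fa44a86b44133a430fdc42f0c74163e140a2fd40919f404b55400b313f88243e57543cff463bdf7639c53e39107a3902d2380e7f38091337ed1134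d108329b8d2f829a2b9d611e84801e84801e84800f4240
  ys := 0x1e84802dc6c01e84800f42401280f8182c191f581810148e23e043177ed4030d401ba38612feb90abdf91c13a51f5716172cf71168ca0d181c19e4891b6f6e1dec101ca59e1f7c621423891dc77c1c955c1d17a11b1feb18e21b1c02d619f7491e52c21cea0c20cb4d1c533a0b219118f38f230b1e16b90b19e3d51d5348196b721b161f1a48c31c0ccc188d1f17bec1196af21fda661eb3e119e05618f50e1cbd0b1ae303030d4017f61a19ed4d18e719161fc7113f5820100521497c1ba59c1dee7b173c731a0ac418c3ee1804b31ad3011469d71f0c2e16d737195ffd1c2362180db915d6c91ac8a418b20e17726b1d3cd41b87b519ff3516434e1f260914717320c14f18a87317724f1580d11bab1b19d4fd1369b115cdb126376d1da49e176b10114e6e147d3321d46a1901311440372dc6c01e84800f4240249f00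
  neighbors := 0xcda33e607a7083c7a7263bfa72dfc59b262c19f2e0bd9f0deb996edcd18ed43c97aed9659ae32b78f05bb18b058af8afd7bd6ab55c36ea52a382b51a376bd18b72c45b766accb75a9cda16a9d09f56a4f8f6a4c7b36212d9352749974e74b91427c8ab2e53ead2a2428d3e6c68336641a542037813a340714a1b8792e43c5b5d92d7731fbbc31d58ba331d2e7b29fbd692643473120b99af5e336d05f366919f346b11d356309db16afdb35591dbac5325c2960f5cb05eedcaf80f152954f982a037e28150e97a86ccd7a76ac58264709423a31518844e15a2270d61368cd21f6ed111962b92a140c122040bd2a03ca131e38a939c5cb4e942ab149534a0e9a4e98d9730a8c983494d9a2c8d0962e90c172480f122284f1114a4f8a1e7ce0f1c80e0e2074890148898a1a8c80d0caca861c6c88e34589091858a0c146070a2e487850e504070e40487070c30332547820a4460502b46810834604044c5821c24202021c28101a058014182806420200020c101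
  edgeCycles := [
    0x10d6c8954e003f401548d4b340d2282c88cd8a5552334d222024db,
    0x129420d40b8834d0ca11024d50bcca2c824776088d5523224d45b,
    0x4b52d57952352bcc8808cd88230d2282cf889ccc8802354d0022db,
    0x1297d522582235752c8ccb00295608c080520556f32203224d45b,
    0x1297d522582235752c8ccb00295680c88c080520556e83224d45b,
    0x755d00552352cd0348a0b235a08225822350d4d5348880822d54db,
    0x1297d522420a2f548b5cc88c0837550322488d332c0080c8934db,
    0x1297d530208c083755032248880cf322202f548b5cc880c8934db,
    0x1297cd32c024d8d4d2220152352cd0348a0b2003481354d0022db,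
    0x1297b22553d214cc80d4822894836c122020b3688c8935ae8025b,
    0x10a55cc8094d4d22214d28d30322488cba249495a0d4d0db22015b,
    0x7d568802d4853d24f28488c0b5d4d08c0ce8220a352d4b3600c4db,
    0x550d482d4cce0300a0cd62325500896cb340954b2322258223505b,
    0x7d568802d4853d24f28488c0b5d4c0ce8220a352d4b3600c80c4db,
    0x1297d522582235752c8ccb00282d0ccb20936352208540520445b,
    0x755402372434023324885540934bccb0c88348cc328821543544db,
    0x1297d497493c8803375b03202cc02c824d8d488203568888d42db,
    0x5525d24e2900cb730d033a08828d4b52cd883320316d5a2223505b,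
    0x1297cd32c0020812e8b43582154f3255a8532230203688c8934db,
    0x550d4b52cd80c02e0a3548088316d54235a3530b2322258223505b,
    0x15822d3534e20d204c0d5033a088c92232ee92491683534332a15b,
    0x7d2b5488c2552c8000d4b203c83502928ad0024da855200b5344db,
    0x5525d2488888d5548b5037323520342030ce8220a352d4b323145b,
    0x177d4052045f52a00352dccb8a30a2bccc8b00208c8897d20015b,
    0x1297d552c02c824d8d489322928a032cdc80954b22096088d42db,
    0x7f533a0200352db3420888c83d4c808cd804802d4b55f5014810db,
    0x7a0d4cd4b203202d5f30ca22324ad400d40b8828b34815014810db,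
    0x5525d24e2900cb7548230d033a08828d4b52cd80316d5a2223505b,
    0x5525d2488888d5548b5037322b40054030ce8220a352d4b323145b,
    0x177d4052045f52a00352dcca0af50030cd2808c8897d4b000015b,
    0x177d6f500374a0232225f34cb0029220148117d4b2000352c815b,
    0x553c8803282fd4cce20888c83d4c808cd808828d4b55f5014810db,
    0x177d4052045f5338a30a2bccc8034b00208c8897b3c8800d4a95b,
    0x7d568802d4853d24e08c0b5d405340ce8220a352d4b3622880c4db,
    0x1297a135500d334b00324885522d40dccb0c882d432803224d45b,
    0x7d56d08a0830a2824d2eca080353d32eba0882b222d4b52cc8c4db,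
    0x5525d2488888d5548b5037322b400cc030ce8220a352d4b323145b,
    0x1297d5225822357401548d50b2332c00b82334d0ca1023224d45b,
    0x7d56a302d52b422824030a080353d32eba0882b222d4b52cc8c4db,
    0x5525c8a352d57dccc820233603024f0c82e8922302b568888d42db,
    0x550d4b55f73320808cd80c0025d24f0c82e8922302b568888d42db,
    0x1297d5225822357401548d4a88d4c00c28b2332c00b8d2824d45b,
    0x576008d5352cfa08210d4b52cc8c5d5bb422820db229220148085b,
    0x1297cd32c00b8d2824d8d4c080548d4b428b2003481354d0022db,
    0x555568208d4b556d48d68b8233634888534a34c820408d55c8805b,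
    0x5554b022324adb57d6ec88372ca003c8803282fd4cc822014810db,
    0x7f52c8000d4b203cd32952d57d6f3320808cd80214a302014810db,
    0x555488d4b52cd80c20888c8100cb75320316d5ccea01023556005b,
    0x7f52a00352db3402e28c28af3320808cd804802d4b55f5014810db,
    0x552582235752d2eba08828d4b55e08cd8d2225488c82540520445b,
    0x16cc8825e8552ccc88003d2b5c92230954b3829568b00233204db,
    0x7d568802d4853d24e08c0b55340ce8220a352d4b36208cc880c4db,
    0x5525d24e2900cb6d08a0836c0ce8220a352d4b32316d5a2223505b,
    0x177d6f3322c008232225f4800552d8003f52ce0b8a302014810db,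
    0x555568208d482d4cce228948368880336896d5dda081023556005b,
    0x5525d24e2900cb6d08a090340ce8220a352d4b32316d5a2223505b,
    0x1297cd32c02088204ba2d0d72232e8925550352cd0ca00c8934db,
    0x177d6f500374a0232225f34cb002e080148117d4b2000352c815b,
    0x177d4052045f533202bd400c334a0232225f34cb00000352c815b,
    0x13485f4800552d8003f52ce0b822ec88372ca2c088df5014810db,
    0x15822d3534e2289483688803368356888d7d3a08355a08284d42db,
    0x1297cd32c0208800d204d52556d3d2022302d753432803224d45b,
    0x1297d522582235740148d4890290253ccd2282ce32c02c824d45b,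
    0x1297d362c024d8d4d2220152352cd0348a0b2003481354d0022db,
    0x15822d3534e233208c0d5033a088c92232ee92491683534332a15b,
    0x1297a154b334b00322003f53320005205574c834d0ca00c8934db,
    0x1297cd32c00b820033748d52824d8d4c080356888d7c8204d42db,
    0x177d4052045f562bd400c334a0232225f34cb00822000352c815b,
    0x555568208d4b55f253bbcc8808cd88230d2282c816088d5d00445b,
    0x552408d55480557333882332023360220a352d57dcc34008c0a45b,
    0x177dd400dd2808c8897a15480f55a30ccd2c00c93c320883028db,
    0x177d6f3322c008232225f4800552d8003f548e214a302014810db,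
    0x10d35548cd4db3300c023433a088c92232e892525683534332a15b,
    0x572534cb002e08c2c8008d53482dcdb34328084adb4b4c5d48085b,
    0x552408d5352cfa08828d482d4cce22881756f20db229220148085b,
    0x1297dd82235740148d4890290253ccd2282ce00552c02c824d45b,
    0x16a25e855203ec33323322005522dc83688955ae2c08a208cc4db,
    0x7d56880352dcc8f6a0002d4b52cd8055082228488c0b5d4c80c4db,
    0x5724352d57952352bcc8808cd88230d2282cfa088802354d0022db,
    0x10d35548cd4200d4804094f3348a0b3e8220012e8b580cd00524db,
    0x1297d552c02c824d8d489322928a032cdc80954b38216088d42db,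
    0x16a25e855203d540d68c3334b00324f0c82e8922373320c0cc4db,
    0x13485e855203d540d68c3334b00324f0c82e8922373320c2234db,
    0x552408d55480557333a08828d4b55e08cd8d222540534008c0a45b,
    0x4c1548228823222577d6f20da230a0ca1245a0d4d0dccba80015b,
    0x5554b022324adb57cc25533202bb220c332ca003c8803282f4a8db,
    0x5554b0002408d5548533203320d2330ca22324adb57d022cc902db,
    0x7e80353f2022d4b55f5bcdb3202336032820b55023d822014810db,
    0x5555023d82200cdbcdb32023360328208d4b55e3554816088d42db,
    0x10d35548cd400cca082855023b5435420322556ccc80b4328824db,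
    0x4d02322553c8cc214cc8534a15400c08082cda22214d35ae8025b,
    0x10a54d02322553c8cc214cc80a4082cb750030cd2800545ae8025b,
    0x10d35548cd348082855023b5720d56089523688801548d4c8224db,
    0x1297cd32c00b8834d0ca110253cca2c8204cb425d00523224d45b,
    0x15822d3534e01542094c88c0803368356888d724f50320004d42db,
    0x4d022154b3322000fb6d3823d8223bcdb3432808c8895df2490db,
    0x7a0d4d0dccba8000b520b53338055082228d324530a08553a8a4db,
    0x10a54d025200154b6000f54d54b382e0803748d5282535302024db,
    0x1297a154b334b00322003f533203320d343284440254a8c8934db,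
    0x1297d534cb002e20d3432844094f328b2020ba33340148c8934db,
    0x554a352d57952352bcc8808cd88230d2282cfa088802354d0022db,
    0x576008d5352cfa08828d482d4cce22881756f20db229220148085b,
    0x552408d554ca0af32202336208c34ba08828d4b55f500b572802db,
    0x5554b0002408d5548533203320d2330ca22324adb57d102452a45b,
    0x17788c889500b22240a45334a0348752408d554ca0a4114c8245b,
    0x177d40245a0d4d0dc80dccc80af50030cd2808c8897d4b000015b,
    0x7b2a48b53994c8e214a3020148155bccca08828d482d4cce0204db,
    0x555508c102357533214a3020148155bccc83000c9b42d548cc145b,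
    0x7a0d4d0dc842f282495730d00cc8000b52d4b360154208cc80c4db,
    0x4c1548228823222577cdbbc83688d688822af53800154b6000adb,
    0x75550408d554214cc8528c080520556f3320c00326d0b5523304db,
    0x1297a135500d334b003214cc80cc834d0ca111024552a3224d45b,
    0x177cc3b48ccb0023d8223bcdb3432808c8897d52258223568445b,
    0x1778cb340954cc80af50030cd2808c8897c804cb5b32c022042db,
    0x1297cd32c02488cbccb0c8834d0ca11024948c89356835350815b,
    0x4d022154b3322000fb6d3823d8223bcdb3432808c8895df3028db,
    0x1297d522420a2f55a372332c008f60880336f36cd0ca00c8934db,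
    0x4d02322553800f54d50a352bd400c28b223302e34a023222574db,
    0x10d35548cd4200d4804093542f3348a0b235a08222553800f524db,
    0x5525c8cc2488888d555024d2f32c3220d2330ca02952d4b323145b,
    0x10d35548cd4228240a453340333a088c84130cca855203d322a4db,
    0x10a54d02322553c8cc2488803d540934bccb0c88348cc3282544db,
    0x16cc8825f34cb0023d822014ed20812e8b58a155bd400dd2804db,
    0x74ca0d4e0955b422820da220934bd5a2234fa08828d4b52cc8c4db,
    0x554ca2d0ed3823d82e892236d0033282220cca352d4b32316a825b,
    0x553820d5352cfa08828d4b52cd88230d22829020b2dcc880c5a85b,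
    0x72d4e00d4955b422820da220934bd5a2234fa08828d4b52cc8c4db,
    0x4b52d57952352bcc8808cd88230d2282cfa0882b3802354d0022db,
    0x7a0d4d0dc808b2d103ccc80cc8348cc32800003d4a54b52cc8c4db,
    0x75550408d55424f0c828d52800c9b42d548cd3021488c3a22b24db,
    0x74a352435493c88053a2155bc836c0ce8220a3520b533388a204db,
    0x72d4e094c955b422820da220934bd5a2234fa08828d4b52cc8c4db,
    0x552408d554938af32202336208c340ce8220a352d57d4053a2085b,
    0x552408d55493c88053a2155bc836c0ce8220a3520b533388a204db,
    0x553828b43b4e08f60ba2488db400cca08828d4b52cc8c5ab2a0a5b,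
    0x7d5720da220934bd5a222373e82221080b54a3520b533388a204db,
    0x1778cb340954cc80af50030cd2808c8897c80552db32c022042db,
    0x554a352d57823363488952368888ca353208522d5cfa0888408adb,
    0x5d532152d6208c0824d2f55032248880cf322202f55cc880134db,
    0x10a54d0233a33092232ef34320a354a094d4c0812491683534295b,
    0x15822d3534e22894836c0ce8220ac97493c88033683568888d42db,
    0x16cc8825f34cb0093c32088053a2155bd400dd280568b4350815b,
    0x16a25f34cb0080c882055035590bca093455750030cd2808cc4db,
    0x1297cd32c020882194fce3320d34328440934ba8803d48c8934db,
    0x15822d3534e01542094c88c080e88b3682b5008d5c93d40c80015b,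
    0x750248a0d4d0a2d0233a33092232f32c3220d2330ca208550d5156,
    0x4b4094801d802354d4b382e20d2330ca208550d5754a08c20aa85b,
    0x4d34ac80f32152d57dcc8808cd88230d2282ce2320d3283082aa55,
    0xd3accd4200d4804093542f3348a0b388c894c87dd8223554945b,
    0x5725321b55d48d4b35200208ad4d4200d2282ce232008d5340085b,
    0x75525534a353208e002b56348895236888d388c8023725321b54db,
    0x1297a135500d334b00320155ccc8528c080336f3320c094d1845b,
    0x3f30ca22284d217cd32c00b88348408d54235cca2c821d822350d6,
    0x129502520076008d5352ce0b8200dd2354a0936353020152022db,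
    0x38c8922953408c8954f23308533200082cdd320d34328402e802d6,
    0x4d02322553c8cc214cc80020b374c83480f30ca2222575ae8025b,
    0x5cc854b58d22214d28d30322488cba2494e08d5a0d4d0db22015b,
    0x4d02322553c8cc214cc80a4082cb750030cd280814d4c5ae8025b,
    0x10a54d02322553c8cc214cc80a4082cb750030cd2808cc5ae8025b,
    0x4a4a54089ccc8802354d4b382e0803748d5282535302025d48085b,
    0x4b4089ccc8802354d4b382e0803748d5282095b35302025d48085b,
    0x5d53215354e208c0824d2f55032248880cf322202f55cc88034db,
    0xd548cd4200d4804093542f3348a0b388c894c87dd8223554945b,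
    0x12c92b502322553c8cc2488803d522d40dccb0c88348cc3288c4db,
    0xd3acd8823020934bd540ce8220ac8954f4922200f55cc880c4db,
    0x4d02322553c8cc2488803d540934bccb0c88348cc3288215b44db,
    0x10a5408752420a2f54d28dc8a348cc24f0c828d5282535302024db,
    0x12c854d02322553c8cc2488803d522d40dccb0c88348cc3288c4db,
    0x7a0d4d0a2d28950233a33092232f282495750030b0c8d2808cc4db,
    0x5d532156b36208c0824d2f55032248880cf322202f55cc880c4db,
    0x155d56880353c8cc24f0c828d528c08522302ce23222d3408c895b,
    0x4d02322553c8cc214cc80a4082cb750030cd28084eb4c5ae8025b,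
    0x12d3508035201024d50bccd2282c8d682088d1d53800f522134db]
  terminalCycles := [
    0x4a5f34cb0008204ba2d0d608553cc95682532230203688c8934db,
    0x4a5ec8954f485332034b022894836c122020b3688c8935ae8025b,
    0x4a5f54c8208c083755032248880cf322202f548b5cc880c8934db,
    0x1e8353428b4a2b50233a33092232f282495750030b0c8d2808cc4db,
    0x1754c854eb36208c0824d2f55032248880cf322202f55cc880c4db,
    0x34eb36208c348a0a4082cb73220316bd4b235a082234754e0025b]

end PieceData

theorem isPiece_46 : IsPiece 42 PieceData.piece46.graph :=
  PieceData.isPiece (d := PieceData.piece46) (by decide +kernel)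

theorem isPiece_49 : IsPiece 45 PieceData.piece49.graph :=
  PieceData.isPiece (d := PieceData.piece49) (by decide +kernel)

theorem isPiece_55 : IsPiece 51 PieceData.piece55.graph :=
  PieceData.isPiece (d := PieceData.piece55) (by decide +kernel)

theorem isPiece_79 : IsPiece 75 PieceData.piece79.graph :=
  PieceData.isPiece (d := PieceData.piece79) (by decide +kernel)

theorem isPiece_94 : IsPiece 90 PieceData.piece94.graph :=
  PieceData.isPiece (d := PieceData.piece94) (by decide +kernel)

theorem isPiece_97 : IsPiece 93 PieceData.piece97.graph :=
  PieceData.isPiece (d := PieceData.piece97) (by decide +kernel)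

theorem isPiece_103 : IsPiece 99 PieceData.piece103.graph :=
  PieceData.isPiece (d := PieceData.piece103) (by decide +kernel)

theorem isPiece_106 : IsPiece 102 PieceData.piece106.graph :=
  PieceData.isPiece (d := PieceData.piece106) (by decide +kernel)

end Data

/-! ### The orders reached by gluing -/

section Orders

/-- The numbers by which gluing a piece with the graph of one of the certificates raises the order:
the orders of these pieces minus five. -/
def pieceIncrements : List ℕ := [41, 44, 50, 74, 89, 92, 98, 101]

theorem exists_isPiece {a : ℕ} (ha : a ∈ pieceIncrements) : ∃ G, IsPiece (a + 1) G := by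
  simp only [pieceIncrements, List.mem_cons, List.not_mem_nil, or_false] at ha
  rcases ha with rfl | rfl | rfl | rfl | rfl | rfl | rfl | rfl
  exacts [⟨_, isPiece_46⟩, ⟨_, isPiece_49⟩, ⟨_, isPiece_55⟩, ⟨_, isPiece_79⟩, ⟨_, isPiece_94⟩,
    ⟨_, isPiece_97⟩, ⟨_, isPiece_103⟩, ⟨_, isPiece_106⟩]

theorem exists_isRightCap_add {a v : ℕ} (ha : a ∈ pieceIncrements)
    (hv : v = 0 ∨ ∃ G, IsRightCap (v + 1) G) : ∃ G, IsRightCap (v + a + 1) G := by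
  obtain ⟨H, hH⟩ := exists_isPiece ha
  rcases hv with rfl | ⟨G, hG⟩
  · exact ⟨H, by simpa using hH.toIsRightCap⟩
  · exact ⟨_, by simpa [add_assoc, add_comm, add_left_comm] using hG.glueAt hH⟩

/-- Whether `v` is a sum of at most `n` increments. -/
def isIncrementSum : ℕ → ℕ → Bool
  | 0, v => Nat.beq v 0
  | n + 1, v => Nat.beq v 0 ||
      pieceIncrements.any fun a => Nat.ble a v && isIncrementSum n (v - a)

theorem exists_isRightCap_of_isIncrementSum {n v : ℕ} (h : isIncrementSum n v = true) :
    v = 0 ∨ ∃ G, IsRightCap (v + 1) G := by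
  induction n generalizing v with
  | zero => exact Or.inl (Nat.beq_eq ▸ h)
  | succ n ih =>
    rw [isIncrementSum, Bool.or_eq_true, Nat.beq_eq, List.any_eq_true] at h
    refine h.imp id ?_
    rintro ⟨a, ha, h⟩
    rw [Bool.and_eq_true, Nat.ble_eq] at h
    simpa [Nat.sub_add_cancel h.1] using exists_isRightCap_add ha (ih h.2)

theorem exists_isRightCap {v : ℕ} (hv : 172 ≤ v) : ∃ G, IsRightCap (v + 1) G := by
  induction v using Nat.strong_induction_on with
  | _ v ih =>
    by_cases h : v < 213
    · have : ∀ i < 41, isIncrementSum 5 (i + 172) = true := by decide +kernel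
      have := this (v - 172) (by omega)
      rw [Nat.sub_add_cancel hv] at this
      exact (exists_isRightCap_of_isIncrementSum this).resolve_left (by omega)
    · have := exists_isRightCap_add (a := 41) (by simp [pieceIncrements])
        (Or.inr (ih (v - 41) (by omega) (by omega)))
      rwa [Nat.sub_add_cancel (by omega)] at this

end Orders

theorem theorem10 (n : ℕ) (hn : 177 ≤ n) :
    ∃ G : SimpleGraph (Fin n), G.Connected ∧ IsPlanar G ∧ IsK2Hypohamiltonian G := by
  obtain ⟨G, hG⟩ := exists_isRightCap (v := n - 5) (by omega)
  obtain ⟨k, rfl⟩ : ∃ k, n = k + 4 := ⟨n - 4, by omega⟩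
  rw [show k + 4 - 5 + 1 = k by omega] at hG
  exact hG.exists_graph
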